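/- Let $d\ge1$ and $s\ge0$. For real-valued $f\in L^2(\mathbb R^d)$ let $\hat f(\xi)=(2\pi)^{-d/2}\int_{\mathbb R^d}f(x)e^{-ix\cdot\xi}\,dx$ be the unitary Fourier transform (extended to $L^2$), and put $$\|f\|_{\dot{\mathcal F}^{r,p}}=\Big(\int_{\mathbb R^d}|\xi|^{rp}|\hat f(\xi)|^p\,d\xi\Big)^{1/p},\quad \|f\|_{r}=\|f\|_{\dot{\mathcal F}^{r,1}},\quad \|f\|_{r,\infty}=\sup_{k\in\mathbb Z}\int_{2^{k-1}\le|\xi|<2^k}|\xi|^r|\hat f(\xi)|\,d\xi,$$ $$\|f\|_{\dot{\mathcal F}^{r,1}_\nu}=\int_{\mathbb R^d}|\xi|^re^{\nu|\xi|}|\hat f(\xi)|\,d\xi ,$$ so that $\dot{\mathcal F}^{0,2}=L^2$. Let $f_2(y)=(y^3+6y^2+7y+1)e^y-1=\sum_{j\ge1}\frac{(j+1)^3}{j!}y^j$, and let $y_*>0$ satisfy $f_2(y_*)\le1$. Let $h_0\in\dot{\mathcal F}^{0,2}$ be real-valued with $\|h_0\|_2<y_*$, and assume moreover that $\|h_0\|_{-d,\infty}<\infty$,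 $h_0\in\dot{\mathcal F}^{s,1}$ and $h_0\in\dot{\mathcal F}^{2,2}$. Then there is a unique global solution $h\in C^0([0,\infty);\dot{\mathcal F}^{0,2})$ of $$h_t=\Delta e^{-\Delta h}\ \text{ in }\mathbb R^d,\qquad h(0)=h_0,$$ (in the sense of tempered distributions, integrated in time, with $\Delta h(t)\in L^\infty$ for every $t\ge0$) which satisfies $$\|h(t)\|_2+\sigma\int_0^t\|h(\tau)\|_6\,d\tau\le\|h_0\|_2\quad(t\ge0),\qquad \sigma=1-f_2(\|h_0\|_2).$$ Further, there are a continuous strictly increasing function $\nu:[0,\infty)\to[0,\infty)$ with $\nu(0)=0$, so that $\nu(t)>0$ for $t>0$, and constants $c,C,C'>0$, such that: 1. $c\,t^{1/4}\le\nu(t)\le C\,t^{1/4}$ for all $t\ge1$; 2. $h\in C^0([0,\infty);\dot{\mathcal F}^{s,1}_\nu)$, that is, $\|h(t)\|_{\dot{\mathcal F}^{s,1}_{\nu(t)}}<\infty$ for all $t\ge0$ and $t\mapsto|\xi|^se^{\nu(t)|\xi|}\hat h(\xi,t)$ is continuous from $[0,\infty)$ to $L^1(\mathbb R^d_\xi)$;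 3. $\|h(t)\|_{\dot{\mathcal F}^{s,1}_{\nu(t)}}\le C'(1+t)^{-(s+d)/4}$ for all $t\ge0$. -/

import Mathlib

open MeasureTheory Filter
open scoped ENNReal Topology SchwartzMap FourierTransform Laplacian

noncomputable section

namespace ExpPDE

/-- The space `ℝ^d` with its Euclidean norm. -/
abbrev E (d : ℕ) : Type := EuclideanSpace ℝ (Fin d)

/-- Real-valued square integrable functions on `ℝ^d`. With the unitary Fourier transform below
this is the space `Ḟ^{0,2}`, with the same norm. -/
abbrev L2 (d : ℕ) : Type := Lp ℝ 2 (volume : Measure (E d))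

/-- A real-valued `L²` function regarded as a complex-valued one. -/
def toComplex {d : ℕ} (f : L2 d) : Lp ℂ 2 (volume : Measure (E d)) :=
  Complex.ofRealCLM.compLp f

/-- The unitary Fourier transform with angular frequencies,
`f̂(ξ) = (2π)^{-d/2} ∫ f(x) e^{-i x·ξ} dx`, extended to `L²` by Plancherel. Mathlib's transform `𝓕`
on `L²` is the extension of `η ↦ ∫ f(x) e^{-2πi x·η} dx`, so that
`f̂(ξ) = (2π)^{-d/2} (𝓕 f)(ξ / 2π)`. -/
def hat {d : ℕ} (f : L2 d) (ξ : E d) : ℂ :=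
  (((2 * Real.pi) ^ (-(d : ℝ) / 2) : ℝ) : ℂ) *
    (𝓕 (toComplex f) : Lp ℂ 2 (volume : Measure (E d))) ((2 * Real.pi)⁻¹ • ξ)

/-- The norm of `Ḟ^{s,p}`: `(∫ |ξ|^{sp} |f̂(ξ)|^p dξ)^{1/p}`, with values in `[0,∞]`. -/
def FNorm {d : ℕ} (s p : ℝ) (f : L2 d) : ℝ≥0∞ :=
  (∫⁻ ξ : E d, ENNReal.ofReal (‖ξ‖ ^ (s * p)) * ‖hat f ξ‖ₑ ^ p) ^ (1 / p)

/-- The norm of `Ḟ^{s,1}`, or `s`-norm: `∫ |ξ|^s |f̂(ξ)| dξ`. -/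
def sNorm {d : ℕ} (s : ℝ) (f : L2 d) : ℝ≥0∞ :=
  ∫⁻ ξ : E d, ENNReal.ofReal (‖ξ‖ ^ s) * ‖hat f ξ‖ₑ

/-- The dyadic shell `C_k = {ξ : 2^{k-1} ≤ |ξ| < 2^k}`. -/
def shell (d : ℕ) (k : ℤ) : Set (E d) :=
  {ξ | (2 : ℝ) ^ (k - 1) ≤ ‖ξ‖ ∧ ‖ξ‖ < (2 : ℝ) ^ k}

/-- The Besov-type `s`-norm: `sup_{k ∈ ℤ} ∫_{C_k} |ξ|^s |f̂(ξ)| dξ`. -/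
def besovNorm {d : ℕ} (s : ℝ) (f : L2 d) : ℝ≥0∞ :=
  ⨆ k : ℤ, ∫⁻ ξ in shell d k, ENNReal.ofReal (‖ξ‖ ^ s) * ‖hat f ξ‖ₑ

/-- The function `ξ ↦ |ξ|^s e^{ν|ξ|} f̂(ξ)`. -/
def analyticWeight {d : ℕ} (s ν : ℝ) (f : L2 d) (ξ : E d) : ℂ :=
  ((‖ξ‖ ^ s * Real.exp (ν * ‖ξ‖) : ℝ) : ℂ) * hat f ξ

/-- The norm of `Ḟ^{s,1}_ν` (at a fixed radius `ν`): `∫ |ξ|^s e^{ν|ξ|} |f̂(ξ)| dξ`. -/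
def analyticNorm {d : ℕ} (s ν : ℝ) (f : L2 d) : ℝ≥0∞ :=
  ∫⁻ ξ : E d, ‖analyticWeight s ν f ξ‖ₑ

/-- `h ∈ C⁰([0,∞); Ḟ^{s,1}_ν)` for a time-dependent radius `ν(t)`: all the norms are finite, and
`t ↦ |ξ|^s e^{ν(t)|ξ|} ĥ(ξ,t)` is continuous on `[0,∞)` with values in `L¹(dξ)`. -/
def ContinuousInAnalytic {d : ℕ} (s : ℝ) (ν : ℝ → ℝ) (h : ℝ → L2 d) : Prop :=
  (∀ t : ℝ, 0 ≤ t → analyticNorm s (ν t) (h t) < ∞) ∧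
  ∀ t₀ : ℝ, 0 ≤ t₀ →
    Tendsto
      (fun t : ℝ => ∫⁻ ξ : E d,
        ‖analyticWeight s (ν t) (h t) ξ - analyticWeight s (ν t₀) (h t₀) ξ‖ₑ)
      (𝓝[Set.Ici 0] t₀) (𝓝 0)

/-- `f₂(y) = (y³ + 6y² + 7y + 1) e^y - 1 = ∑_{j ≥ 1} (j+1)³ y^j / j!`. -/
def f₂ (y : ℝ) : ℝ :=
  (y ^ 3 + 6 * y ^ 2 + 7 * y + 1) * Real.exp y - 1

/-- `Δf = w` in the sense of tempered distributions, with `w` an essentially bounded function. -/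
def IsWeakLaplacian {d : ℕ} (f : L2 d) (w : E d → ℝ) : Prop :=
  MemLp w ∞ (volume : Measure (E d)) ∧
  ∀ φ : 𝓢(E d, ℂ), ∫ x, (w x : ℂ) * φ x = ∫ x, (f x : ℂ) * (Δ φ) x

/-- `h` solves `h_t = Δ e^{-Δh}` on `[0,∞)` with initial value `h₀`, in the sense of tempered
distributions: the spatial Laplacian `w(τ) = Δh(τ)` is a bounded function at every time, and
`⟨h(t),φ⟩ = ⟨h₀,φ⟩ + ∫_0^t ⟨e^{-w(τ)}, Δφ⟩ dτ` for every Schwartz function `φ` and every `t ≥ 0`. -/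
def SolvesPDE {d : ℕ} (h₀ : L2 d) (h : ℝ → L2 d) : Prop :=
  ∃ w : ℝ → E d → ℝ,
    (∀ τ : ℝ, 0 ≤ τ → IsWeakLaplacian (h τ) (w τ)) ∧
    ∀ φ : 𝓢(E d, ℂ), ∀ t : ℝ, 0 ≤ t →
      IntervalIntegrable
        (fun τ : ℝ => ∫ x, (Real.exp (-w τ x) : ℂ) * (Δ φ) x) volume 0 t ∧
      ∫ x, (h t x : ℂ) * φ x =
        (∫ x, (h₀ x : ℂ) * φ x) +
          ∫ τ in (0 : ℝ)..t, ∫ x, (Real.exp (-w τ x) : ℂ) * (Δ φ) x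

/-- Global solutions of `h_t = Δ e^{-Δh}` with `h(0) = h₀`, in `C⁰([0,∞); Ḟ^{0,2})`, satisfying
`‖h(t)‖₂ + σ ∫_0^t ‖h(τ)‖₆ dτ ≤ ‖h₀‖₂` with `σ = 1 - f₂(‖h₀‖₂)`. Only times `t ≥ 0` matter. -/
structure IsGlobalSolution {d : ℕ} (h₀ : L2 d) (h : ℝ → L2 d) : Prop where
  initial : h 0 = h₀
  continuousOn : ContinuousOn h (Set.Ici 0)
  equation : SolvesPDE h₀ h
  energy : ∀ t : ℝ, 0 ≤ t →
    sNorm 2 (h t) +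
      ENNReal.ofReal (1 - f₂ (sNorm 2 h₀).toReal) * ∫⁻ τ in Set.Icc 0 t, sNorm 6 (h τ)
      ≤ sNorm 2 h₀

end ExpPDE

end

/-!
On the Fourier side the equation `h_t = Δ e^{-Δh}` is an ordinary differential equation at each
frequency, coupled by convolutions. With `ρ = |ξ|`, `p = ĥ` and `u = ρ² p` (the transform of `-Δh`)
it reads

  `p_t = -ρ⁴ p - ρ² ∑_{j ≥ 2} u^{*j} / j!`.

**Existence.** Replacing every term by its absolute value and the sign of the nonlinearity by `+`
gives a monotone problem with values in `[0,∞]`, whose minimal solution is the `majorant`; it is the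
increasing limit of Picard iterates, so that no convergence has to be proved. Integrating against
`ρ²`, and using `(x₀ + ⋯ + xₙ)⁴ ≤ (n+1)³ (x₀⁴ + ⋯ + xₙ⁴)` to distribute the total factor `ρ⁴` over
the convolution factors, bounds the nonlinearity by `f₂(‖·‖₂) ‖·‖₆`, which the dissipation
`-‖·‖₆` absorbs: this is `majorant_energy`. The Picard iterates for `p` and their increments are
dominated by those of the majorant at every point (`enorm_picard_sub_le`), hence converge to
`fourierSol` wherever the majorant is finite. Cauchy–Schwarz in Duhamel's formula bounds the
majorant in `L²` uniformly in time (`sq_majorant_le_majSq`), which makes the curve continuous in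
`L²`.

**Analyticity and decay.** The weight `e^{ε t^{1/4} ρ}` is submultiplicative in frequency, and since
`(t^{1/4} - τ^{1/4}) ρ ≤ 1 + (t - τ) ρ⁴` its growth in time costs a constant `e^ε` and a part `ε` of
the heat kernel. The weighted majorant is therefore dominated by a majorant with slightly worse
constants (`weight_mul_majorant_le`), which is still subcritical because `f₂ < 1` at the datum is an
open condition. The second moment decays by Fourier splitting (`Subcritical.moment_decay`): the
Besov condition on the datum says that the mass in `{ρ < R}` is `O(R^d)`, and this propagates in
time because the forcing is bounded pointwise by the space-time `L²` norm. Low frequencies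
`ρ < t^{-1/4}` are then counted directly, and the others are controlled by the second moment. The
radius is `ν(t) = ν₀ t^{1/4}`.

**Uniqueness.** Any solution with the energy inequality has a Fourier transform with a jointly
measurable representative, which solves Duhamel's formula for almost every time and frequency. The
difference of two such solutions satisfies `X ≤ f₂(‖h₀‖₂) X` for `X = ∫_0^T ∫ ρ² |p - p'|`, because
the time integral of `ρ⁴ e^{-tρ⁴}` is at most one; hence `X = 0` (`IsGlobalSolution.eq`).

Mathlib's Fourier transform uses the frequency variable `η = ξ / 2π`, and all of the analysis is
done in this variable, with `freq η = 2π‖η‖` in the role of `ρ`. The norms of the statement differ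
from those used here by the constant factor `scaleConst d ≥ 1`, so the smallness condition passes
to the latter.
-/

open MeasureTheory Filter
open scoped ENNReal Topology SchwartzMap FourierTransform Laplacian ComplexConjugate

noncomputable section

namespace ExpPDE

variable {d : ℕ}

/-! ### Convolution powers of nonnegative functions -/

/-- The angular frequency `2π|η|` attached to Mathlib's frequency variable `η`; the Laplacian is
multiplication by `-(freq η)²` on the Fourier side. -/
def freq (η : E d) : ℝ := 2 * Real.pi * ‖η‖

/-- The angular frequency with values in `[0,∞]`. -/
def efreq (η : E d) : ℝ≥0∞ := ENNReal.ofReal (freq η)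

lemma freq_nonneg (η : E d) : 0 ≤ freq η := by unfold freq; positivity

lemma continuous_freq : Continuous (freq : E d → ℝ) := by unfold freq; fun_prop

@[fun_prop]
lemma measurable_freq : Measurable (freq : E d → ℝ) := continuous_freq.measurable

@[fun_prop]
lemma measurable_efreq : Measurable (efreq : E d → ℝ≥0∞) := by unfold efreq; fun_prop

lemma efreq_ne_top (η : E d) : efreq η ≠ ∞ := ENNReal.ofReal_ne_top

lemma freq_le_add (x y : E d) : freq x ≤ freq y + freq (x - y) := by
  unfold freq
  have h : ‖x‖ ≤ ‖y‖ + ‖x - y‖ := by simpa using norm_add_le y (x - y)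
  have := mul_le_mul_of_nonneg_left h (by positivity : 0 ≤ 2 * Real.pi)
  linarith

/-- `lconvPow W n` is the `(n+1)`-fold convolution of `W` with itself. -/
def lconvPow (W : E d → ℝ≥0∞) : ℕ → E d → ℝ≥0∞
  | 0 => W
  | n + 1 => fun x => ∫⁻ y, W y * lconvPow W n (x - y)

/-- The convolution analogue `∑_{j ≥ 2} W^{*j} / j!` of `e^w - 1 - w`. -/
def lconvExp (W : E d → ℝ≥0∞) (x : E d) : ℝ≥0∞ :=
  ∑' n : ℕ, lconvPow W (n + 1) x / ((n + 2).factorial : ℝ≥0∞)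

/-- The quotient `∑_{j ≥ 2} W^{*(j-1)} / j!` of `lconvExp W` by one convolution factor `W`. -/
def lconvExpDiv (W : E d → ℝ≥0∞) (x : E d) : ℝ≥0∞ :=
  ∑' n : ℕ, lconvPow W n x / ((n + 2).factorial : ℝ≥0∞)

/-- The series `∑_{j ≥ 1} (j+1)³ a^j / j!` on `[0,∞]`, with the coefficient written as
`(j+1)⁴ / (j+1)!`. -/
def ef₂ (a : ℝ≥0∞) : ℝ≥0∞ :=
  ∑' n : ℕ, ((n : ℝ≥0∞) + 2) ^ 4 / ((n + 2).factorial : ℝ≥0∞) * a ^ (n + 1)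

section Measurability

variable {α : Type*} [MeasurableSpace α]

lemma measurable_lconv_param {f g : α → E d → ℝ≥0∞}
    (hf : Measurable fun p : α × E d => f p.1 p.2) (hg : Measurable fun p : α × E d => g p.1 p.2) :
    Measurable fun p : α × E d => ∫⁻ y, f p.1 y * g p.1 (p.2 - y) := by
  refine Measurable.lintegral_prod_right' (f := fun q : (α × E d) × E d =>
    f q.1.1 q.2 * g q.1.1 (q.1.2 - q.2)) ?_
  exact (hf.comp (by fun_prop : Measurable fun q : (α × E d) × E d => (q.1.1, q.2))).mul
    (hg.comp (by fun_prop : Measurable fun q : (α × E d) × E d => (q.1.1, q.1.2 - q.2)))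

lemma measurable_lconvPow_param {W : α → E d → ℝ≥0∞}
    (hW : Measurable fun p : α × E d => W p.1 p.2) (n : ℕ) :
    Measurable fun p : α × E d => lconvPow (W p.1) n p.2 := by
  induction n with
  | zero => exact hW
  | succ n ih => exact measurable_lconv_param (g := fun a => lconvPow (W a) n) hW ih

lemma measurable_lconvExp_param {W : α → E d → ℝ≥0∞}
    (hW : Measurable fun p : α × E d => W p.1 p.2) :
    Measurable fun p : α × E d => lconvExp (W p.1) p.2 :=
  Measurable.tsum fun n => (measurable_lconvPow_param hW (n + 1)).div_const _

end Measurability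

lemma measurable_lconv {f g : E d → ℝ≥0∞} (hf : Measurable f) (hg : Measurable g) :
    Measurable fun x => ∫⁻ y, f y * g (x - y) :=
  (measurable_lconv_param (α := Unit) (f := fun _ => f) (g := fun _ => g) (by fun_prop)
    (by fun_prop)).comp (by fun_prop : Measurable fun x : E d => ((), x))

lemma measurable_lconvPow {W : E d → ℝ≥0∞} (hW : Measurable W) (n : ℕ) :
    Measurable (lconvPow W n) :=
  (measurable_lconvPow_param (α := Unit) (W := fun _ => W) (by fun_prop) n).comp
    (by fun_prop : Measurable fun x : E d => ((), x))

lemma measurable_lconvExp {W : E d → ℝ≥0∞} (hW : Measurable W) : Measurable (lconvExp W) :=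
  Measurable.tsum fun n => (measurable_lconvPow hW (n + 1)).div_const _

lemma measurable_lconvExpDiv {W : E d → ℝ≥0∞} (hW : Measurable W) :
    Measurable (lconvExpDiv W) :=
  Measurable.tsum fun n => (measurable_lconvPow hW n).div_const _

lemma lintegral_lconv_mul {f g : E d → ℝ≥0∞} (hf : Measurable f) (hg : Measurable g)
    {w : E d → ℝ≥0∞} (hw : Measurable w) :
    ∫⁻ x, w x * ∫⁻ y, f y * g (x - y) = ∫⁻ y, f y * ∫⁻ z, w (y + z) * g z := by
  have h1 : ∀ x, w x * ∫⁻ y, f y * g (x - y) = ∫⁻ y, w x * (f y * g (x - y)) := fun x =>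
    (lintegral_const_mul _ (by fun_prop)).symm
  simp_rw [h1]
  rw [lintegral_lintegral_swap (by fun_prop)]
  refine lintegral_congr fun y => ?_
  have h2 : ∀ x, w x * (f y * g (x - y)) = f y * (w (y + (x - y)) * g (x - y)) := fun x => by
    rw [add_sub_cancel]; ring
  simp_rw [h2]
  rw [lintegral_const_mul _ (by fun_prop)]
  rw [lintegral_sub_right_eq_self (fun z => w (y + z) * g z) y]

lemma lintegral_lconv {f g : E d → ℝ≥0∞} (hf : Measurable f) (hg : Measurable g) :
    ∫⁻ x, ∫⁻ y, f y * g (x - y) = (∫⁻ x, f x) * ∫⁻ x, g x := by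
  have := lintegral_lconv_mul hf hg (w := fun _ => 1) measurable_const
  simp only [one_mul] at this
  rw [this, lintegral_mul_const _ hf]

lemma lintegral_lconvPow {W : E d → ℝ≥0∞} (hW : Measurable W) (n : ℕ) :
    ∫⁻ x, lconvPow W n x = (∫⁻ x, W x) ^ (n + 1) := by
  induction n with
  | zero => simp [lconvPow]
  | succ n ih =>
    simp only [lconvPow]
    rw [lintegral_lconv hW (measurable_lconvPow hW n), ih]; ring

lemma lintegral_mul_lconv_le {f g : E d → ℝ≥0∞} (hf : Measurable f) (hg : Measurable g)
    {w w₁ w₂ : E d → ℝ≥0∞} (hw₁ : Measurable w₁) (hw₂ : Measurable w₂)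
    (h : ∀ x y, w x ≤ w₁ y + w₂ (x - y)) :
    ∫⁻ x, w x * ∫⁻ y, f y * g (x - y) ≤
      (∫⁻ x, w₁ x * f x) * (∫⁻ x, g x) + (∫⁻ x, f x) * ∫⁻ x, w₂ x * g x := by
  rw [← lintegral_lconv (by fun_prop) hg, ← lintegral_lconv hf (by fun_prop)]
  rw [← lintegral_add_left (measurable_lconv (f := fun x => w₁ x * f x) (by fun_prop) hg)]
  refine lintegral_mono fun x => ?_
  simp only
  rw [← lintegral_const_mul _ (by fun_prop), ← lintegral_add_left (by fun_prop)]
  refine lintegral_mono fun y => ?_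
  simp only
  calc w x * (f y * g (x - y)) ≤ (w₁ y + w₂ (x - y)) * (f y * g (x - y)) := by gcongr; exact h x y
    _ = _ := by ring

/-- Convexity of `x⁴`, with the weights `1 / (m + 1)` and `m / (m + 1)`. -/
lemma add_pow_four_le {m x y : ℝ} (hm : 0 < m) (hx : 0 ≤ x) (hy : 0 ≤ y) :
    m ^ 3 * (x + y) ^ 4 ≤ (m + 1) ^ 3 * (m ^ 3 * x ^ 4 + y ^ 4) := by
  have h := (convexOn_pow (𝕜 := ℝ) 4).2 (Set.mem_Ici.2 hx)
    (Set.mem_Ici.2 (by positivity : 0 ≤ y / m))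
    (by positivity : 0 ≤ 1 / (m + 1)) (by positivity : 0 ≤ m / (m + 1)) (by field_simp; ring)
  simp only [smul_eq_mul] at h
  have e1 : 1 / (m + 1) * x + m / (m + 1) * (y / m) = (x + y) / (m + 1) := by field_simp
  rw [e1] at h
  have h' := mul_le_mul_of_nonneg_left h (by positivity : 0 ≤ (m + 1) ^ 4 * m ^ 3)
  have e2 : (m + 1) ^ 4 * m ^ 3 * ((x + y) / (m + 1)) ^ 4 = m ^ 3 * (x + y) ^ 4 := by field_simp
  have e3 : (m + 1) ^ 4 * m ^ 3 * (1 / (m + 1) * x ^ 4 + m / (m + 1) * (y / m) ^ 4)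
      = (m + 1) ^ 3 * (m ^ 3 * x ^ 4 + y ^ 4) := by field_simp
  rwa [e2, e3] at h'

lemma efreq_pow_four_le (n : ℕ) (x y : E d) :
    ((n : ℝ≥0∞) + 1) ^ 3 * efreq x ^ 4 ≤
      ((n : ℝ≥0∞) + 2) ^ 3 * (((n : ℝ≥0∞) + 1) ^ 3 * efreq y ^ 4) +
        ((n : ℝ≥0∞) + 2) ^ 3 * efreq (x - y) ^ 4 := by
  have h := add_pow_four_le (m := (n : ℝ) + 1) (by positivity) (freq_nonneg y)
    (freq_nonneg (x - y))
  have h1 : ((n : ℝ) + 1) ^ 3 * freq x ^ 4 ≤ ((n : ℝ) + 1) ^ 3 * (freq y + freq (x - y)) ^ 4 := by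
    gcongr
    · exact freq_nonneg x
    · exact freq_le_add x y
  have h2 := ENNReal.ofReal_le_ofReal (h1.trans h)
  have e1 : ((n : ℝ≥0∞) + 1) = ENNReal.ofReal ((n : ℝ) + 1) := by
    rw [ENNReal.ofReal_add (by positivity) (by positivity)]; simp
  have e2 : ((n : ℝ≥0∞) + 2) = ENNReal.ofReal ((n : ℝ) + 1 + 1) := by
    rw [add_assoc, ENNReal.ofReal_add (by positivity) (by positivity)]; norm_num
  have p := freq_nonneg y
  have q := freq_nonneg (x - y)
  have r := freq_nonneg x
  rw [e1, e2]
  simp only [efreq]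
  rw [← ENNReal.ofReal_pow (by positivity), ← ENNReal.ofReal_pow r, ← ENNReal.ofReal_mul
    (by positivity), ← ENNReal.ofReal_pow (by positivity), ← ENNReal.ofReal_pow p,
    ← ENNReal.ofReal_pow q, ← ENNReal.ofReal_mul (by positivity), ← ENNReal.ofReal_mul
    (by positivity), ← ENNReal.ofReal_mul (by positivity), ← ENNReal.ofReal_add (by positivity)
    (by positivity)]
  refine h2.trans_eq ?_
  congr 1; ring

/-- The fourth moment of a convolution power. The factor `(n+1)⁴ = (n+1)³·(n+1)` comes from
`(x₀ + ⋯ + xₙ)⁴ ≤ (n+1)³ (x₀⁴ + ⋯ + xₙ⁴)`; this is the source of the cubes in `f₂`. -/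
lemma lintegral_efreq_lconvPow_le {W : E d → ℝ≥0∞} (hW : Measurable W) (n : ℕ) :
    ∫⁻ x, efreq x ^ 4 * lconvPow W n x ≤
      ((n : ℝ≥0∞) + 1) ^ 4 * (∫⁻ x, efreq x ^ 4 * W x) * (∫⁻ x, W x) ^ n := by
  induction n with
  | zero => simp [lconvPow]
  | succ n ih =>
    have key := lintegral_mul_lconv_le hW (measurable_lconvPow hW n)
      (w := fun x => ((n : ℝ≥0∞) + 1) ^ 3 * efreq x ^ 4)
      (w₁ := fun x => ((n : ℝ≥0∞) + 2) ^ 3 * (((n : ℝ≥0∞) + 1) ^ 3 * efreq x ^ 4))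
      (w₂ := fun x => ((n : ℝ≥0∞) + 2) ^ 3 * efreq x ^ 4)
      (by fun_prop) (by fun_prop) (efreq_pow_four_le n)
    have hm := measurable_lconvPow hW n
    have hm' := measurable_lconvPow hW (n + 1)
    simp only [mul_assoc] at key
    rw [lintegral_const_mul _ (by exact ((measurable_efreq.pow_const 4).mul hm')),
      lintegral_const_mul _ (by fun_prop), lintegral_const_mul _ (by fun_prop),
      lintegral_const_mul _ (by fun_prop), lintegral_lconvPow hW] at key
    have hn0 : ((n : ℝ≥0∞) + 1) ^ 3 ≠ 0 := by positivity
    have hnt : ((n : ℝ≥0∞) + 1) ^ 3 ≠ ∞ := by finiteness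
    rw [← ENNReal.mul_le_mul_iff_right hn0 hnt]
    refine key.trans ?_
    calc _ ≤ ((n : ℝ≥0∞) + 2) ^ 3 * (((n : ℝ≥0∞) + 1) ^ 3 * (∫⁻ x, efreq x ^ 4 * W x)) *
          (∫⁻ x, W x) ^ (n + 1) + (∫⁻ x, W x) * (((n : ℝ≥0∞) + 2) ^ 3 *
          (((n : ℝ≥0∞) + 1) ^ 4 * (∫⁻ x, efreq x ^ 4 * W x) * (∫⁻ x, W x) ^ n)) := by
          rw [mul_assoc _ (((n : ℝ≥0∞) + 1) ^ 3 * _), mul_assoc (((n : ℝ≥0∞) + 1) ^ 3)]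
          gcongr
      _ = _ := by push_cast; ring

lemma lintegral_lconvExp_mul {W : E d → ℝ≥0∞} (hW : Measurable W) {w : E d → ℝ≥0∞}
    (hw : Measurable w) :
    ∫⁻ x, w x * lconvExp W x =
      ∑' n : ℕ, (∫⁻ x, w x * lconvPow W (n + 1) x) / ((n + 2).factorial : ℝ≥0∞) := by
  simp_rw [lconvExp, ← ENNReal.tsum_mul_left]
  rw [lintegral_tsum fun n => by
    have := measurable_lconvPow hW (n + 1); fun_prop]
  refine tsum_congr fun n => ?_
  have := measurable_lconvPow hW (n + 1)
  simp_rw [div_eq_mul_inv, ← mul_assoc]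
  rw [lintegral_mul_const _ (by fun_prop)]

/-- The fourth moment of the nonlinearity; this estimate determines `f₂`. -/
lemma lintegral_efreq_lconvExp_le {W : E d → ℝ≥0∞} (hW : Measurable W) :
    ∫⁻ x, efreq x ^ 4 * lconvExp W x ≤ ef₂ (∫⁻ x, W x) * ∫⁻ x, efreq x ^ 4 * W x := by
  rw [lintegral_lconvExp_mul hW (by fun_prop), ef₂, ← ENNReal.tsum_mul_right]
  refine ENNReal.tsum_le_tsum fun n => ?_
  have h := lintegral_efreq_lconvPow_le hW (n + 1)
  calc _ ≤ _ := ENNReal.div_le_div_right h _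
    _ = _ := by
      push_cast
      rw [show (n : ℝ≥0∞) + 1 + 1 = n + 2 by rw [add_assoc]; norm_num]
      simp only [div_eq_mul_inv]; ring

lemma one_le_pow_four_coeff (n : ℕ) : (1 : ℝ≥0∞) ≤ ((n : ℝ≥0∞) + 2) ^ 4 :=
  one_le_pow₀ (le_add_left (by norm_num))

lemma lintegral_lconvExp_le {W : E d → ℝ≥0∞} (hW : Measurable W) :
    ∫⁻ x, lconvExp W x ≤ ef₂ (∫⁻ x, W x) * ∫⁻ x, W x := by
  have h := lintegral_lconvExp_mul hW (w := fun _ => 1) measurable_const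
  simp only [one_mul] at h
  rw [h, ef₂, ← ENNReal.tsum_mul_right]
  refine ENNReal.tsum_le_tsum fun n => ?_
  rw [lintegral_lconvPow hW]
  calc (∫⁻ x, W x) ^ (n + 1 + 1) / ((n + 2).factorial : ℝ≥0∞)
      = 1 * ((∫⁻ x, W x) ^ (n + 1 + 1) / ((n + 2).factorial : ℝ≥0∞)) := by rw [one_mul]
    _ ≤ ((n : ℝ≥0∞) + 2) ^ 4 * ((∫⁻ x, W x) ^ (n + 1 + 1) / ((n + 2).factorial : ℝ≥0∞)) := by
      gcongr; exact one_le_pow_four_coeff n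
    _ = _ := by simp only [div_eq_mul_inv]; ring

/-- The coefficients of `ef₂` exceed those of `∑ a^{j-1} / j!` by `j⁴ ≥ 16`. -/
lemma lintegral_lconvExpDiv_le {W : E d → ℝ≥0∞} (hW : Measurable W) :
    16 * ∫⁻ x, lconvExpDiv W x ≤ ef₂ (∫⁻ x, W x) := by
  have h : ∫⁻ x, lconvExpDiv W x =
      ∑' n : ℕ, (∫⁻ x, W x) ^ (n + 1) / ((n + 2).factorial : ℝ≥0∞) := by
    simp_rw [lconvExpDiv]
    rw [lintegral_tsum fun n => ((measurable_lconvPow hW n).div_const _).aemeasurable]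
    refine tsum_congr fun n => ?_
    simp_rw [div_eq_mul_inv]
    rw [lintegral_mul_const _ (measurable_lconvPow hW n), lintegral_lconvPow hW]
  rw [h, ef₂, ← ENNReal.tsum_mul_left]
  refine ENNReal.tsum_le_tsum fun n => ?_
  have h16 : (16 : ℝ≥0∞) ≤ ((n : ℝ≥0∞) + 2) ^ 4 := by
    calc (16 : ℝ≥0∞) = 2 ^ 4 := by norm_num
      _ ≤ _ := by gcongr; exact le_add_self
  calc _ ≤ ((n : ℝ≥0∞) + 2) ^ 4 * ((∫⁻ x, W x) ^ (n + 1) / ((n + 2).factorial : ℝ≥0∞)) := by gcongr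
    _ = _ := by simp only [div_eq_mul_inv]; ring

lemma lconvExp_eq_lconv {W : E d → ℝ≥0∞} (hW : Measurable W) (x : E d) :
    lconvExp W x = ∫⁻ y, W y * lconvExpDiv W (x - y) := by
  simp_rw [lconvExpDiv, ← ENNReal.tsum_mul_left]
  rw [lintegral_tsum fun n => by
    have := measurable_lconvPow hW n; fun_prop]
  refine tsum_congr fun n => ?_
  have := measurable_lconvPow hW n
  simp_rw [div_eq_mul_inv, ← mul_assoc]
  rw [lintegral_mul_const _ (by fun_prop)]
  rfl

lemma lconvExpDiv_le {W : E d → ℝ≥0∞} (x : E d) : lconvExpDiv W x ≤ W x + lconvExp W x := by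
  rw [lconvExpDiv, tsum_eq_zero_add' ENNReal.summable]
  gcongr
  · refine ENNReal.div_le_of_le_mul ?_
    exact le_mul_of_one_le_right' (by norm_num)
  · refine ENNReal.tsum_le_tsum fun n => ?_
    gcongr
    omega

/-- Cauchy–Schwarz with one factor split as `f = √f · √f`. -/
lemma sq_lintegral_mul_le {α : Type*} [MeasurableSpace α] (μ : Measure α) {f g : α → ℝ≥0∞}
    (hf : AEMeasurable f μ) (hg : AEMeasurable g μ) :
    (∫⁻ x, f x * g x ∂μ) ^ 2 ≤ (∫⁻ x, f x ∂μ) * ∫⁻ x, f x * g x ^ 2 ∂μ := by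
  have h := ENNReal.lintegral_mul_le_Lp_mul_Lq μ Real.HolderConjugate.two_two
    (f := fun x => f x ^ (1 / 2 : ℝ)) (g := fun x => f x ^ (1 / 2 : ℝ) * g x)
    (hf.pow_const _) ((hf.pow_const _).mul hg)
  have e : ∀ x, f x ^ (1 / 2 : ℝ) * f x ^ (1 / 2 : ℝ) = f x := fun x => by
    rw [← ENNReal.rpow_add_of_nonneg _ _ (by norm_num) (by norm_num)]; norm_num
  have e1 : ∀ x, f x ^ (1 / 2 : ℝ) * (f x ^ (1 / 2 : ℝ) * g x) = f x * g x := fun x => by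
    rw [← mul_assoc, e]
  have e2 : ∀ x, (f x ^ (1 / 2 : ℝ)) ^ (2 : ℝ) = f x := fun x => by
    rw [← ENNReal.rpow_mul]; norm_num
  have e3 : ∀ x, (f x ^ (1 / 2 : ℝ) * g x) ^ (2 : ℝ) = f x * g x ^ 2 := fun x => by
    rw [ENNReal.mul_rpow_of_nonneg _ _ (by norm_num), e2]; norm_num
  simp only [Pi.mul_apply, e1, e2, e3] at h
  calc _ ≤ ((∫⁻ x, f x ∂μ) ^ (1 / 2 : ℝ) * (∫⁻ x, f x * g x ^ 2 ∂μ) ^ (1 / 2 : ℝ)) ^ 2 := by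
        gcongr
    _ = _ := by
      rw [mul_pow, ← ENNReal.rpow_natCast, ← ENNReal.rpow_natCast, ← ENNReal.rpow_mul,
        ← ENNReal.rpow_mul]; norm_num

/-- Young's inequality `‖f * g‖₂ ≤ ‖f‖₁ ‖g‖₂`. -/
lemma lintegral_sq_lconv_le {f g : E d → ℝ≥0∞} (hf : Measurable f) (hg : Measurable g) :
    ∫⁻ x, (∫⁻ y, f y * g (x - y)) ^ 2 ≤ (∫⁻ x, f x) ^ 2 * ∫⁻ x, g x ^ 2 := by
  calc _ ≤ ∫⁻ x, (∫⁻ y, f y) * ∫⁻ y, f y * g (x - y) ^ 2 :=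
        lintegral_mono fun x => sq_lintegral_mul_le _ hf.aemeasurable (by fun_prop)
    _ = _ := by
      have hm := measurable_lconv hf (hg.pow_const 2)
      rw [lintegral_const_mul _ hm, lintegral_lconv hf (g := fun x => g x ^ 2) (by fun_prop)]
      ring

lemma lintegral_sq_lconvExp_le {W : E d → ℝ≥0∞} (hW : Measurable W) :
    ∫⁻ x, lconvExp W x ^ 2 ≤ (∫⁻ x, lconvExpDiv W x) ^ 2 * ∫⁻ x, W x ^ 2 := by
  refine le_trans (le_of_eq ?_) (lintegral_sq_lconv_le (measurable_lconvExpDiv hW) hW)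
  refine lintegral_congr fun x => ?_
  rw [lconvExp_eq_lconv hW, ← lintegral_sub_left_eq_self _ x]
  simp only [sub_sub_cancel, mul_comm]

lemma add_sq_le_two_mul (a b : ℝ≥0∞) : (a + b) ^ 2 ≤ 2 * a ^ 2 + 2 * b ^ 2 := by
  have h := ENNReal.rpow_add_le_mul_rpow_add_rpow a b (p := 2) (by norm_num)
  norm_num at h
  rwa [mul_add] at h

lemma mul_le_sq_add_sq (a b : ℝ≥0∞) : a * b ≤ a ^ 2 + b ^ 2 := by
  rcases le_total a b with h | h
  · calc a * b ≤ b * b := by gcongr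
      _ = b ^ 2 := by ring
      _ ≤ _ := le_add_self
  · calc a * b ≤ a * a := by gcongr
      _ = a ^ 2 := by ring
      _ ≤ _ := le_self_add

/-- A pointwise bound of the convolution exponential by the square of the `L²` norm. -/
lemma lconvExp_le_lintegral_sq {W : E d → ℝ≥0∞} (hW : Measurable W) (x : E d) :
    lconvExp W x ≤ (3 + 2 * (∫⁻ x, lconvExpDiv W x) ^ 2) * ∫⁻ x, W x ^ 2 := by
  have hH := measurable_lconvExpDiv hW
  have hG := measurable_lconvExp hW
  calc lconvExp W x = ∫⁻ y, W y * lconvExpDiv W (x - y) := lconvExp_eq_lconv hW x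
    _ ≤ ∫⁻ y, (W y ^ 2 + lconvExpDiv W (x - y) ^ 2) :=
        lintegral_mono fun y => mul_le_sq_add_sq _ _
    _ = (∫⁻ y, W y ^ 2) + ∫⁻ y, lconvExpDiv W y ^ 2 := by
        rw [lintegral_add_left (by fun_prop),
          lintegral_sub_left_eq_self (fun y => lconvExpDiv W y ^ 2) x]
    _ ≤ (∫⁻ y, W y ^ 2) + ∫⁻ y, (2 * W y ^ 2 + 2 * lconvExp W y ^ 2) := by
        gcongr with y
        exact (pow_le_pow_left' (lconvExpDiv_le y) 2).trans (add_sq_le_two_mul _ _)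
    _ = (∫⁻ y, W y ^ 2) + (2 * (∫⁻ y, W y ^ 2) + 2 * ∫⁻ y, lconvExp W y ^ 2) := by
        rw [lintegral_add_left (by fun_prop), lintegral_const_mul _ (by fun_prop),
          lintegral_const_mul _ (by fun_prop)]
    _ ≤ (∫⁻ y, W y ^ 2) + (2 * (∫⁻ y, W y ^ 2) +
          2 * ((∫⁻ x, lconvExpDiv W x) ^ 2 * ∫⁻ x, W x ^ 2)) := by
        gcongr; exact lintegral_sq_lconvExp_le hW
    _ = _ := by ring

/-! ### Monotonicity, submultiplicative weights and monotone limits -/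

lemma lconvPow_mono {W W' : E d → ℝ≥0∞} (h : ∀ x, W x ≤ W' x) (n : ℕ) (x : E d) :
    lconvPow W n x ≤ lconvPow W' n x := by
  induction n generalizing x with
  | zero => exact h x
  | succ n ih => exact lintegral_mono fun y => mul_le_mul' (h y) (ih _)

lemma lconvExp_mono {W W' : E d → ℝ≥0∞} (h : ∀ x, W x ≤ W' x) (x : E d) :
    lconvExp W x ≤ lconvExp W' x :=
  ENNReal.tsum_le_tsum fun n => ENNReal.div_le_div_right (lconvPow_mono h (n + 1) x) _

lemma mul_lconvPow_le {ω W W' : E d → ℝ≥0∞} (hω : ∀ x y, ω x ≤ ω y * ω (x - y))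
    (hfin : ∀ x, ω x ≠ ∞) (h : ∀ x, ω x * W x ≤ W' x) (n : ℕ) (x : E d) :
    ω x * lconvPow W n x ≤ lconvPow W' n x := by
  induction n generalizing x with
  | zero => exact h x
  | succ n ih =>
    simp only [lconvPow]
    rw [← lintegral_const_mul' _ _ (hfin x)]
    refine lintegral_mono fun y => ?_
    calc ω x * (W y * lconvPow W n (x - y))
        ≤ (ω y * ω (x - y)) * (W y * lconvPow W n (x - y)) := by gcongr; exact hω x y
      _ = (ω y * W y) * (ω (x - y) * lconvPow W n (x - y)) := by ring
      _ ≤ _ := mul_le_mul' (h y) (ih _)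

lemma mul_lconvExp_le {ω W W' : E d → ℝ≥0∞} (hω : ∀ x y, ω x ≤ ω y * ω (x - y))
    (hfin : ∀ x, ω x ≠ ∞) (h : ∀ x, ω x * W x ≤ W' x) (x : E d) :
    ω x * lconvExp W x ≤ lconvExp W' x := by
  rw [lconvExp, ← ENNReal.tsum_mul_left]
  refine ENNReal.tsum_le_tsum fun n => ?_
  rw [← mul_div_assoc]
  exact ENNReal.div_le_div_right (mul_lconvPow_le hω hfin h (n + 1) x) _

lemma iSup_mul_iSup_of_monotone {f g : ℕ → ℝ≥0∞} (hf : Monotone f) (hg : Monotone g) :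
    (⨆ k, f k) * ⨆ k, g k = ⨆ k, f k * g k := by
  refine le_antisymm ?_ (iSup_le fun k => mul_le_mul' (le_iSup f k) (le_iSup g k))
  rw [ENNReal.iSup_mul]
  refine iSup_le fun i => ?_
  rw [ENNReal.mul_iSup]
  exact iSup_le fun j => le_iSup_of_le (max i j)
    (mul_le_mul' (hf (le_max_left i j)) (hg (le_max_right i j)))

lemma lconvPow_iSup {W : ℕ → E d → ℝ≥0∞} (hm : ∀ k, Measurable (W k))
    (hmono : ∀ x, Monotone fun k => W k x) (n : ℕ) (x : E d) :
    lconvPow (fun x => ⨆ k, W k x) n x = ⨆ k, lconvPow (W k) n x := by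
  induction n generalizing x with
  | zero => rfl
  | succ n ih =>
    simp only [lconvPow]
    rw [← lintegral_iSup]
    · refine lintegral_congr fun y => ?_
      rw [ih, iSup_mul_iSup_of_monotone (hmono y)
        fun i j hij => lconvPow_mono (fun z => hmono z hij) n (x - y)]
    · intro k
      have := measurable_lconvPow (hm k) n
      have := hm k
      fun_prop
    · exact fun i j hij y => mul_le_mul' (hmono y hij) (lconvPow_mono (fun z => hmono z hij) n _)

lemma lconvExp_iSup {W : ℕ → E d → ℝ≥0∞} (hm : ∀ k, Measurable (W k))
    (hmono : ∀ x, Monotone fun k => W k x) (x : E d) :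
    lconvExp (fun x => ⨆ k, W k x) x = ⨆ k, lconvExp (W k) x := by
  have h : ∀ V : E d → ℝ≥0∞, lconvExp V x =
      ∫⁻ n : ℕ, lconvPow V (n + 1) x / ((n + 2).factorial : ℝ≥0∞) ∂Measure.count := fun V => by
    rw [lintegral_count]; rfl
  simp only [h]
  rw [← lintegral_iSup]
  · refine lintegral_congr fun n => ?_
    rw [lconvPow_iSup hm hmono, ENNReal.iSup_div]
  · exact fun k => measurable_of_countable _
  · exact fun i j hij n =>
      ENNReal.div_le_div_right (lconvPow_mono (fun z => hmono z hij) (n + 1) x) _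

/-! ### The series for `f₂` -/

lemma ef₂_mono {a b : ℝ≥0∞} (h : a ≤ b) : ef₂ a ≤ ef₂ b :=
  ENNReal.tsum_le_tsum fun n => by gcongr

lemma hasSum_of_eq {f g : ℕ → ℝ} {a : ℝ} (h : ∀ n, f n = g n) (hg : HasSum g a) :
    HasSum f a := by
  rwa [funext h]

lemma hasSum_f₂ (y : ℝ) :
    HasSum (fun n : ℕ => ((n : ℝ) + 2) ^ 4 / ((n + 2).factorial : ℝ) * y ^ (n + 1)) (f₂ y) := by
  have hexp : HasSum (fun n : ℕ => y ^ n / (n.factorial : ℝ)) (Real.exp y) := by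
    have := NormedSpace.expSeries_div_hasSum_exp y
    rwa [← Real.exp_eq_exp_ℝ] at this
  -- `h1`, `h2`, `h3` sum the moments `n^k y^n / n!`, by shifting the index.
  have h1 : HasSum (fun n : ℕ => (n : ℝ) * (y ^ n / (n.factorial : ℝ))) (y * Real.exp y) := by
    rw [← hasSum_nat_add_iff' 1]
    simp only [Finset.sum_range_one, Nat.cast_zero, zero_mul, sub_zero]
    refine hasSum_of_eq (fun n => ?_) (hexp.mul_left y)
    rw [Nat.factorial_succ]; push_cast; field_simp; ring
  have h2 : HasSum (fun n : ℕ => (n : ℝ) ^ 2 * (y ^ n / (n.factorial : ℝ)))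
      (y * (y * Real.exp y + Real.exp y)) := by
    rw [← hasSum_nat_add_iff' 1]
    simp only [Finset.sum_range_one, Nat.cast_zero, zero_pow two_ne_zero, zero_mul, sub_zero]
    refine hasSum_of_eq (fun n => ?_) ((h1.add hexp).mul_left y)
    rw [Nat.factorial_succ]; push_cast; field_simp; ring
  have h3 : HasSum (fun n : ℕ => (n : ℝ) ^ 3 * (y ^ n / (n.factorial : ℝ)))
      (y * (y * (y * Real.exp y + Real.exp y) + 2 * (y * Real.exp y) + Real.exp y)) := by
    rw [← hasSum_nat_add_iff' 1]
    simp only [Finset.sum_range_one, Nat.cast_zero, zero_pow three_ne_zero, zero_mul, sub_zero]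
    refine hasSum_of_eq (fun n => ?_) (((h2.add (h1.mul_left 2)).add hexp).mul_left y)
    rw [Nat.factorial_succ]; push_cast; field_simp; ring
  have h4 := ((h3.add (h2.mul_left 3)).add (h1.mul_left 3)).add hexp
  rw [← hasSum_nat_add_iff' 1] at h4
  have e : f₂ y = y * (y * (y * Real.exp y + Real.exp y) + 2 * (y * Real.exp y) + Real.exp y) +
      3 * (y * (y * Real.exp y + Real.exp y)) + 3 * (y * Real.exp y) + Real.exp y - 1 := by
    unfold f₂; ring
  rw [e]
  simp only [Finset.sum_range_one, Nat.cast_zero, zero_pow three_ne_zero, zero_pow two_ne_zero,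
    zero_mul, mul_zero, zero_add, pow_zero, Nat.factorial_zero, Nat.cast_one, div_one] at h4
  refine hasSum_of_eq (fun n => ?_) h4
  rw [show n + 2 = (n + 1) + 1 from rfl, Nat.factorial_succ]
  push_cast; field_simp; ring

lemma ef₂_ofReal {y : ℝ} (hy : 0 ≤ y) : ef₂ (ENNReal.ofReal y) = ENNReal.ofReal (f₂ y) := by
  rw [← (hasSum_f₂ y).tsum_eq, ENNReal.ofReal_tsum_of_nonneg (fun n => by positivity)
    (hasSum_f₂ y).summable, ef₂]
  refine tsum_congr fun n => ?_
  have hfac : (0 : ℝ) < ((n + 2).factorial : ℝ) := by positivity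
  have h2 : ENNReal.ofReal ((n : ℝ) + 2) = (n : ℝ≥0∞) + 2 := by
    rw [ENNReal.ofReal_add (by positivity) (by norm_num), ENNReal.ofReal_natCast]
    norm_num
  rw [ENNReal.ofReal_mul (p := ((n : ℝ) + 2) ^ 4 / ((n + 2).factorial : ℝ)) (by positivity),
    ENNReal.ofReal_div_of_pos hfac,
    ENNReal.ofReal_pow hy, ENNReal.ofReal_pow (by positivity), h2, ENNReal.ofReal_natCast]

lemma ef₂_ne_top {a : ℝ≥0∞} (ha : a ≠ ∞) : ef₂ a ≠ ∞ := by
  rw [← ENNReal.ofReal_toReal ha, ef₂_ofReal ENNReal.toReal_nonneg]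
  exact ENNReal.ofReal_ne_top

lemma continuous_f₂ : Continuous f₂ := by unfold f₂; fun_prop

lemma f₂_strictMonoOn : StrictMonoOn f₂ (Set.Ici 0) := by
  intro a ha b hb hab
  have ha' : 0 ≤ a := ha
  have hb' : 0 ≤ b := hb
  unfold f₂
  have h1 : a ^ 3 + 6 * a ^ 2 + 7 * a + 1 < b ^ 3 + 6 * b ^ 2 + 7 * b + 1 := by gcongr
  have h2 := Real.exp_lt_exp.2 hab
  have := mul_lt_mul h1 h2.le (Real.exp_pos a) (by positivity)
  linarith

lemma f₂_nonneg {y : ℝ} (hy : 0 ≤ y) : 0 ≤ f₂ y :=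
  (hasSum_f₂ y).nonneg fun n => by positivity

/-! ### The biharmonic heat kernel and Duhamel's formula in `[0,∞]` -/

/-- The multiplier `e^{-λ t |ξ|⁴}` with values in `[0,∞]`. -/
def heat (lam t : ℝ) (η : E d) : ℝ≥0∞ := ENNReal.ofReal (Real.exp (-(lam * t * freq η ^ 4)))

@[fun_prop]
lemma Measurable.heat {α : Type*} [MeasurableSpace α] {f : α → ℝ} {g : α → E d} (lam : ℝ)
    (hf : Measurable f) (hg : Measurable g) : Measurable fun x => heat lam (f x) (g x) := by
  unfold ExpPDE.heat
  have : Measurable fun x => freq (g x) := measurable_freq.comp hg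
  fun_prop

lemma heat_zero (lam : ℝ) (η : E d) : heat lam 0 η = 1 := by simp [heat]

lemma heat_add (lam s t : ℝ) (η : E d) : heat lam (s + t) η = heat lam s η * heat lam t η := by
  unfold heat
  rw [← ENNReal.ofReal_mul (Real.exp_nonneg _), ← Real.exp_add]
  congr 2; ring

lemma heat_le_one {lam t : ℝ} (hl : 0 ≤ lam) (ht : 0 ≤ t) (η : E d) : heat lam t η ≤ 1 := by
  unfold heat
  rw [← ENNReal.ofReal_one]
  apply ENNReal.ofReal_le_ofReal
  rw [Real.exp_le_one_iff]
  have : 0 ≤ freq η ^ 4 := by positivity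
  have : 0 ≤ lam * t * freq η ^ 4 := by positivity
  linarith

lemma setLIntegral_heat_add {lam : ℝ} (hl : 0 ≤ lam) {s t : ℝ} (hst : s ≤ t) (η : E d) :
    heat lam (t - s) η +
      ENNReal.ofReal lam * efreq η ^ 4 * ∫⁻ τ in Set.Ioc s t, heat lam (τ - s) η = 1 := by
  set a : ℝ := lam * freq η ^ 4 with ha
  have ha0 : 0 ≤ a := by positivity
  have hc : ENNReal.ofReal lam * efreq η ^ 4 = ENNReal.ofReal a := by
    rw [ha, ENNReal.ofReal_mul hl, efreq, ENNReal.ofReal_pow (freq_nonneg η)]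
  have hd : ∀ x ∈ Set.uIcc s t, HasDerivAt (fun τ => -Real.exp (-(a * (τ - s))))
      (a * Real.exp (-(a * (x - s)))) x := by
    intro x _
    have := ((((hasDerivAt_id x).sub_const s).const_mul a).neg.exp).neg
    exact this.congr_deriv (by simp only [Pi.neg_apply, id_eq]; ring)
  have hint := intervalIntegral.integral_eq_sub_of_hasDerivAt hd
    (Continuous.intervalIntegrable (by fun_prop) _ _)
  have hheat : ∀ τ, heat lam (τ - s) η = ENNReal.ofReal (Real.exp (-(a * (τ - s)))) := fun τ => by
    unfold heat; congr 2; rw [ha]; ring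
  have h1 : ENNReal.ofReal a * ∫⁻ τ in Set.Ioc s t, heat lam (τ - s) η =
      ENNReal.ofReal (∫ τ in s..t, a * Real.exp (-(a * (τ - s)))) := by
    rw [intervalIntegral.integral_of_le hst, ofReal_integral_eq_lintegral_ofReal]
    · rw [← lintegral_const_mul _ (by fun_prop)]
      refine lintegral_congr fun τ => ?_
      rw [hheat, ENNReal.ofReal_mul ha0]
    · exact (Continuous.integrableOn_Icc (by fun_prop)).mono_set Set.Ioc_subset_Icc_self
    · exact ae_of_all _ fun τ => by positivity
  rw [hc, h1, hint, hheat, ← ENNReal.ofReal_add (Real.exp_nonneg _)]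
  · simp
  · have : Real.exp (-(a * (t - s))) ≤ 1 := by
      rw [Real.exp_le_one_iff]; nlinarith [mul_nonneg ha0 (sub_nonneg.2 hst)]
    simp [this]

/-- Tonelli on the triangle `s < r ≤ τ ≤ t`. -/
lemma setLIntegral_triangle {f : ℝ → ℝ → ℝ≥0∞} (hf : Measurable fun p : ℝ × ℝ => f p.1 p.2)
    (s t : ℝ) :
    ∫⁻ τ in Set.Ioc s t, ∫⁻ r in Set.Ioc s τ, f τ r =
      ∫⁻ r in Set.Ioc s t, ∫⁻ τ in Set.Ioc r t, f τ r := by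
  have hT : MeasurableSet {p : ℝ × ℝ | p.2 ≤ p.1} := measurableSet_le measurable_snd measurable_fst
  have h1 : ∀ τ ∈ Set.Ioc s t, ∫⁻ r in Set.Ioc s τ, f τ r =
      ∫⁻ r in Set.Ioc s t, {p : ℝ × ℝ | p.2 ≤ p.1}.indicator (fun p => f p.1 p.2) (τ, r) := by
    intro τ hτ
    have : ∀ r, {p : ℝ × ℝ | p.2 ≤ p.1}.indicator (fun p => f p.1 p.2) (τ, r) =
        (Set.Iic τ).indicator (fun r => f τ r) r := fun r => by
      simp [Set.indicator]
    simp_rw [this]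
    rw [setLIntegral_indicator measurableSet_Iic, Set.inter_comm, Set.Ioc_inter_Iic,
      min_eq_right hτ.2]
  have h2 : ∀ r ∈ Set.Ioc s t, ∫⁻ τ in Set.Ioc r t, f τ r =
      ∫⁻ τ in Set.Ioc s t, {p : ℝ × ℝ | p.2 ≤ p.1}.indicator (fun p => f p.1 p.2) (τ, r) := by
    intro r hr
    have : ∀ τ, {p : ℝ × ℝ | p.2 ≤ p.1}.indicator (fun p => f p.1 p.2) (τ, r) =
        (Set.Ici r).indicator (fun τ => f τ r) τ := fun τ => by
      simp [Set.indicator]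
    simp_rw [this]
    rw [setLIntegral_indicator measurableSet_Ici]
    have e : Set.Ici r ∩ Set.Ioc s t = Set.Icc r t := by
      ext x; simp only [Set.mem_inter_iff, Set.mem_Ici, Set.mem_Ioc, Set.mem_Icc]
      exact ⟨fun h => ⟨h.1, h.2.2⟩, fun h => ⟨h.1, hr.1.trans_le h.1, h.2⟩⟩
    rw [e]
    exact setLIntegral_congr Ioc_ae_eq_Icc
  rw [setLIntegral_congr_fun measurableSet_Ioc h1, setLIntegral_congr_fun measurableSet_Ioc h2]
  exact lintegral_lintegral_swap (hf.indicator hT).aemeasurable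

/-- Time-integrated dissipation for a single frequency: if `v' = -λ|ξ|⁴ v + g` on `[s,t]` in
Duhamel's form, then `v(t) + λ|ξ|⁴ ∫ v = v(s) + ∫ g`. -/
lemma duhamel_add_dissipation {lam : ℝ} (hl : 0 ≤ lam) {s t : ℝ} (hst : s ≤ t) (η : E d)
    {v g : ℝ → ℝ≥0∞} {b : ℝ≥0∞} (hg : Measurable g)
    (hv : ∀ τ ∈ Set.Icc s t, v τ =
      heat lam (τ - s) η * b + ∫⁻ r in Set.Ioc s τ, heat lam (τ - r) η * g r) :
    v t + ENNReal.ofReal lam * efreq η ^ 4 * ∫⁻ τ in Set.Ioc s t, v τ =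
      b + ∫⁻ r in Set.Ioc s t, g r := by
  set c := ENNReal.ofReal lam * efreq η ^ 4 with hc
  have h1 : ∫⁻ τ in Set.Ioc s t, v τ = (∫⁻ τ in Set.Ioc s t, heat lam (τ - s) η) * b +
      ∫⁻ r in Set.Ioc s t, (∫⁻ τ in Set.Ioc r t, heat lam (τ - r) η) * g r := by
    rw [setLIntegral_congr_fun measurableSet_Ioc
      (fun τ hτ => hv τ (Set.Ioc_subset_Icc_self hτ)), lintegral_add_left (by fun_prop),
      lintegral_mul_const _ (by fun_prop), setLIntegral_triangle (by fun_prop)]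
    congr 1
    refine lintegral_congr fun r => ?_
    rw [lintegral_mul_const _ (by fun_prop)]
  have hm : Measurable fun r => (∫⁻ τ in Set.Ioc r t, heat lam (τ - r) η) := by
    have : ∀ r, ∫⁻ τ in Set.Ioc r t, heat lam (τ - r) η =
        ∫⁻ τ, {p : ℝ × ℝ | p.1 < p.2 ∧ p.2 ≤ t}.indicator (fun p => heat lam (p.2 - p.1) η)
          (r, τ) := fun r => by
      rw [← lintegral_indicator measurableSet_Ioc]
      refine lintegral_congr fun τ => ?_
      simp [Set.indicator]
    simp_rw [this]
    refine Measurable.lintegral_prod_right' (Measurable.indicator (by fun_prop) ?_)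
    exact (measurableSet_lt measurable_fst measurable_snd).inter
      (measurableSet_le measurable_snd measurable_const)
  rw [h1, hv t ⟨hst, le_rfl⟩, mul_add, ← lintegral_const_mul c (f := fun r => (∫⁻ τ in Set.Ioc r t, heat lam (τ - r) η) * g r)
    (hm.mul hg)]
  have h2 : (∫⁻ r in Set.Ioc s t, heat lam (t - r) η * g r) +
      (∫⁻ r in Set.Ioc s t, c * ((∫⁻ τ in Set.Ioc r t, heat lam (τ - r) η) * g r)) =
      ∫⁻ r in Set.Ioc s t, g r := by
    rw [← lintegral_add_left (by fun_prop)]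
    refine setLIntegral_congr_fun measurableSet_Ioc fun r hr => ?_
    calc _ = (heat lam (t - r) η + c * ∫⁻ τ in Set.Ioc r t, heat lam (τ - r) η) * g r := by ring
      _ = g r := by rw [hc, setLIntegral_heat_add hl hr.2, one_mul]
  calc _ = (heat lam (t - s) η + c * ∫⁻ τ in Set.Ioc s t, heat lam (τ - s) η) * b +
      ((∫⁻ r in Set.Ioc s t, heat lam (t - r) η * g r) +
      (∫⁻ r in Set.Ioc s t, c * ((∫⁻ τ in Set.Ioc r t, heat lam (τ - r) η) * g r))) := by ring
    _ = _ := by rw [h2, hc, setLIntegral_heat_add hl hst, one_mul]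

lemma measurable_setLIntegral_Ioc {α : Type*} [MeasurableSpace α] {f : α → ℝ → ℝ≥0∞} {b : α → ℝ}
    (hf : Measurable fun p : α × ℝ => f p.1 p.2) (hb : Measurable b) (s : ℝ) :
    Measurable fun x => ∫⁻ τ in Set.Ioc s (b x), f x τ := by
  have : ∀ x, ∫⁻ τ in Set.Ioc s (b x), f x τ =
      ∫⁻ τ, {p : α × ℝ | s < p.2 ∧ p.2 ≤ b p.1}.indicator (fun p => f p.1 p.2) (x, τ) := by
    intro x
    rw [← lintegral_indicator measurableSet_Ioc]
    refine lintegral_congr fun τ => ?_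
    simp [Set.indicator]
  simp_rw [this]
  refine Measurable.lintegral_prod_right' (Measurable.indicator hf ?_)
  exact (measurableSet_lt measurable_const measurable_snd).inter
    (measurableSet_le measurable_snd (hb.comp measurable_fst))

/-! ### The majorant -/

/-- The nonnegative forcing `∑_{j ≥ 2} (|ξ|² V)^{*j} / j!`. -/
def forcing (V : ℝ → E d → ℝ≥0∞) (t : ℝ) : E d → ℝ≥0∞ :=
  lconvExp fun ζ => efreq ζ ^ 2 * V t ζ

/-- One step of the Picard iteration for `V_t = -λ|ξ|⁴ V + κ|ξ|² ∑_{j ≥ 2} (|ξ|² V)^{*j} / j!`,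
`V(0) = κ a`. -/
def majStep (κ : ℝ≥0∞) (lam : ℝ) (a : E d → ℝ≥0∞) (V : ℝ → E d → ℝ≥0∞) (t : ℝ) (η : E d) :
    ℝ≥0∞ :=
  κ * (heat lam t η * a η +
    efreq η ^ 2 * ∫⁻ τ in Set.Ioc 0 t, heat lam (t - τ) η * forcing V τ η)

/-- The Picard iterates, started from zero. -/
def majIter (κ : ℝ≥0∞) (lam : ℝ) (a : E d → ℝ≥0∞) : ℕ → ℝ → E d → ℝ≥0∞
  | 0 => fun _ _ => 0
  | n + 1 => majStep κ lam a (majIter κ lam a n)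

/-- The majorant: the increasing limit of the Picard iterates. With `κ = λ = 1` it dominates the
Fourier transform of the solution; other values of `κ`, `λ` leave room for a growing weight. -/
def majorant (κ : ℝ≥0∞) (lam : ℝ) (a : E d → ℝ≥0∞) (t : ℝ) (η : E d) : ℝ≥0∞ :=
  ⨆ n, majIter κ lam a n t η

lemma measurable_forcing {V : ℝ → E d → ℝ≥0∞} (hV : Measurable fun p : ℝ × E d => V p.1 p.2) :
    Measurable fun p : ℝ × E d => forcing V p.1 p.2 :=
  measurable_lconvExp_param (W := fun t ζ => efreq ζ ^ 2 * V t ζ) (by fun_prop)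

lemma measurable_majStep {κ : ℝ≥0∞} {lam : ℝ} {a : E d → ℝ≥0∞} (ha : Measurable a)
    {V : ℝ → E d → ℝ≥0∞} (hV : Measurable fun p : ℝ × E d => V p.1 p.2) :
    Measurable fun p : ℝ × E d => majStep κ lam a V p.1 p.2 := by
  have hF := measurable_forcing hV
  have h := measurable_setLIntegral_Ioc (α := ℝ × E d) (b := Prod.fst)
    (f := fun p τ => heat lam (p.1 - τ) p.2 * forcing V τ p.2) (by
      have : Measurable fun q : (ℝ × E d) × ℝ => forcing V q.2 q.1.2 :=
        hF.comp (by fun_prop : Measurable fun q : (ℝ × E d) × ℝ => (q.2, q.1.2))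
      fun_prop) measurable_fst 0
  unfold majStep
  fun_prop

lemma majStep_mono {κ : ℝ≥0∞} {lam : ℝ} {a : E d → ℝ≥0∞} {V V' : ℝ → E d → ℝ≥0∞}
    (h : ∀ t η, V t η ≤ V' t η) (t : ℝ) (η : E d) :
    majStep κ lam a V t η ≤ majStep κ lam a V' t η := by
  unfold majStep
  gcongr with τ
  exact lconvExp_mono (fun ζ => by gcongr; exact h τ ζ) η

section Majorant

variable {κ : ℝ≥0∞} {lam : ℝ} {a : E d → ℝ≥0∞}

lemma measurable_majIter (ha : Measurable a) (n : ℕ) :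
    Measurable fun p : ℝ × E d => majIter κ lam a n p.1 p.2 := by
  induction n with
  | zero => exact measurable_const
  | succ n ih => exact measurable_majStep ha ih

lemma measurable_majorant (ha : Measurable a) :
    Measurable fun p : ℝ × E d => majorant κ lam a p.1 p.2 :=
  Measurable.iSup fun n => measurable_majIter ha n

lemma majIter_le_succ (n : ℕ) (t : ℝ) (η : E d) :
    majIter κ lam a n t η ≤ majIter κ lam a (n + 1) t η := by
  induction n generalizing t η with
  | zero => exact zero_le
  | succ n ih => exact majStep_mono ih t η

lemma majIter_monotone (t : ℝ) (η : E d) : Monotone fun n => majIter κ lam a n t η :=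
  monotone_nat_of_le_succ fun n => majIter_le_succ n t η

lemma forcing_majorant (ha : Measurable a) (t : ℝ) (η : E d) :
    forcing (majorant κ lam a) t η = ⨆ n, forcing (majIter κ lam a n) t η := by
  unfold forcing majorant
  simp_rw [ENNReal.mul_iSup]
  refine lconvExp_iSup (fun k => ?_) (fun x i j hij => ?_) η
  · have := (measurable_majIter (κ := κ) (lam := lam) ha k).comp (measurable_prodMk_left (x := t))
    exact (by fun_prop : Measurable fun x : E d => efreq x ^ 2).mul this
  · exact mul_le_mul_right (majIter_monotone t x hij) _

/-- The majorant is a fixed point of the Picard step, by monotone convergence. -/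
lemma majStep_majorant (ha : Measurable a) (t : ℝ) (η : E d) :
    majStep κ lam a (majorant κ lam a) t η = majorant κ lam a t η := by
  have h1 : majorant κ lam a t η = ⨆ n, majIter κ lam a (n + 1) t η :=
    ((majIter_monotone t η).iSup_nat_add 1).symm
  rw [h1]
  simp only [majIter]
  unfold majStep
  have hF := fun n => measurable_forcing (measurable_majIter (κ := κ) (lam := lam) ha n)
  rw [← ENNReal.mul_iSup, ← ENNReal.add_iSup, ← ENNReal.mul_iSup, ← lintegral_iSup]
  · simp_rw [forcing_majorant ha, ENNReal.mul_iSup]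
  · intro n
    have := (hF n).comp (measurable_prodMk_right (y := η))
    exact (by fun_prop : Measurable fun τ => heat lam (t - τ) η).mul this
  · intro i j hij τ
    refine mul_le_mul_right ?_ _
    exact lconvExp_mono (fun ζ => mul_le_mul_right (majIter_monotone τ ζ hij) _) η

/-- Duhamel's formula restarted at the time `s`. -/
lemma majStep_restart {V : ℝ → E d → ℝ≥0∞}
    (hV : Measurable fun p : ℝ × E d => V p.1 p.2) {s t : ℝ} (hs : 0 ≤ s) (hst : s ≤ t) (η : E d) :
    majStep κ lam a V t η = heat lam (t - s) η * majStep κ lam a V s η +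
      ∫⁻ r in Set.Ioc s t, heat lam (t - r) η * (κ * (efreq η ^ 2 * forcing V r η)) := by
  have hF : Measurable fun τ => forcing V τ η :=
    (measurable_forcing hV).comp (measurable_prodMk_right (y := η))
  have e1 : heat lam t η = heat lam (t - s) η * heat lam s η := by
    rw [← heat_add]; congr 1; ring
  have e2 : ∫⁻ τ in Set.Ioc 0 t, heat lam (t - τ) η * forcing V τ η =
      heat lam (t - s) η * (∫⁻ τ in Set.Ioc 0 s, heat lam (s - τ) η * forcing V τ η) +
      ∫⁻ τ in Set.Ioc s t, heat lam (t - τ) η * forcing V τ η := by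
    rw [← Set.Ioc_union_Ioc_eq_Ioc hs hst, lintegral_union measurableSet_Ioc
      (Set.Ioc_disjoint_Ioc_of_le le_rfl), ← lintegral_const_mul _ (by fun_prop)]
    congr 1
    refine lintegral_congr fun τ => ?_
    rw [← mul_assoc, ← heat_add]; congr 2; ring
  have e3 : ∫⁻ r in Set.Ioc s t, heat lam (t - r) η * (κ * (efreq η ^ 2 * forcing V r η)) =
      κ * (efreq η ^ 2 * ∫⁻ τ in Set.Ioc s t, heat lam (t - τ) η * forcing V τ η) := by
    rw [← lintegral_const_mul _ (by fun_prop), ← lintegral_const_mul _ (by fun_prop)]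
    refine lintegral_congr fun τ => ?_
    ring
  rw [e3]
  unfold majStep
  rw [e1, e2]; ring

lemma majStep_zero (V : ℝ → E d → ℝ≥0∞) (η : E d) : majStep κ lam a V 0 η = κ * a η := by
  simp [majStep, heat_zero]

/-- The integrated equation `v_t + λ|ξ|⁴ v = κ|ξ|² F` at a single frequency. -/
lemma majStep_dissipation (hl : 0 ≤ lam) {V : ℝ → E d → ℝ≥0∞}
    (hV : Measurable fun p : ℝ × E d => V p.1 p.2) {s t : ℝ} (hs : 0 ≤ s) (hst : s ≤ t) (η : E d) :
    majStep κ lam a V t η +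
        ENNReal.ofReal lam * efreq η ^ 4 * ∫⁻ τ in Set.Ioc s t, majStep κ lam a V τ η =
      majStep κ lam a V s η + κ * (efreq η ^ 2 * ∫⁻ r in Set.Ioc s t, forcing V r η) := by
  have hF : Measurable fun τ => forcing V τ η :=
    (measurable_forcing hV).comp (measurable_prodMk_right (y := η))
  rw [duhamel_add_dissipation hl hst η (v := fun τ => majStep κ lam a V τ η)
    (g := fun r => κ * (efreq η ^ 2 * forcing V r η)) (by fun_prop)
    fun τ hτ => majStep_restart hV hs hτ.1 η]
  rw [lintegral_const_mul _ (by fun_prop), lintegral_const_mul _ (by fun_prop)]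

/-- Integrating the single-frequency dissipation against `|ξ|²`. -/
lemma lintegral_dissipation {v F : ℝ → E d → ℝ≥0∞} (hv : Measurable fun p : ℝ × E d => v p.1 p.2)
    (hF : Measurable fun p : ℝ × E d => F p.1 p.2) {s t : ℝ} {c : ℝ≥0∞}
    (h : ∀ η, v t η + c * efreq η ^ 4 * ∫⁻ τ in Set.Ioc s t, v τ η =
      v s η + κ * (efreq η ^ 2 * ∫⁻ r in Set.Ioc s t, F r η)) :
    (∫⁻ η, efreq η ^ 2 * v t η) + c * ∫⁻ τ in Set.Ioc s t, ∫⁻ η, efreq η ^ 6 * v τ η =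
      (∫⁻ η, efreq η ^ 2 * v s η) +
        κ * ∫⁻ r in Set.Ioc s t, ∫⁻ η, efreq η ^ 4 * F r η := by
  have hv' : Measurable fun p : E d × ℝ => v p.2 p.1 := hv.comp measurable_swap
  have hF' : Measurable fun p : E d × ℝ => F p.2 p.1 := hF.comp measurable_swap
  have hvt : ∀ t, Measurable fun η => v t η := fun t => hv.comp measurable_prodMk_left
  have hvη : ∀ η, Measurable fun t => v t η := fun t => hv.comp measurable_prodMk_right
  have hFη : ∀ η, Measurable fun t => F t η := fun t => hF.comp measurable_prodMk_right
  have h1 : ∫⁻ τ in Set.Ioc s t, ∫⁻ η, efreq η ^ 6 * v τ η =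
      ∫⁻ η, efreq η ^ 6 * ∫⁻ τ in Set.Ioc s t, v τ η := by
    rw [lintegral_lintegral_swap (by fun_prop)]
    exact lintegral_congr fun η => lintegral_const_mul _ (hvη η)
  have h2 : ∫⁻ r in Set.Ioc s t, ∫⁻ η, efreq η ^ 4 * F r η =
      ∫⁻ η, efreq η ^ 4 * ∫⁻ r in Set.Ioc s t, F r η := by
    rw [lintegral_lintegral_swap (by fun_prop)]
    exact lintegral_congr fun η => lintegral_const_mul _ (hFη η)
  have hmv : Measurable fun η => ∫⁻ τ in Set.Ioc s t, v τ η := hv'.lintegral_prod_right'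
  have hmF : Measurable fun η => ∫⁻ τ in Set.Ioc s t, F τ η := hF'.lintegral_prod_right'
  have := hvt t
  have := hvt s
  rw [h1, h2, ← lintegral_const_mul _ (by fun_prop), ← lintegral_const_mul _ (by fun_prop),
    ← lintegral_add_left (by fun_prop), ← lintegral_add_left (by fun_prop)]
  refine lintegral_congr fun η => ?_
  calc _ = efreq η ^ 2 * (v t η + c * efreq η ^ 4 * ∫⁻ τ in Set.Ioc s t, v τ η) := by ring
    _ = _ := by rw [h η]; ring

lemma measurable_lintegral_efreq_mul {V : ℝ → E d → ℝ≥0∞}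
    (hV : Measurable fun p : ℝ × E d => V p.1 p.2) (k : ℕ) :
    Measurable fun τ => ∫⁻ η, efreq η ^ k * V τ η :=
  Measurable.lintegral_prod_right' (f := fun p : ℝ × E d => efreq p.2 ^ k * V p.1 p.2)
    (by fun_prop)

/-- The balance of the second moments, with forcing controlled by the sixth moments. -/
lemma majStep_moment_balance (ha : Measurable a) (hl : 0 ≤ lam)
    {V : ℝ → E d → ℝ≥0∞} (hV : Measurable fun p : ℝ × E d => V p.1 p.2) {M : ℝ≥0∞}
    {s t : ℝ} (hs : 0 ≤ s) (hst : s ≤ t)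
    (hM : ∀ τ, 0 ≤ τ → ∫⁻ η, efreq η ^ 2 * V τ η ≤ M) :
    (∫⁻ η, efreq η ^ 2 * majStep κ lam a V t η) +
        ENNReal.ofReal lam *
          ∫⁻ τ in Set.Ioc s t, ∫⁻ η, efreq η ^ 6 * majStep κ lam a V τ η ≤
      (∫⁻ η, efreq η ^ 2 * majStep κ lam a V s η) +
        κ * ef₂ M * ∫⁻ τ in Set.Ioc s t, ∫⁻ η, efreq η ^ 6 * V τ η := by
  rw [lintegral_dissipation (measurable_majStep ha hV) (measurable_forcing hV)
    (majStep_dissipation hl hV hs hst), mul_assoc]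
  gcongr
  rw [← lintegral_const_mul _ (measurable_lintegral_efreq_mul hV 6)]
  refine setLIntegral_mono' measurableSet_Ioc fun τ hτ => ?_
  have hVτ : Measurable fun η => V τ η := hV.comp measurable_prodMk_left
  refine (lintegral_efreq_lconvExp_le (W := fun ζ => efreq ζ ^ 2 * V τ ζ)
    (by fun_prop)).trans ?_
  exact mul_le_mul' (ef₂_mono (hM τ (hs.trans hτ.1.le)))
    (le_of_eq (lintegral_congr fun η => by ring))

/-- The Picard iterates obey the energy inequality with the sharp constant. Monotonicity in `n`
is what allows the sixth moment of the previous iterate to be absorbed. -/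
lemma majIter_energy (ha : Measurable a) (hl : 0 < lam) {Y σ : ℝ≥0∞} (hY : Y ≠ ∞)
    (haY : κ * ∫⁻ η, efreq η ^ 2 * a η ≤ Y) (hσ : σ + κ * ef₂ Y ≤ ENNReal.ofReal lam)
    (n : ℕ) (t : ℝ) (ht : 0 ≤ t) :
    (∫⁻ η, efreq η ^ 2 * majIter κ lam a n t η) +
        σ * (∫⁻ τ in Set.Ioc 0 t, ∫⁻ η, efreq η ^ 6 * majIter κ lam a n τ η) ≤ Y ∧
      ∫⁻ τ in Set.Ioc 0 t, ∫⁻ η, efreq η ^ 6 * majIter κ lam a n τ η ≠ ∞ := by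
  induction n generalizing t with
  | zero => simp [majIter]
  | succ n ih =>
    have hb := majStep_moment_balance (κ := κ) (lam := lam) ha hl.le
      (measurable_majIter (κ := κ) (lam := lam) ha n) le_rfl ht
      (M := Y) fun τ hτ => le_self_add.trans (ih τ hτ).1
    have h0 : ∫⁻ η, efreq η ^ 2 * majStep κ lam a (majIter κ lam a n) 0 η ≤ Y := by
      simp_rw [majStep_zero]
      refine le_trans (le_of_eq ?_) haY
      rw [← lintegral_const_mul _ (by fun_prop)]
      exact lintegral_congr fun η => by ring
    have hκf : κ * ef₂ Y ≠ ∞ := ne_top_of_le_ne_top ENNReal.ofReal_ne_top (le_add_self.trans hσ)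
    change _ + _ * (∫⁻ τ in Set.Ioc 0 t, ∫⁻ η, efreq η ^ 6 *
      majStep κ lam a (majIter κ lam a n) τ η) ≤ Y ∧ _
    have hmono : ∫⁻ τ in Set.Ioc 0 t, ∫⁻ η, efreq η ^ 6 * majIter κ lam a n τ η ≤
        ∫⁻ τ in Set.Ioc 0 t, ∫⁻ η, efreq η ^ 6 * majStep κ lam a (majIter κ lam a n) τ η := by
      gcongr with τ η
      exact majIter_le_succ n τ η
    have hb' := hb.trans (add_le_add_left h0 _)
    set B := ∫⁻ τ in Set.Ioc 0 t, ∫⁻ η, efreq η ^ 6 * majIter κ lam a n τ η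
    set B' := ∫⁻ τ in Set.Ioc 0 t, ∫⁻ η, efreq η ^ 6 * majStep κ lam a (majIter κ lam a n) τ η
    have hB' : B' ≠ ∞ := by
      have : ENNReal.ofReal lam * B' ≠ ∞ := ne_top_of_le_ne_top
        (ENNReal.add_ne_top.2 ⟨hY, ENNReal.mul_ne_top hκf (ih t ht).2⟩) (le_add_self.trans hb')
      intro h
      rw [h, ENNReal.mul_top (by simpa using hl)] at this
      exact this rfl
    refine ⟨?_, hB'⟩
    have h1 : (∫⁻ η, efreq η ^ 2 * majStep κ lam a (majIter κ lam a n) t η) + σ * B' +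
        κ * ef₂ Y * B' ≤ Y + κ * ef₂ Y * B' := by
      calc _ = (∫⁻ η, efreq η ^ 2 * majStep κ lam a (majIter κ lam a n) t η) +
            (σ + κ * ef₂ Y) * B' := by ring
        _ ≤ _ := by gcongr
        _ ≤ _ := hb'
        _ ≤ _ := by gcongr
    exact (ENNReal.add_le_add_iff_right (ENNReal.mul_ne_top hκf hB')).1 h1

/-- The energy inequality of the majorant, which implies its finiteness for all times. -/
lemma majorant_energy (ha : Measurable a) (hl : 0 < lam) {Y σ : ℝ≥0∞} (hY : Y ≠ ∞)
    (haY : κ * ∫⁻ η, efreq η ^ 2 * a η ≤ Y) (hσ : σ + κ * ef₂ Y ≤ ENNReal.ofReal lam)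
    (t : ℝ) (ht : 0 ≤ t) :
    (∫⁻ η, efreq η ^ 2 * majorant κ lam a t η) +
      σ * (∫⁻ τ in Set.Ioc 0 t, ∫⁻ η, efreq η ^ 6 * majorant κ lam a τ η) ≤ Y := by
  have hm := fun n => measurable_majIter (κ := κ) (lam := lam) ha n
  have hmt : ∀ n t, Measurable fun η => majIter κ lam a n t η := fun n t =>
    (hm n).comp measurable_prodMk_left
  have hk : ∀ (k : ℕ) (t : ℝ), ∫⁻ η, efreq η ^ k * majorant κ lam a t η =
      ⨆ n, ∫⁻ η, efreq η ^ k * majIter κ lam a n t η := by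
    intro k t
    rw [← lintegral_iSup]
    · simp_rw [majorant, ENNReal.mul_iSup]
    · intro n; have := hmt n t; fun_prop
    · exact fun i j hij η => mul_le_mul_right (majIter_monotone t η hij) _
  simp_rw [hk]
  rw [lintegral_iSup, ENNReal.mul_iSup, ENNReal.iSup_add_iSup_of_monotone]
  · exact iSup_le fun n => (majIter_energy ha hl hY haY hσ n t ht).1
  · exact fun i j hij => lintegral_mono fun η => mul_le_mul_right (majIter_monotone t η hij) _
  · exact fun i j hij => mul_le_mul_right (lintegral_mono fun τ => lintegral_mono fun η =>
      mul_le_mul_right (majIter_monotone τ η hij) _) _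
  · exact fun n => measurable_lintegral_efreq_mul (hm n) 6
  · exact fun i j hij τ => lintegral_mono fun η =>
      mul_le_mul_right (majIter_monotone τ η hij) _

/-- The energy inequality of the majorant between two times. -/
lemma majorant_energy_restart (ha : Measurable a) (hl : 0 < lam) {Y σ : ℝ≥0∞} (hY : Y ≠ ∞)
    (haY : κ * ∫⁻ η, efreq η ^ 2 * a η ≤ Y) (hσ : σ + κ * ef₂ Y ≤ ENNReal.ofReal lam)
    (hσ0 : σ ≠ 0) {s t : ℝ} (hs : 0 ≤ s) (hst : s ≤ t) :
    (∫⁻ η, efreq η ^ 2 * majorant κ lam a t η) +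
      σ * (∫⁻ τ in Set.Ioc s t, ∫⁻ η, efreq η ^ 6 * majorant κ lam a τ η) ≤
      ∫⁻ η, efreq η ^ 2 * majorant κ lam a s η := by
  have hen := majorant_energy ha hl hY haY hσ
  have hb := majStep_moment_balance (κ := κ) (lam := lam) ha hl.le
      (measurable_majorant (κ := κ) (lam := lam) ha) hs hst
      (M := Y) fun τ hτ => le_self_add.trans (hen τ hτ)
  simp_rw [majStep_majorant ha] at hb
  have hκf : κ * ef₂ Y ≠ ∞ := ne_top_of_le_ne_top ENNReal.ofReal_ne_top (le_add_self.trans hσ)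
  have hfin : ∫⁻ τ in Set.Ioc s t, ∫⁻ η, efreq η ^ 6 * majorant κ lam a τ η ≠ ∞ := by
    intro h
    have h1 : ∫⁻ τ in Set.Ioc 0 t, ∫⁻ η, efreq η ^ 6 * majorant κ lam a τ η = ∞ := by
      rw [eq_top_iff, ← h]
      exact lintegral_mono_set (Set.Ioc_subset_Ioc_left hs)
    have h2 := hen t (hs.trans hst)
    rw [h1, ENNReal.mul_top hσ0, add_top, top_le_iff] at h2
    exact hY h2
  refine (ENNReal.add_le_add_iff_right (ENNReal.mul_ne_top hκf hfin)).1 ?_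
  refine le_trans ?_ hb
  calc _ = (∫⁻ η, efreq η ^ 2 * majorant κ lam a t η) + (σ + κ * ef₂ Y) *
        ∫⁻ τ in Set.Ioc s t, ∫⁻ η, efreq η ^ 6 * majorant κ lam a τ η := by ring
    _ ≤ _ := by gcongr

end Majorant

/-! ### Time-independent bounds of the majorant -/

/-- The smallness condition under which the majorant with initial datum `κ a` is global: `Y` bounds
its second moment, and `σ` is the dissipation left over by the nonlinearity. -/
structure Subcritical (κ : ℝ≥0∞) (lam : ℝ) (a : E d → ℝ≥0∞) (Y σ : ℝ≥0∞) : Prop where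
  measurable : Measurable a
  lam_pos : 0 < lam
  ne_top : Y ≠ ∞
  moment_le : κ * ∫⁻ η, efreq η ^ 2 * a η ≤ Y
  dissipation : σ + κ * ef₂ Y ≤ ENNReal.ofReal lam
  sigma_ne_zero : σ ≠ 0

/-- A time-independent bound of the majorant: initial datum plus total forcing. -/
def majSup (κ : ℝ≥0∞) (lam : ℝ) (a : E d → ℝ≥0∞) (η : E d) : ℝ≥0∞ :=
  κ * (a η + efreq η ^ 2 * ∫⁻ τ in Set.Ioi 0, forcing (majorant κ lam a) τ η)

/-- A time-independent bound of the square of the majorant. -/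
def majSq (κ : ℝ≥0∞) (lam : ℝ) (a : E d → ℝ≥0∞) (η : E d) : ℝ≥0∞ :=
  2 * κ ^ 2 * (a η ^ 2 + (ENNReal.ofReal lam)⁻¹ *
    ∫⁻ τ in Set.Ioi 0, forcing (majorant κ lam a) τ η ^ 2)

lemma setLIntegral_Ioi_le {f : ℝ → ℝ≥0∞} {C : ℝ≥0∞}
    (h : ∀ t, 0 ≤ t → ∫⁻ τ in Set.Ioc 0 t, f τ ≤ C) : ∫⁻ τ in Set.Ioi 0, f τ ≤ C := by
  have hU : Set.Ioi (0 : ℝ) = ⋃ n : ℕ, Set.Ioc (0 : ℝ) n := by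
    ext x
    simp only [Set.mem_Ioi, Set.mem_iUnion, Set.mem_Ioc, exists_and_left]
    exact ⟨fun hx => ⟨hx, exists_nat_ge x⟩, fun hx => hx.1⟩
  rw [hU, setLIntegral_iUnion_of_directed]
  · exact iSup_le fun n => h n (Nat.cast_nonneg n)
  · exact (monotone_nat_of_le_succ fun n => Set.Ioc_subset_Ioc_right (by simp)).directed_le

section TimeKernel

variable {lam : ℝ}

lemma setLIntegral_heat_le_one (hl : 0 ≤ lam) (s t : ℝ) (η : E d) :
    ENNReal.ofReal lam * efreq η ^ 4 * ∫⁻ τ in Set.Ioc s t, heat lam (τ - s) η ≤ 1 := by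
  rcases le_total s t with h | h
  · exact le_add_self.trans (setLIntegral_heat_add hl h η).le
  · simp [Set.Ioc_eq_empty (not_lt.2 h)]

lemma setLIntegral_heat_rev (t : ℝ) (η : E d) :
    ∫⁻ τ in Set.Ioc 0 t, heat lam (t - τ) η = ∫⁻ τ in Set.Ioc 0 t, heat lam (τ - 0) η := by
  have h := setLIntegral_congr (f := fun τ => heat lam (t - τ) η) (μ := volume)
    (Ioo_ae_eq_Ioc (a := (0 : ℝ)) (b := t))
  have h' := setLIntegral_congr (f := fun τ => heat lam (τ - 0) η) (μ := volume)
    (Ioo_ae_eq_Ioc (a := (0 : ℝ)) (b := t))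
  rw [← h, ← h', ← lintegral_indicator measurableSet_Ioo, ← lintegral_indicator measurableSet_Ioo,
    ← lintegral_sub_left_eq_self _ t]
  refine lintegral_congr fun τ => ?_
  by_cases hτ : τ ∈ Set.Ioo 0 t
  · rw [Set.indicator_of_mem (by simp at hτ ⊢; exact ⟨hτ.2, hτ.1⟩), Set.indicator_of_mem hτ]
    simp
  · rw [Set.indicator_of_notMem (by simp at hτ ⊢; intro h1; by_contra h2; linarith [hτ (by linarith)]),
      Set.indicator_of_notMem hτ]

/-- Cauchy–Schwarz against the kernel `λ|ξ|⁴ e^{-λ(t-τ)|ξ|⁴}`, whose mass is at most one. -/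
lemma sq_setLIntegral_heat_mul_le (hl : 0 ≤ lam) {g : ℝ → ℝ≥0∞} (hg : Measurable g) (t : ℝ)
    (η : E d) :
    ENNReal.ofReal lam * efreq η ^ 4 * (∫⁻ τ in Set.Ioc 0 t, heat lam (t - τ) η * g τ) ^ 2 ≤
      ∫⁻ τ in Set.Ioc 0 t, heat lam (t - τ) η * g τ ^ 2 := by
  calc _ ≤ ENNReal.ofReal lam * efreq η ^ 4 * ((∫⁻ τ in Set.Ioc 0 t, heat lam (t - τ) η) *
        ∫⁻ τ in Set.Ioc 0 t, heat lam (t - τ) η * g τ ^ 2) := by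
        gcongr
        exact sq_lintegral_mul_le _ (by fun_prop) (by fun_prop)
    _ = (ENNReal.ofReal lam * efreq η ^ 4 * ∫⁻ τ in Set.Ioc 0 t, heat lam (τ - 0) η) *
        ∫⁻ τ in Set.Ioc 0 t, heat lam (t - τ) η * g τ ^ 2 := by
        rw [setLIntegral_heat_rev]; ring
    _ ≤ 1 * _ := by gcongr; exact setLIntegral_heat_le_one hl 0 t η
    _ = _ := one_mul _

/-- Maximal regularity in `L²` in time for a single frequency. -/
lemma setLIntegral_sq_duhamel_le (hl : 0 ≤ lam) {g : ℝ → ℝ≥0∞} (hg : Measurable g) (T : ℝ)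
    (η : E d) :
    (ENNReal.ofReal lam * efreq η ^ 4) ^ 2 *
        ∫⁻ t in Set.Ioc 0 T, (∫⁻ τ in Set.Ioc 0 t, heat lam (t - τ) η * g τ) ^ 2 ≤
      ∫⁻ τ in Set.Ioc 0 T, g τ ^ 2 := by
  set c := ENNReal.ofReal lam * efreq η ^ 4 with hc
  have hct : c ≠ ∞ := ENNReal.mul_ne_top ENNReal.ofReal_ne_top (ENNReal.pow_ne_top (efreq_ne_top η))
  calc _ = c * ∫⁻ t in Set.Ioc 0 T, c * (∫⁻ τ in Set.Ioc 0 t, heat lam (t - τ) η * g τ) ^ 2 := by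
        rw [lintegral_const_mul' _ _ hct]; ring
    _ ≤ c * ∫⁻ t in Set.Ioc 0 T, ∫⁻ τ in Set.Ioc 0 t, heat lam (t - τ) η * g τ ^ 2 := by
        gcongr with t
        exact sq_setLIntegral_heat_mul_le hl hg t η
    _ = c * ∫⁻ r in Set.Ioc 0 T, (∫⁻ t in Set.Ioc r T, heat lam (t - r) η) * g r ^ 2 := by
        rw [setLIntegral_triangle (by fun_prop)]
        congr 1
        exact lintegral_congr fun r => lintegral_mul_const _ (by fun_prop)
    _ = ∫⁻ r in Set.Ioc 0 T, (c * ∫⁻ t in Set.Ioc r T, heat lam (t - r) η) * g r ^ 2 := by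
        rw [← lintegral_const_mul' _ _ hct]
        exact lintegral_congr fun r => by ring
    _ ≤ _ := by
        refine lintegral_mono fun r => ?_
        exact mul_le_of_le_one_left' (setLIntegral_heat_le_one hl r T η)

end TimeKernel

section Bounds

variable {κ : ℝ≥0∞} {lam : ℝ} {a : E d → ℝ≥0∞} {Y σ : ℝ≥0∞}

lemma measurable_forcing_majorant (ha : Measurable a) :
    Measurable fun p : ℝ × E d => forcing (majorant κ lam a) p.1 p.2 :=
  measurable_forcing (measurable_majorant ha)

lemma measurable_setLIntegral_Ioi {F : ℝ → E d → ℝ≥0∞}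
    (hF : Measurable fun p : ℝ × E d => F p.1 p.2) :
    Measurable fun η => ∫⁻ τ in Set.Ioi 0, F τ η :=
  Measurable.lintegral_prod_right' (ν := volume.restrict (Set.Ioi 0))
    (f := fun p : E d × ℝ => F p.2 p.1) (hF.comp measurable_swap)

lemma measurable_majSup (ha : Measurable a) : Measurable (majSup κ lam a) :=
  measurable_const.mul (ha.add ((measurable_efreq.pow_const 2).mul
    (measurable_setLIntegral_Ioi (measurable_forcing_majorant ha))))

/-- Integrating a bound of the form `a + |ξ|² ∫ F` against `|ξ|²`. -/
lemma lintegral_efreq_sq_mul_majSup (ha : Measurable a) {F : ℝ → E d → ℝ≥0∞}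
    (hF : Measurable fun p : ℝ × E d => F p.1 p.2) :
    ∫⁻ η, efreq η ^ 2 * (κ * (a η + efreq η ^ 2 * ∫⁻ τ in Set.Ioi 0, F τ η)) =
      κ * (∫⁻ η, efreq η ^ 2 * a η) + κ * ∫⁻ τ in Set.Ioi 0, ∫⁻ η, efreq η ^ 4 * F τ η := by
  have hm := measurable_setLIntegral_Ioi hF
  rw [lintegral_lintegral_swap (by fun_prop)]
  have e : ∀ η, ∫⁻ τ in Set.Ioi 0, efreq η ^ 4 * F τ η = efreq η ^ 4 * ∫⁻ τ in Set.Ioi 0, F τ η :=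
    fun η => lintegral_const_mul' _ _ (ENNReal.pow_ne_top (efreq_ne_top η))
  simp_rw [e]
  rw [← lintegral_const_mul _ (by fun_prop), ← lintegral_const_mul _ (by fun_prop),
    ← lintegral_add_left (by fun_prop)]
  exact lintegral_congr fun η => by ring

lemma majorant_le_majSup (ha : Measurable a) (hl : 0 ≤ lam) {t : ℝ} (ht : 0 ≤ t) (η : E d) :
    majorant κ lam a t η ≤ majSup κ lam a η := by
  rw [← majStep_majorant ha]
  unfold majStep majSup
  refine mul_le_mul' le_rfl (add_le_add (mul_le_of_le_one_left' (heat_le_one hl ht η))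
    (mul_le_mul' le_rfl ?_))
  calc _ ≤ ∫⁻ τ in Set.Ioc 0 t, forcing (majorant κ lam a) τ η :=
        setLIntegral_mono' measurableSet_Ioc fun τ hτ =>
          mul_le_of_le_one_left' (heat_le_one hl (sub_nonneg.2 hτ.2) η)
    _ ≤ _ := lintegral_mono_set Set.Ioc_subset_Ioi_self

namespace Subcritical

lemma energy (h : Subcritical κ lam a Y σ) {t : ℝ} (ht : 0 ≤ t) :
    (∫⁻ η, efreq η ^ 2 * majorant κ lam a t η) +
      σ * (∫⁻ τ in Set.Ioc 0 t, ∫⁻ η, efreq η ^ 6 * majorant κ lam a τ η) ≤ Y :=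
  majorant_energy h.measurable h.lam_pos h.ne_top h.moment_le h.dissipation t ht

lemma moment_majorant_le (h : Subcritical κ lam a Y σ) {t : ℝ} (ht : 0 ≤ t) :
    ∫⁻ η, efreq η ^ 2 * majorant κ lam a t η ≤ Y := le_self_add.trans (h.energy ht)

lemma energy_restart (h : Subcritical κ lam a Y σ) {s t : ℝ} (hs : 0 ≤ s) (hst : s ≤ t) :
    (∫⁻ η, efreq η ^ 2 * majorant κ lam a t η) +
      σ * (∫⁻ τ in Set.Ioc s t, ∫⁻ η, efreq η ^ 6 * majorant κ lam a τ η) ≤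
      ∫⁻ η, efreq η ^ 2 * majorant κ lam a s η :=
  majorant_energy_restart h.measurable h.lam_pos h.ne_top h.moment_le h.dissipation
    h.sigma_ne_zero hs hst

lemma mul_ef₂_ne_top (h : Subcritical κ lam a Y σ) : κ * ef₂ Y ≠ ∞ :=
  ne_top_of_le_ne_top ENNReal.ofReal_ne_top (le_add_self.trans h.dissipation)

lemma sigma_ne_top (h : Subcritical κ lam a Y σ) : σ ≠ ∞ :=
  ne_top_of_le_ne_top ENNReal.ofReal_ne_top (le_self_add.trans h.dissipation)

lemma dissipation_lt_top (h : Subcritical κ lam a Y σ) :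
    ∫⁻ τ in Set.Ioi 0, ∫⁻ η, efreq η ^ 6 * majorant κ lam a τ η < ∞ := by
  refine lt_of_le_of_lt (setLIntegral_Ioi_le (C := Y / σ) fun t ht => ?_)
    (ENNReal.div_lt_top h.ne_top h.sigma_ne_zero)
  rw [ENNReal.le_div_iff_mul_le (Or.inl h.sigma_ne_zero) (Or.inl h.sigma_ne_top), mul_comm]
  exact le_add_self.trans (h.energy ht)

lemma moment_forcing_lt_top (h : Subcritical κ lam a Y σ) :
    κ * ∫⁻ τ in Set.Ioi 0, ∫⁻ η, efreq η ^ 4 * forcing (majorant κ lam a) τ η < ∞ := by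
  have hV := measurable_majorant (κ := κ) (lam := lam) h.measurable
  calc _ ≤ κ * ∫⁻ τ in Set.Ioi 0, ef₂ Y * ∫⁻ η, efreq η ^ 6 * majorant κ lam a τ η := by
        gcongr κ * ?_
        refine setLIntegral_mono' measurableSet_Ioi fun τ hτ => ?_
        have hVτ : Measurable fun η => majorant κ lam a τ η := hV.comp measurable_prodMk_left
        refine (lintegral_efreq_lconvExp_le (W := fun ζ => efreq ζ ^ 2 * majorant κ lam a τ ζ)
          (by fun_prop)).trans ?_
        exact mul_le_mul' (ef₂_mono (h.moment_majorant_le (le_of_lt hτ)))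
          (le_of_eq (lintegral_congr fun η => by ring))
    _ = κ * ef₂ Y * ∫⁻ τ in Set.Ioi 0, ∫⁻ η, efreq η ^ 6 * majorant κ lam a τ η := by
        rw [lintegral_const_mul _ (measurable_lintegral_efreq_mul hV 6), mul_assoc]
    _ < ∞ := ENNReal.mul_lt_top h.mul_ef₂_ne_top.lt_top h.dissipation_lt_top

/-- The supremum in time of the majorant has a finite second moment. -/
lemma moment_majSup_lt_top (h : Subcritical κ lam a Y σ) :
    ∫⁻ η, efreq η ^ 2 * majSup κ lam a η < ∞ := by
  unfold majSup
  rw [lintegral_efreq_sq_mul_majSup h.measurable (measurable_forcing_majorant h.measurable)]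
  exact ENNReal.add_lt_top.2 ⟨lt_of_le_of_lt h.moment_le h.ne_top.lt_top, h.moment_forcing_lt_top⟩

lemma sixteen_mul_lconvExpDiv_le {W : E d → ℝ≥0∞} (hW : Measurable W)
    (hWY : ∫⁻ η, W η ≤ Y) : 16 * ∫⁻ η, lconvExpDiv W η ≤ ef₂ Y :=
  (lintegral_lconvExpDiv_le hW).trans (ef₂_mono hWY)

/-- The space-time `L²` bound of `|ξ|² V` for the iterates. The contraction factor comes from the
`L²` operator norm of the nonlinearity, which is at most `f₂ / 16`. -/
lemma lintegral_sq_majIter_le (h : Subcritical κ lam a Y σ) (n : ℕ) (T : ℝ) :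
    ∫⁻ t in Set.Ioc 0 T, ∫⁻ η, (efreq η ^ 2 * majIter κ lam a n t η) ^ 2 ≤
      4 * κ ^ 2 * (ENNReal.ofReal lam)⁻¹ * ∫⁻ η, a η ^ 2 := by
  have ha := h.measurable
  set L := ENNReal.ofReal lam with hL
  have hL0 : L ≠ 0 := by simpa [hL] using h.lam_pos
  have hLt : L ≠ ∞ := ENNReal.ofReal_ne_top
  induction n with
  | zero => simp [majIter]
  | succ n ih =>
    have hm := measurable_majIter (κ := κ) (lam := lam) ha n
    have hF := measurable_forcing hm
    have hFη : ∀ η, Measurable fun t => forcing (majIter κ lam a n) t η := fun t =>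
      hF.comp measurable_prodMk_right
    have hF' : Measurable fun p : E d × ℝ => forcing (majIter κ lam a n) p.2 p.1 :=
      hF.comp measurable_swap
    have hS := measurable_majIter (κ := κ) (lam := lam) ha (n + 1)
    -- at a single frequency, by maximal regularity of the heat kernel
    have h1 : ∀ η, L ^ 2 * ∫⁻ t in Set.Ioc 0 T, (efreq η ^ 2 * majIter κ lam a (n + 1) t η) ^ 2 ≤
        2 * κ ^ 2 * L * a η ^ 2 +
          2 * κ ^ 2 * ∫⁻ τ in Set.Ioc 0 T, forcing (majIter κ lam a n) τ η ^ 2 := by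
      intro η
      have hFη' := hFη η
      have hD : Measurable fun t =>
          ∫⁻ τ in Set.Ioc 0 t, heat lam (t - τ) η * forcing (majIter κ lam a n) τ η :=
        measurable_setLIntegral_Ioc (α := ℝ) (b := fun t => t)
          (f := fun t τ => heat lam (t - τ) η * forcing (majIter κ lam a n) τ η)
          (by fun_prop) measurable_id 0
      have hp : ∀ t ∈ Set.Ioc 0 T, (efreq η ^ 2 * majIter κ lam a (n + 1) t η) ^ 2 ≤
          2 * κ ^ 2 * efreq η ^ 4 * a η ^ 2 * heat lam (t - 0) η + 2 * κ ^ 2 * efreq η ^ 8 *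
          (∫⁻ τ in Set.Ioc 0 t, heat lam (t - τ) η * forcing (majIter κ lam a n) τ η) ^ 2 := by
        intro t ht
        have hh : heat lam t η ^ 2 ≤ heat lam t η := by
          rw [sq]; exact mul_le_of_le_one_left' (heat_le_one h.lam_pos.le ht.1.le η)
        calc _ = (efreq η ^ 2 * κ) ^ 2 * (heat lam t η * a η + efreq η ^ 2 *
              ∫⁻ τ in Set.Ioc 0 t, heat lam (t - τ) η * forcing (majIter κ lam a n) τ η) ^ 2 := by
              simp only [majIter, majStep]; ring
          _ ≤ (efreq η ^ 2 * κ) ^ 2 * (2 * (heat lam t η * a η) ^ 2 + 2 * (efreq η ^ 2 *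
              ∫⁻ τ in Set.Ioc 0 t, heat lam (t - τ) η * forcing (majIter κ lam a n) τ η) ^ 2) := by
              gcongr; exact add_sq_le_two_mul _ _
          _ = 2 * κ ^ 2 * efreq η ^ 4 * a η ^ 2 * heat lam t η ^ 2 + 2 * κ ^ 2 * efreq η ^ 8 *
            (∫⁻ τ in Set.Ioc 0 t, heat lam (t - τ) η * forcing (majIter κ lam a n) τ η) ^ 2 := by
              ring
          _ ≤ _ := by rw [sub_zero]; gcongr
      calc _ ≤ L ^ 2 * ∫⁻ t in Set.Ioc 0 T,
            (2 * κ ^ 2 * efreq η ^ 4 * a η ^ 2 * heat lam (t - 0) η + 2 * κ ^ 2 * efreq η ^ 8 *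
            (∫⁻ τ in Set.Ioc 0 t, heat lam (t - τ) η * forcing (majIter κ lam a n) τ η) ^ 2) := by
            gcongr L ^ 2 * ?_
            exact setLIntegral_mono' measurableSet_Ioc hp
        _ = 2 * κ ^ 2 * L * a η ^ 2 * (L * efreq η ^ 4 *
              ∫⁻ t in Set.Ioc 0 T, heat lam (t - 0) η) +
            2 * κ ^ 2 * ((L * efreq η ^ 4) ^ 2 * ∫⁻ t in Set.Ioc 0 T,
            (∫⁻ τ in Set.Ioc 0 t, heat lam (t - τ) η * forcing (majIter κ lam a n) τ η) ^ 2) := by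
            rw [lintegral_add_left (by fun_prop), lintegral_const_mul _ (by fun_prop),
              lintegral_const_mul _ (by fun_prop)]
            ring
        _ ≤ 2 * κ ^ 2 * L * a η ^ 2 * 1 +
            2 * κ ^ 2 * ∫⁻ τ in Set.Ioc 0 T, forcing (majIter κ lam a n) τ η ^ 2 := by
            gcongr
            · exact setLIntegral_heat_le_one h.lam_pos.le 0 T η
            · exact setLIntegral_sq_duhamel_le h.lam_pos.le hFη' T η
        _ = _ := by rw [mul_one]
    have h2 : ∫⁻ τ in Set.Ioc 0 T, ∫⁻ η, forcing (majIter κ lam a n) τ η ^ 2 ≤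
        (ef₂ Y / 16) ^ 2 *
          ∫⁻ t in Set.Ioc 0 T, ∫⁻ η, (efreq η ^ 2 * majIter κ lam a n t η) ^ 2 := by
      have hmm : Measurable fun t => ∫⁻ η, (efreq η ^ 2 * majIter κ lam a n t η) ^ 2 :=
        Measurable.lintegral_prod_right'
          (f := fun p : ℝ × E d => (efreq p.2 ^ 2 * majIter κ lam a n p.1 p.2) ^ 2) (by fun_prop)
      rw [← lintegral_const_mul _ hmm]
      refine setLIntegral_mono' measurableSet_Ioc fun τ hτ => ?_
      have hVτ : Measurable fun η => majIter κ lam a n τ η := hm.comp measurable_prodMk_left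
      refine (lintegral_sq_lconvExp_le (W := fun ζ => efreq ζ ^ 2 * majIter κ lam a n τ ζ)
        (by fun_prop)).trans ?_
      gcongr
      rw [ENNReal.le_div_iff_mul_le (by simp) (by simp), mul_comm]
      exact sixteen_mul_lconvExpDiv_le (by fun_prop) (le_self_add.trans
        (majIter_energy ha h.lam_pos h.ne_top h.moment_le h.dissipation n τ hτ.1.le).1)
    have h3 : L ^ 2 * ∫⁻ t in Set.Ioc 0 T, ∫⁻ η, (efreq η ^ 2 * majIter κ lam a (n + 1) t η) ^ 2 ≤
        2 * κ ^ 2 * L * (∫⁻ η, a η ^ 2) + 2 * κ ^ 2 *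
          ∫⁻ τ in Set.Ioc 0 T, ∫⁻ η, forcing (majIter κ lam a n) τ η ^ 2 := by
      have hmF : Measurable fun η => ∫⁻ τ in Set.Ioc 0 T, forcing (majIter κ lam a n) τ η ^ 2 :=
        Measurable.lintegral_prod_right' (ν := volume.restrict (Set.Ioc 0 T))
          (f := fun p : E d × ℝ => forcing (majIter κ lam a n) p.2 p.1 ^ 2) (by fun_prop)
      rw [lintegral_lintegral_swap (by fun_prop),
        lintegral_lintegral_swap (f := fun τ η => forcing (majIter κ lam a n) τ η ^ 2)
          (by fun_prop),
        ← lintegral_const_mul' _ _ (ENNReal.pow_ne_top hLt),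
        ← lintegral_const_mul _ (by fun_prop), ← lintegral_const_mul _ (by fun_prop),
        ← lintegral_add_left (by fun_prop)]
      exact lintegral_mono h1
    -- `κ f₂ ≤ λ` turns the last term into a small multiple of the previous iterate
    set X := 4 * κ ^ 2 * L⁻¹ * ∫⁻ η, a η ^ 2 with hX
    have hκL : κ * ef₂ Y ≤ L := le_add_self.trans h.dissipation
    have h4 : 2 * κ ^ 2 * ((ef₂ Y / 16) ^ 2 * X) ≤ L ^ 2 * (X / 2) := by
      calc 2 * κ ^ 2 * ((ef₂ Y / 16) ^ 2 * X) = (κ * ef₂ Y) ^ 2 * (X * (2 * (16⁻¹ * 16⁻¹))) := by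
            rw [div_eq_mul_inv]; ring
        _ ≤ L ^ 2 * (X / 2) := by
            rw [div_eq_mul_inv]
            gcongr
            calc (2 : ℝ≥0∞) * (16⁻¹ * 16⁻¹) = (2 * 16⁻¹) * 16⁻¹ := by ring
              _ ≤ 1 * 2⁻¹ := by
                gcongr
                · rw [← div_eq_mul_inv]; exact ENNReal.div_le_of_le_mul (by norm_num)
                · norm_num
              _ = 2⁻¹ := one_mul _
    have h5 : 2 * κ ^ 2 * L * (∫⁻ η, a η ^ 2) = L ^ 2 * (X / 2) := by
      rw [hX, div_eq_mul_inv]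
      calc _ = 2 * κ ^ 2 * L * (∫⁻ η, a η ^ 2) * (L * L⁻¹) * (2 * 2⁻¹) := by
            rw [ENNReal.mul_inv_cancel hL0 hLt, ENNReal.mul_inv_cancel two_ne_zero (by simp)]; simp
        _ = _ := by ring
    refine (ENNReal.mul_le_mul_iff_right (pow_ne_zero 2 hL0) (ENNReal.pow_ne_top hLt)).1 ?_
    refine h3.trans ?_
    calc _ ≤ L ^ 2 * (X / 2) + L ^ 2 * (X / 2) := by
          rw [h5]
          refine add_le_add_right (le_trans ?_ h4) _
          gcongr
          exact h2.trans (by gcongr)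
      _ = L ^ 2 * X := by rw [← mul_add, ENNReal.add_halves]

lemma lintegral_sq_majorant_le (h : Subcritical κ lam a Y σ) :
    ∫⁻ t in Set.Ioi 0, ∫⁻ η, (efreq η ^ 2 * majorant κ lam a t η) ^ 2 ≤
      4 * κ ^ 2 * (ENNReal.ofReal lam)⁻¹ * ∫⁻ η, a η ^ 2 := by
  refine setLIntegral_Ioi_le fun T _ => ?_
  have hm := fun n => measurable_majIter (κ := κ) (lam := lam) h.measurable n
  have e : ∀ t η, (efreq η ^ 2 * majorant κ lam a t η) ^ 2 =
      ⨆ n, (efreq η ^ 2 * majIter κ lam a n t η) ^ 2 := by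
    intro t η
    have hmono : Monotone fun n => efreq η ^ 2 * majIter κ lam a n t η := fun i j hij =>
      mul_le_mul_right (majIter_monotone t η hij) _
    simp_rw [sq (_ * _)]
    rw [majorant, ENNReal.mul_iSup, iSup_mul_iSup_of_monotone hmono hmono]
  have hmono : ∀ t η, Monotone fun n => (efreq η ^ 2 * majIter κ lam a n t η) ^ 2 :=
    fun t η i j hij => pow_le_pow_left' (mul_le_mul_right (majIter_monotone t η hij) _) 2
  have e2 : ∀ t, ∫⁻ η, (efreq η ^ 2 * majorant κ lam a t η) ^ 2 =
      ⨆ n, ∫⁻ η, (efreq η ^ 2 * majIter κ lam a n t η) ^ 2 := by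
    intro t
    simp_rw [e]
    rw [lintegral_iSup]
    · intro n
      have : Measurable fun η => majIter κ lam a n t η := (hm n).comp measurable_prodMk_left
      fun_prop
    · exact fun i j hij η => hmono t η hij
  simp_rw [e2]
  rw [lintegral_iSup]
  · exact iSup_le fun n => h.lintegral_sq_majIter_le n T
  · intro n
    have := hm n
    exact Measurable.lintegral_prod_right'
      (f := fun p : ℝ × E d => (efreq p.2 ^ 2 * majIter κ lam a n p.1 p.2) ^ 2) (by fun_prop)
  · exact fun i j hij t => lintegral_mono fun η => hmono t η hij

end Subcritical

end Bounds

section Bounds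

variable {κ : ℝ≥0∞} {lam : ℝ} {a : E d → ℝ≥0∞} {Y σ : ℝ≥0∞}

/-- The square of the majorant is dominated uniformly in time, by Cauchy–Schwarz in Duhamel's
formula. -/
lemma sq_majorant_le_majSq (ha : Measurable a) (hl : 0 < lam) {t : ℝ} (ht : 0 ≤ t) (η : E d) :
    majorant κ lam a t η ^ 2 ≤ majSq κ lam a η := by
  rw [← majStep_majorant ha]
  have hF := measurable_forcing_majorant (κ := κ) (lam := lam) ha
  unfold majStep majSq
  generalize forcing (majorant κ lam a) = F at *
  have hFm : Measurable fun τ => F τ η := hF.comp (measurable_prodMk_right (y := η))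
  have hL0 : ENNReal.ofReal lam ≠ 0 := by simpa using hl
  have hLt : ENNReal.ofReal lam ≠ ∞ := ENNReal.ofReal_ne_top
  have h1 : (efreq η ^ 2 * ∫⁻ τ in Set.Ioc 0 t, heat lam (t - τ) η * F τ η) ^ 2 ≤
      (ENNReal.ofReal lam)⁻¹ * ∫⁻ τ in Set.Ioi 0, F τ η ^ 2 := by
    calc _ = (ENNReal.ofReal lam)⁻¹ * (ENNReal.ofReal lam * efreq η ^ 4 *
          (∫⁻ τ in Set.Ioc 0 t, heat lam (t - τ) η * F τ η) ^ 2) := by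
          rw [← mul_assoc, ← mul_assoc, ENNReal.inv_mul_cancel hL0 hLt]; ring
      _ ≤ (ENNReal.ofReal lam)⁻¹ * ∫⁻ τ in Set.Ioc 0 t, heat lam (t - τ) η * F τ η ^ 2 := by
          gcongr
          exact sq_setLIntegral_heat_mul_le hl.le hFm t η
      _ ≤ _ := by
          refine mul_le_mul' le_rfl ?_
          calc _ ≤ ∫⁻ τ in Set.Ioc 0 t, F τ η ^ 2 :=
                setLIntegral_mono' measurableSet_Ioc fun τ hτ =>
                  mul_le_of_le_one_left' (heat_le_one hl.le (sub_nonneg.2 hτ.2) η)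
            _ ≤ _ := lintegral_mono_set Set.Ioc_subset_Ioi_self
  have h2 : (heat lam t η * a η) ^ 2 ≤ a η ^ 2 := by
    gcongr; exact mul_le_of_le_one_left' (heat_le_one hl.le ht η)
  calc _ = κ ^ 2 * (heat lam t η * a η +
        efreq η ^ 2 * ∫⁻ τ in Set.Ioc 0 t, heat lam (t - τ) η * F τ η) ^ 2 := by
        ring
    _ ≤ κ ^ 2 * (2 * (heat lam t η * a η) ^ 2 +
        2 * (efreq η ^ 2 * ∫⁻ τ in Set.Ioc 0 t, heat lam (t - τ) η * F τ η) ^ 2) := by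
        gcongr; exact add_sq_le_two_mul _ _
    _ ≤ κ ^ 2 * (2 * a η ^ 2 +
        2 * ((ENNReal.ofReal lam)⁻¹ * ∫⁻ τ in Set.Ioi 0, F τ η ^ 2)) :=
        mul_le_mul' le_rfl (add_le_add (mul_le_mul' le_rfl h2) (mul_le_mul' le_rfl h1))
    _ = _ := by ring

namespace Subcritical

lemma lintegral_lconvExpDiv_le (h : Subcritical κ lam a Y σ) {t : ℝ} (ht : 0 ≤ t) :
    ∫⁻ η, lconvExpDiv (fun ζ => efreq ζ ^ 2 * majorant κ lam a t ζ) η ≤ ef₂ Y := by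
  have hVt : Measurable fun η => majorant κ lam a t η :=
    (measurable_majorant (κ := κ) (lam := lam) h.measurable).comp measurable_prodMk_left
  refine le_trans ?_ (sixteen_mul_lconvExpDiv_le
    (W := fun ζ => efreq ζ ^ 2 * majorant κ lam a t ζ) (by fun_prop) (h.moment_majorant_le ht))
  exact le_mul_of_one_le_left' (by norm_num)

lemma lintegral_sq_forcing_lt_top (h : Subcritical κ lam a Y σ) (hκ : κ ≠ ∞)
    (ha2 : ∫⁻ η, a η ^ 2 < ∞) :
    ∫⁻ τ in Set.Ioi 0, ∫⁻ η, forcing (majorant κ lam a) τ η ^ 2 < ∞ := by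
  have hV := measurable_majorant (κ := κ) (lam := lam) h.measurable
  have hL0 : ENNReal.ofReal lam ≠ 0 := by simpa using h.lam_pos
  have hf := ef₂_ne_top h.ne_top
  have hmm : Measurable fun t => ∫⁻ η, (efreq η ^ 2 * majorant κ lam a t η) ^ 2 :=
    Measurable.lintegral_prod_right'
      (f := fun p : ℝ × E d => (efreq p.2 ^ 2 * majorant κ lam a p.1 p.2) ^ 2) (by fun_prop)
  calc _ ≤ ∫⁻ t in Set.Ioi 0, ef₂ Y ^ 2 * ∫⁻ η, (efreq η ^ 2 * majorant κ lam a t η) ^ 2 := by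
        refine setLIntegral_mono' measurableSet_Ioi fun τ hτ => ?_
        have hVτ : Measurable fun η => majorant κ lam a τ η := hV.comp measurable_prodMk_left
        refine (lintegral_sq_lconvExp_le (W := fun ζ => efreq ζ ^ 2 * majorant κ lam a τ ζ)
          (by fun_prop)).trans ?_
        exact mul_le_mul' (pow_le_pow_left' (h.lintegral_lconvExpDiv_le (le_of_lt hτ)) 2) le_rfl
    _ = ef₂ Y ^ 2 * ∫⁻ t in Set.Ioi 0, ∫⁻ η, (efreq η ^ 2 * majorant κ lam a t η) ^ 2 :=
        lintegral_const_mul _ hmm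
    _ ≤ ef₂ Y ^ 2 * (4 * κ ^ 2 * (ENNReal.ofReal lam)⁻¹ * ∫⁻ η, a η ^ 2) :=
        mul_le_mul' le_rfl h.lintegral_sq_majorant_le
    _ < ∞ := by
        have := ENNReal.inv_ne_top.2 hL0
        have := ha2.ne
        finiteness

lemma lintegral_majSq_lt_top (h : Subcritical κ lam a Y σ) (hκ : κ ≠ ∞)
    (ha2 : ∫⁻ η, a η ^ 2 < ∞) : ∫⁻ η, majSq κ lam a η < ∞ := by
  have hL0 : ENNReal.ofReal lam ≠ 0 := by simpa using h.lam_pos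
  have ha := h.measurable
  have hF := measurable_forcing_majorant (κ := κ) (lam := lam) ha
  have hlt := h.lintegral_sq_forcing_lt_top hκ ha2
  unfold majSq
  generalize forcing (majorant κ lam a) = F at *
  have hm := measurable_setLIntegral_Ioi (F := fun τ η => F τ η ^ 2) (by fun_prop)
  rw [lintegral_const_mul _ (by fun_prop), lintegral_add_left (by fun_prop),
    lintegral_const_mul _ (by fun_prop),
    lintegral_lintegral_swap (f := fun η τ => F τ η ^ 2)
      (by exact ((hF.comp measurable_swap).pow_const 2).aemeasurable)]
  have := ENNReal.inv_ne_top.2 hL0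
  have := ha2.ne
  have := hlt.ne
  finiteness

/-- The total forcing is bounded pointwise. -/
lemma setLIntegral_forcing_le (h : Subcritical κ lam a Y σ) (η : E d) :
    ∫⁻ τ in Set.Ioi 0, forcing (majorant κ lam a) τ η ≤
      (3 + 2 * ef₂ Y ^ 2) * (4 * κ ^ 2 * (ENNReal.ofReal lam)⁻¹ * ∫⁻ η, a η ^ 2) := by
  have hV := measurable_majorant (κ := κ) (lam := lam) h.measurable
  have hmm : Measurable fun t => ∫⁻ η, (efreq η ^ 2 * majorant κ lam a t η) ^ 2 :=
    Measurable.lintegral_prod_right'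
      (f := fun p : ℝ × E d => (efreq p.2 ^ 2 * majorant κ lam a p.1 p.2) ^ 2) (by fun_prop)
  calc _ ≤ ∫⁻ t in Set.Ioi 0,
        (3 + 2 * ef₂ Y ^ 2) * ∫⁻ η, (efreq η ^ 2 * majorant κ lam a t η) ^ 2 := by
        refine setLIntegral_mono' measurableSet_Ioi fun τ hτ => ?_
        have hVτ : Measurable fun η => majorant κ lam a τ η := hV.comp measurable_prodMk_left
        refine (lconvExp_le_lintegral_sq (W := fun ζ => efreq ζ ^ 2 * majorant κ lam a τ ζ)
          (by fun_prop) η).trans ?_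
        exact mul_le_mul' (add_le_add_right (mul_le_mul' le_rfl
          (pow_le_pow_left' (h.lintegral_lconvExpDiv_le (le_of_lt hτ)) 2)) _) le_rfl
    _ = (3 + 2 * ef₂ Y ^ 2) *
        ∫⁻ t in Set.Ioi 0, ∫⁻ η, (efreq η ^ 2 * majorant κ lam a t η) ^ 2 :=
        lintegral_const_mul _ hmm
    _ ≤ _ := mul_le_mul' le_rfl h.lintegral_sq_majorant_le

end Subcritical

/-! ### Low frequencies -/

lemma measurableSet_freq_lt (R : ℝ) : MeasurableSet {η : E d | freq η < R} :=
  measurableSet_lt measurable_freq measurable_const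

lemma volume_freq_lt_le : ∃ c : ℝ≥0∞, c ≠ ∞ ∧ ∀ R : ℝ, 0 < R →
    volume {η : E d | freq η < R} ≤ c * ENNReal.ofReal (R ^ d) := by
  refine ⟨ENNReal.ofReal (((2 * Real.pi)⁻¹) ^ d) * volume (Metric.ball (0 : E d) 1), ?_, ?_⟩
  · exact ENNReal.mul_ne_top ENNReal.ofReal_ne_top measure_ball_lt_top.ne
  · intro R hR
    have hpi : 0 < 2 * Real.pi := by positivity
    have e : {η : E d | freq η < R} = Metric.ball 0 ((2 * Real.pi)⁻¹ * R) := by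
      ext η
      simp only [freq, Set.mem_ofPred_eq, mem_ball_zero_iff]
      rw [inv_mul_eq_div, lt_div_iff₀' hpi]
    rw [e, Measure.addHaar_ball_of_pos _ _ (by positivity), finrank_euclideanSpace, Fintype.card_fin,
      mul_pow, ENNReal.ofReal_mul (by positivity)]
    apply le_of_eq; ring

/-- The low-frequency condition encoded by the Besov norm `‖·‖_{-d,∞}`: the mass of `a` in
`{|ξ| < R}` is at most a multiple of `R^d`. -/
def LowFrequency (a : E d → ℝ≥0∞) : Prop :=
  ∃ K : ℝ≥0∞, K ≠ ∞ ∧ ∀ R : ℝ, 0 < R →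
    ∫⁻ η in {η : E d | freq η < R}, a η ≤ K * ENNReal.ofReal (R ^ d)

/-- The low-frequency condition propagates to the supremum in time of the majorant: for `R ≤ 1` by
the pointwise bound of the forcing, for `R ≥ 1` by the second moment. -/
lemma Subcritical.lowFrequency_majSup (h : Subcritical κ lam a Y σ) (hκ : κ ≠ ∞)
    (ha2 : ∫⁻ η, a η ^ 2 < ∞) (hlow : LowFrequency a) : LowFrequency (majSup κ lam a) := by
  obtain ⟨K, hK, hKa⟩ := hlow
  obtain ⟨c, hc, hvol⟩ := volume_freq_lt_le (d := d)
  have hL0 : ENNReal.ofReal lam ≠ 0 := by simpa using h.lam_pos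
  have ha := h.measurable
  set C := (3 + 2 * ef₂ Y ^ 2) * (4 * κ ^ 2 * (ENNReal.ofReal lam)⁻¹ * ∫⁻ η, a η ^ 2) with hC
  have hCt : C ≠ ∞ := by
    have := ENNReal.inv_ne_top.2 hL0
    have := ha2.ne
    have := ef₂_ne_top h.ne_top
    finiteness
  set D := ∫⁻ η, efreq η ^ 2 * majSup κ lam a η with hD
  have hDt : D ≠ ∞ := h.moment_majSup_lt_top.ne
  have hsmall : ∀ R : ℝ, 0 < R → R ≤ 1 →
      ∫⁻ η in {η : E d | freq η < R}, majSup κ lam a η ≤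
        (κ * (K + C * c)) * ENNReal.ofReal (R ^ d) := by
    intro R hR hR1
    calc _ ≤ ∫⁻ η in {η : E d | freq η < R}, κ * (a η + C) := by
          refine setLIntegral_mono' (measurableSet_freq_lt R) fun η hη => ?_
          unfold majSup
          refine mul_le_mul' le_rfl (add_le_add le_rfl ?_)
          refine (mul_le_of_le_one_left' ?_).trans (h.setLIntegral_forcing_le η)
          refine pow_le_one₀ zero_le ?_
          rw [efreq, ← ENNReal.ofReal_one]
          exact ENNReal.ofReal_le_ofReal (le_trans (le_of_lt hη) hR1)
      _ = κ * ((∫⁻ η in {η : E d | freq η < R}, a η) + C * volume {η : E d | freq η < R}) := by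
          rw [lintegral_const_mul _ (by fun_prop), lintegral_add_left ha, lintegral_const,
            Measure.restrict_apply_univ]
      _ ≤ κ * (K * ENNReal.ofReal (R ^ d) + C * (c * ENNReal.ofReal (R ^ d))) := by
          gcongr
          · exact hKa R hR
          · exact hvol R hR
      _ = _ := by ring
  refine ⟨κ * (K + C * c) + D, by finiteness, fun R hR => ?_⟩
  rcases le_total R 1 with hR1 | hR1
  · refine (hsmall R hR hR1).trans ?_
    gcongr; exact le_self_add
  · have hsub : {η : E d | freq η < R} ⊆ {η : E d | freq η < 1} ∪ {η : E d | 1 ≤ freq η} :=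
      fun η _ => lt_or_ge (freq η) 1
    calc _ ≤ ∫⁻ η in {η : E d | freq η < 1} ∪ {η : E d | 1 ≤ freq η}, majSup κ lam a η :=
          lintegral_mono_set hsub
      _ ≤ (∫⁻ η in {η : E d | freq η < 1}, majSup κ lam a η) +
          ∫⁻ η in {η : E d | 1 ≤ freq η}, majSup κ lam a η := lintegral_union_le _ _ _
      _ ≤ κ * (K + C * c) * 1 + D := by
          refine add_le_add ?_ ?_
          · simpa using hsmall 1 one_pos le_rfl
          · refine le_trans ?_ (setLIntegral_le_lintegral {η : E d | 1 ≤ freq η} _)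
            refine setLIntegral_mono' (measurableSet_le measurable_const measurable_freq)
              fun η hη => ?_
            refine le_mul_of_one_le_left' (one_le_pow₀ ?_)
            rw [efreq, ← ENNReal.ofReal_one]
            exact ENNReal.ofReal_le_ofReal hη
      _ = (κ * (K + C * c) + D) * 1 := by ring
      _ ≤ _ := by
          gcongr
          rw [← ENNReal.ofReal_one]
          exact ENNReal.ofReal_le_ofReal (one_le_pow₀ hR1)

/-! ### Decay of the second moment by Fourier splitting -/

/-- An inequality `A' ≤ -σ S (A - K S^q)`, in the integrated form between `t / 2` and `t`, for every
`S > 0`, forces decay at the rate `t^{-q}`: take `S` proportional to `1 / t` and iterate. -/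
lemma splitting_iterate {A : ℝ → ℝ} {σ K q Y : ℝ} (hσ : 0 < σ) (hq : 0 < q) (hK : 0 ≤ K)
    (hY : 0 ≤ Y) (hA : ∀ t, 0 ≤ t → A t ≤ Y)
    (h : ∀ t, 0 < t → ∀ S, 0 < S →
      A t + σ * (t / 2) * S * A t ≤ A (t / 2) + σ * (t / 2) * S * (K * S ^ q)) :
    ∃ C : ℝ, 0 < C ∧ ∀ t, 0 < t → A t ≤ C * t ^ (-q) := by
  -- `S = P / t`, with `P` chosen so that `σ (t / 2) S = 2 · 2^q`: half of the previous value of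
  -- `A t * t ^ q` then suffices
  set b : ℝ := 2 * 2 ^ q with hb
  have hb0 : 0 < b := by positivity
  set P : ℝ := 2 * b / σ with hP
  have hP0 : 0 < P := by positivity
  set C : ℝ := K * P ^ q with hC
  have hC0 : 0 ≤ C := by positivity
  have key : ∀ t, 0 < t → A t * t ^ q ≤ 1 / 2 * (max (A (t / 2)) 0 * (t / 2) ^ q) + C := by
    intro t ht
    have h1 := h t ht (P / t) (by positivity)
    have e1 : σ * (t / 2) * (P / t) = b := by rw [hP]; field_simp
    have e2 : (P / t) ^ q = P ^ q * (t ^ q)⁻¹ := by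
      rw [Real.div_rpow hP0.le ht.le, div_eq_mul_inv]
    rw [e1, e2] at h1
    have htq : 0 < t ^ q := Real.rpow_pos_of_pos ht q
    have e3 : t ^ q = 2 ^ q * (t / 2) ^ q := by
      rw [← Real.mul_rpow (by norm_num) (by positivity)]; congr 1; ring
    have h2 : (A t * t ^ q) * (1 + b) ≤ A (t / 2) * t ^ q + b * C := by
      have := mul_le_mul_of_nonneg_right h1 htq.le
      have e4 : (A (t / 2) + b * (K * (P ^ q * (t ^ q)⁻¹))) * t ^ q =
          A (t / 2) * t ^ q + b * C := by rw [hC]; field_simp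
      rw [e4] at this
      linarith
    have h3 : A (t / 2) * t ^ q ≤ b * (1 / 2 * (max (A (t / 2)) 0 * (t / 2) ^ q)) := by
      rw [e3, hb]
      have : A (t / 2) ≤ max (A (t / 2)) 0 := le_max_left _ _
      have hp : 0 ≤ (2 : ℝ) ^ q * (t / 2) ^ q := by positivity
      nlinarith
    have hnn : 0 ≤ 1 / 2 * (max (A (t / 2)) 0 * (t / 2) ^ q) + C := by positivity
    by_contra hcon
    push Not at hcon
    nlinarith
  have hind : ∀ n : ℕ, ∀ t, 0 < t → t ≤ 2 ^ n → A t * t ^ q ≤ Y + 2 * C := by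
    intro n
    induction n with
    | zero =>
      intro t ht ht1
      have : t ^ q ≤ 1 := Real.rpow_le_one ht.le (by simpa using ht1) hq.le
      have h0 : 0 < t ^ q := Real.rpow_pos_of_pos ht q
      nlinarith [hA t ht.le]
    | succ n ih =>
      intro t ht htn
      have h1 := ih (t / 2) (by positivity) (by rw [pow_succ] at htn; linarith)
      have h2 := key t ht
      have h3 : max (A (t / 2)) 0 * (t / 2) ^ q ≤ Y + 2 * C := by
        rcases le_total (A (t / 2)) 0 with h | h
        · rw [max_eq_right h]; simp; positivity
        · rw [max_eq_left h]; exact h1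
      linarith
  refine ⟨Y + 2 * C + 1, by positivity, fun t ht => ?_⟩
  obtain ⟨n, hn⟩ := pow_unbounded_of_one_lt t (one_lt_two)
  have h1 := hind n t ht hn.le
  have htq : 0 < t ^ q := Real.rpow_pos_of_pos ht q
  rw [Real.rpow_neg ht.le, ← div_eq_mul_inv, le_div_iff₀ htq]
  linarith

/-- Fourier splitting: where `|ξ| ≥ R` the dissipation controls `R⁴` times the second moment, and the
rest of the second moment is `O(R^{2+d})`. -/
lemma Subcritical.moment_decay (h : Subcritical κ lam a Y σ)
    (hlow : LowFrequency (majSup κ lam a)) :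
    ∃ C : ℝ, 0 < C ∧ ∀ t, 0 < t →
      ∫⁻ η, efreq η ^ 2 * majorant κ lam a t η ≤
        ENNReal.ofReal (C * t ^ (-((2 + (d : ℝ)) / 4))) := by
  obtain ⟨K, hK, hKa⟩ := hlow
  have ha := h.measurable
  have hV := measurable_majorant (κ := κ) (lam := lam) ha
  set A : ℝ → ℝ≥0∞ := fun t => ∫⁻ η, efreq η ^ 2 * majorant κ lam a t η with hA
  have hAt : ∀ t, 0 ≤ t → A t ≠ ∞ := fun t ht =>
    ne_top_of_le_ne_top h.ne_top (h.moment_majorant_le ht)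
  have hmono : ∀ s t, 0 ≤ s → s ≤ t → A t ≤ A s := fun s t hs hst =>
    le_self_add.trans (h.energy_restart hs hst)
  -- frequency splitting at `|ξ| = R`
  have hsplit : ∀ R : ℝ, 0 < R → ∀ τ, 0 ≤ τ → ENNReal.ofReal (R ^ 4) * A τ ≤
      (∫⁻ η, efreq η ^ 6 * majorant κ lam a τ η) + K * ENNReal.ofReal (R ^ 4 * R ^ (2 + d)) := by
    intro R hR τ hτ
    have hVτ : Measurable fun η => majorant κ lam a τ η := hV.comp measurable_prodMk_left
    have hs := measurableSet_freq_lt (d := d) R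
    have h1 : A τ = (∫⁻ η in {η : E d | freq η < R}, efreq η ^ 2 * majorant κ lam a τ η) +
        ∫⁻ η in {η : E d | freq η < R}ᶜ, efreq η ^ 2 * majorant κ lam a τ η :=
      (lintegral_add_compl _ hs).symm
    have h2 : ∫⁻ η in {η : E d | freq η < R}, efreq η ^ 2 * majorant κ lam a τ η ≤
        K * ENNReal.ofReal (R ^ (2 + d)) := by
      calc _ ≤ ∫⁻ η in {η : E d | freq η < R}, ENNReal.ofReal (R ^ 2) * majSup κ lam a η := by
            refine setLIntegral_mono' hs fun η hη => ?_
            refine mul_le_mul' ?_ (majorant_le_majSup ha h.lam_pos.le hτ η)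
            rw [efreq, ← ENNReal.ofReal_pow (freq_nonneg η)]
            exact ENNReal.ofReal_le_ofReal (pow_le_pow_left₀ (freq_nonneg η) (le_of_lt hη) 2)
        _ = ENNReal.ofReal (R ^ 2) * ∫⁻ η in {η : E d | freq η < R}, majSup κ lam a η :=
            lintegral_const_mul' _ _ ENNReal.ofReal_ne_top
        _ ≤ ENNReal.ofReal (R ^ 2) * (K * ENNReal.ofReal (R ^ d)) := by
            gcongr; exact hKa R hR
        _ = _ := by
            rw [pow_add, ENNReal.ofReal_mul (p := R ^ 2) (by positivity)]; ring
    have h3 : ENNReal.ofReal (R ^ 4) *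
        ∫⁻ η in {η : E d | freq η < R}ᶜ, efreq η ^ 2 * majorant κ lam a τ η ≤
        ∫⁻ η, efreq η ^ 6 * majorant κ lam a τ η := by
      rw [← lintegral_const_mul' _ _ ENNReal.ofReal_ne_top]
      refine le_trans (setLIntegral_mono' hs.compl fun η hη => ?_)
        (setLIntegral_le_lintegral {η : E d | freq η < R}ᶜ _)
      rw [← mul_assoc]
      refine mul_le_mul' ?_ le_rfl
      have hη' : R ≤ freq η := not_lt.1 hη
      calc ENNReal.ofReal (R ^ 4) * efreq η ^ 2 ≤ efreq η ^ 4 * efreq η ^ 2 := by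
            gcongr
            rw [efreq, ← ENNReal.ofReal_pow (freq_nonneg η)]
            exact ENNReal.ofReal_le_ofReal (pow_le_pow_left₀ hR.le hη' 4)
        _ = _ := by ring
    rw [h1, mul_add, add_comm]
    refine add_le_add h3 ?_
    calc _ ≤ ENNReal.ofReal (R ^ 4) * (K * ENNReal.ofReal (R ^ (2 + d))) := by gcongr
      _ = _ := by rw [ENNReal.ofReal_mul (p := R ^ 4) (by positivity)]; ring
  have hstep : ∀ t, 0 < t → ∀ R : ℝ, 0 < R →
      A t + σ * ENNReal.ofReal (t / 2) * ENNReal.ofReal (R ^ 4) * A t ≤ A (t / 2) +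
        σ * ENNReal.ofReal (t / 2) * (K * ENNReal.ofReal (R ^ 4 * R ^ (2 + d))) := by
    intro t ht R hR
    have h1 := h.energy_restart (s := t / 2) (t := t) (by positivity) (by linarith)
    have h2 : ENNReal.ofReal (t / 2) * (ENNReal.ofReal (R ^ 4) * A t) ≤
        (∫⁻ τ in Set.Ioc (t / 2) t, ∫⁻ η, efreq η ^ 6 * majorant κ lam a τ η) +
          ENNReal.ofReal (t / 2) * (K * ENNReal.ofReal (R ^ 4 * R ^ (2 + d))) := by
      have hv : volume (Set.Ioc (t / 2) t) = ENNReal.ofReal (t / 2) := by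
        rw [Real.volume_Ioc]; congr 1; ring
      calc _ = ∫⁻ τ in Set.Ioc (t / 2) t, ENNReal.ofReal (R ^ 4) * A t := by
            rw [setLIntegral_const, hv, mul_comm]
        _ ≤ ∫⁻ τ in Set.Ioc (t / 2) t, ((∫⁻ η, efreq η ^ 6 * majorant κ lam a τ η) +
            K * ENNReal.ofReal (R ^ 4 * R ^ (2 + d))) := by
            refine setLIntegral_mono' measurableSet_Ioc fun τ hτ => ?_
            have hτ0 : 0 ≤ τ := by linarith [hτ.1]
            exact (mul_le_mul' le_rfl (hmono τ t hτ0 hτ.2)).trans (hsplit R hR τ hτ0)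
        _ = _ := by
            rw [lintegral_add_right _ measurable_const, setLIntegral_const, hv]; ring
    calc _ = A t + σ * (ENNReal.ofReal (t / 2) * (ENNReal.ofReal (R ^ 4) * A t)) := by ring
      _ ≤ A t + σ * ((∫⁻ τ in Set.Ioc (t / 2) t, ∫⁻ η, efreq η ^ 6 * majorant κ lam a τ η) +
          ENNReal.ofReal (t / 2) * (K * ENNReal.ofReal (R ^ 4 * R ^ (2 + d)))) := by gcongr
      _ = (A t + σ * ∫⁻ τ in Set.Ioc (t / 2) t, ∫⁻ η, efreq η ^ 6 * majorant κ lam a τ η) +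
          σ * ENNReal.ofReal (t / 2) * (K * ENNReal.ofReal (R ^ 4 * R ^ (2 + d))) := by ring
      _ ≤ _ := by gcongr
  have hσt := h.sigma_ne_top
  obtain ⟨C, hC, hdec⟩ := splitting_iterate (A := fun t => (A t).toReal) (σ := σ.toReal)
    (K := K.toReal) (q := (2 + (d : ℝ)) / 4) (Y := Y.toReal)
    (ENNReal.toReal_pos h.sigma_ne_zero hσt) (by positivity) ENNReal.toReal_nonneg
    ENNReal.toReal_nonneg (fun t ht => ENNReal.toReal_mono h.ne_top (h.moment_majorant_le ht))
    (by
      intro t ht S hS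
      set R := S ^ (1 / 4 : ℝ) with hR
      have hR0 : 0 < R := Real.rpow_pos_of_pos hS _
      have hR4 : R ^ 4 = S := by
        rw [hR, ← Real.rpow_natCast, ← Real.rpow_mul hS.le]; norm_num
      have hRd : R ^ (2 + d) = S ^ ((2 + (d : ℝ)) / 4) := by
        rw [hR, ← Real.rpow_natCast, ← Real.rpow_mul hS.le]; congr 1; push_cast; ring
      have h1 := hstep t ht R hR0
      have hA1 := hAt t ht.le
      have hA2 := hAt (t / 2) (by positivity)
      have h2 := ENNReal.toReal_mono (by finiteness) h1
      rw [ENNReal.toReal_add hA1 (by finiteness), ENNReal.toReal_add hA2 (by finiteness)] at h2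
      simp only [ENNReal.toReal_mul] at h2
      rw [ENNReal.toReal_ofReal (by positivity), ENNReal.toReal_ofReal (by positivity),
        ENNReal.toReal_ofReal (by positivity), hR4, hRd] at h2
      calc _ ≤ _ := h2
        _ = _ := by ring)
  refine ⟨C, hC, fun t ht => ?_⟩
  change A t ≤ _
  rw [← ENNReal.ofReal_toReal (hAt t ht.le)]
  exact ENNReal.ofReal_le_ofReal (hdec t ht)

end Bounds

/-! ### Convolution exponentials of complex functions -/

/-- `convPow u n` is the `(n+1)`-fold convolution of the complex function `u` with itself; junk
values of the Bochner integral occur only where the convolution of `|u|` is infinite. -/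
def convPow (u : E d → ℂ) : ℕ → E d → ℂ
  | 0 => u
  | n + 1 => fun x => ∫ y, u y * convPow u n (x - y)

/-- The convolution analogue `∑_{j ≥ 2} u^{*j} / j!` of `e^w - 1 - w` for complex functions. -/
def convExp (u : E d → ℂ) (x : E d) : ℂ :=
  ∑' n : ℕ, convPow u (n + 1) x / ((n + 2).factorial : ℂ)

section Measurability

variable {α : Type*} [MeasurableSpace α]

lemma measurable_convPow_param {u : α → E d → ℂ}
    (hu : Measurable fun p : α × E d => u p.1 p.2) (n : ℕ) :
    Measurable fun p : α × E d => convPow (u p.1) n p.2 := by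
  induction n with
  | zero => exact hu
  | succ n ih =>
    have h : StronglyMeasurable fun q : (α × E d) × E d =>
        u q.1.1 q.2 * convPow (u q.1.1) n (q.1.2 - q.2) :=
      ((hu.comp (by fun_prop : Measurable fun q : (α × E d) × E d => (q.1.1, q.2))).mul
        (ih.comp (by fun_prop : Measurable fun q : (α × E d) × E d =>
          (q.1.1, q.1.2 - q.2)))).stronglyMeasurable
    exact h.integral_prod_right'.measurable

lemma measurable_convExp_param {u : α → E d → ℂ}
    (hu : Measurable fun p : α × E d => u p.1 p.2) :
    Measurable fun p : α × E d => convExp (u p.1) p.2 :=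
  Measurable.tsum fun n => (measurable_convPow_param hu (n + 1)).div_const _

end Measurability

lemma measurable_convPow {u : E d → ℂ} (hu : Measurable u) (n : ℕ) : Measurable (convPow u n) :=
  (measurable_convPow_param (α := Unit) (u := fun _ => u) (by fun_prop) n).comp
    (by fun_prop : Measurable fun x : E d => ((), x))

lemma measurable_convExp {u : E d → ℂ} (hu : Measurable u) : Measurable (convExp u) :=
  Measurable.tsum fun n => (measurable_convPow hu (n + 1)).div_const _

lemma enorm_convPow_le {u : E d → ℂ} {W : E d → ℝ≥0∞} (h : ∀ x, ‖u x‖ₑ ≤ W x) (n : ℕ) (x : E d) :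
    ‖convPow u n x‖ₑ ≤ lconvPow W n x := by
  induction n generalizing x with
  | zero => exact h x
  | succ n ih =>
    refine (enorm_integral_le_lintegral_enorm _).trans (lintegral_mono fun y => ?_)
    rw [enorm_mul]
    exact mul_le_mul' (h y) (ih _)

lemma enorm_div_factorial (z : ℂ) (k : ℕ) :
    ‖z / (k.factorial : ℂ)‖ₑ = ‖z‖ₑ / (k.factorial : ℝ≥0∞) := by
  rw [div_eq_mul_inv, enorm_mul, enorm_inv (by exact_mod_cast k.factorial_ne_zero),
    div_eq_mul_inv]
  congr 2
  rw [← ofReal_norm, Complex.norm_natCast, ENNReal.ofReal_natCast]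

lemma enorm_convExp_le {u : E d → ℂ} {W : E d → ℝ≥0∞} (h : ∀ x, ‖u x‖ₑ ≤ W x) (x : E d) :
    ‖convExp u x‖ₑ ≤ lconvExp W x := by
  refine enorm_tsum_le_tsum_enorm.trans (ENNReal.tsum_le_tsum fun n => ?_)
  rw [enorm_div_factorial]
  exact ENNReal.div_le_div_right (enorm_convPow_le h (n + 1) x) _

lemma summable_convExp {u : E d → ℂ} {W : E d → ℝ≥0∞} (h : ∀ x, ‖u x‖ₑ ≤ W x) {x : E d}
    (hx : lconvExp W x ≠ ∞) :
    Summable fun n : ℕ => convPow u (n + 1) x / ((n + 2).factorial : ℂ) := by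
  refine Summable.of_enorm (ne_top_of_le_ne_top hx (ENNReal.tsum_le_tsum fun n => ?_))
  rw [enorm_div_factorial]
  exact ENNReal.div_le_div_right (enorm_convPow_le h (n + 1) x) _

lemma integrable_conv {u c : E d → ℂ} (hu : Measurable u) (hc : Measurable c)
    {W L : E d → ℝ≥0∞} (h : ∀ x, ‖u x‖ₑ ≤ W x) (h' : ∀ x, ‖c x‖ₑ ≤ L x) {x : E d}
    (hx : ∫⁻ y, W y * L (x - y) ≠ ∞) : Integrable fun y => u y * c (x - y) := by
  refine ⟨(by fun_prop : Measurable fun y => u y * c (x - y)).aestronglyMeasurable, ?_⟩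
  refine lt_of_le_of_lt (lintegral_mono fun y => ?_) hx.lt_top
  rw [enorm_mul]
  exact mul_le_mul' (h y) (h' _)

/-- Differences of convolution powers are controlled by differences of the majorants, at every
point: where the majorant is infinite there is nothing to prove. -/
lemma enorm_convPow_sub_le {u u' : E d → ℂ} {W W' : E d → ℝ≥0∞} (hu : Measurable u)
    (hu' : Measurable u') (hW' : Measurable W') (h' : ∀ x, ‖u' x‖ₑ ≤ W' x)
    (h : ∀ x, ‖u x - u' x‖ₑ + W' x ≤ W x) (n : ℕ) (x : E d) :
    ‖convPow u n x - convPow u' n x‖ₑ + lconvPow W' n x ≤ lconvPow W n x := by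
  have hWW : ∀ x, W' x ≤ W x := fun x => le_add_self.trans (h x)
  have huW : ∀ x, ‖u x‖ₑ ≤ W x := fun x => by
    calc ‖u x‖ₑ = ‖(u x - u' x) + u' x‖ₑ := by rw [sub_add_cancel]
      _ ≤ ‖u x - u' x‖ₑ + ‖u' x‖ₑ := enorm_add_le _ _
      _ ≤ _ := (add_le_add_right (h' x) _).trans (h x)
  induction n generalizing x with
  | zero => exact h x
  | succ n ih =>
    rcases eq_or_ne (lconvPow W (n + 1) x) ∞ with hx | hx
    · rw [hx]; exact le_top
    have hx' : lconvPow W' (n + 1) x ≠ ∞ := ne_top_of_le_ne_top hx (lconvPow_mono hWW _ _)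
    have i1 := integrable_conv hu (measurable_convPow hu n) huW (enorm_convPow_le huW n) hx
    have i2 := integrable_conv hu' (measurable_convPow hu' n) h' (enorm_convPow_le h' n) hx'
    have hm := measurable_lconvPow hW' n
    calc ‖convPow u (n + 1) x - convPow u' (n + 1) x‖ₑ + lconvPow W' (n + 1) x
        = ‖∫ y, (u y * convPow u n (x - y) - u' y * convPow u' n (x - y))‖ₑ +
          ∫⁻ y, W' y * lconvPow W' n (x - y) := by rw [integral_sub i1 i2]; rfl
      _ ≤ (∫⁻ y, ‖u y * convPow u n (x - y) - u' y * convPow u' n (x - y)‖ₑ) +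
          ∫⁻ y, W' y * lconvPow W' n (x - y) := by
          gcongr; exact enorm_integral_le_lintegral_enorm _
      _ = ∫⁻ y, (‖u y * convPow u n (x - y) - u' y * convPow u' n (x - y)‖ₑ +
          W' y * lconvPow W' n (x - y)) := (lintegral_add_right _ (by fun_prop)).symm
      _ ≤ _ := lintegral_mono fun y => ?_
    set c := convPow u n (x - y)
    set c' := convPow u' n (x - y)
    set L := lconvPow W n (x - y)
    set L' := lconvPow W' n (x - y)
    have hc : ‖c‖ₑ ≤ L := enorm_convPow_le huW n _
    calc ‖u y * c - u' y * c'‖ₑ + W' y * L'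
        = ‖(u y - u' y) * c + u' y * (c - c')‖ₑ + W' y * L' := by congr 2; ring
      _ ≤ (‖(u y - u' y) * c‖ₑ + ‖u' y * (c - c')‖ₑ) + W' y * L' := by
          gcongr; exact enorm_add_le _ _
      _ = ‖u y - u' y‖ₑ * ‖c‖ₑ + ‖u' y‖ₑ * ‖c - c'‖ₑ + W' y * L' := by
          rw [enorm_mul, enorm_mul]
      _ ≤ ‖u y - u' y‖ₑ * L + W' y * ‖c - c'‖ₑ + W' y * L' := by gcongr; exact h' y
      _ = ‖u y - u' y‖ₑ * L + W' y * (‖c - c'‖ₑ + L') := by ring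
      _ ≤ ‖u y - u' y‖ₑ * L + W' y * L := by gcongr; exact ih _
      _ = (‖u y - u' y‖ₑ + W' y) * L := by ring
      _ ≤ W y * L := by gcongr; exact h y

lemma enorm_convExp_sub_le {u u' : E d → ℂ} {W W' : E d → ℝ≥0∞} (hu : Measurable u)
    (hu' : Measurable u') (hW' : Measurable W') (h' : ∀ x, ‖u' x‖ₑ ≤ W' x)
    (h : ∀ x, ‖u x - u' x‖ₑ + W' x ≤ W x) (x : E d) :
    ‖convExp u x - convExp u' x‖ₑ + lconvExp W' x ≤ lconvExp W x := by
  have hWW : ∀ x, W' x ≤ W x := fun x => le_add_self.trans (h x)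
  have huW : ∀ x, ‖u x‖ₑ ≤ W x := fun x => by
    calc ‖u x‖ₑ = ‖(u x - u' x) + u' x‖ₑ := by rw [sub_add_cancel]
      _ ≤ ‖u x - u' x‖ₑ + ‖u' x‖ₑ := enorm_add_le _ _
      _ ≤ _ := (add_le_add_right (h' x) _).trans (h x)
  rcases eq_or_ne (lconvExp W x) ∞ with hx | hx
  · rw [hx]; exact le_top
  have s1 := summable_convExp huW hx
  have s2 := summable_convExp h' (ne_top_of_le_ne_top hx (lconvExp_mono hWW x))
  unfold convExp
  rw [← s1.tsum_sub s2]
  unfold lconvExp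
  refine (add_le_add_left enorm_tsum_le_tsum_enorm _).trans ?_
  rw [← ENNReal.tsum_add]
  refine ENNReal.tsum_le_tsum fun n => ?_
  rw [← sub_div, enorm_div_factorial, ← ENNReal.add_div]
  exact ENNReal.div_le_div_right (enorm_convPow_sub_le hu hu' hW' h' h (n + 1) x) _

/-! ### The nonlinearity is a contraction of `L¹` -/

lemma lintegral_enorm_convPow_sub_le {u u' : E d → ℂ} (hu : Measurable u) (hu' : Measurable u')
    {M : ℝ≥0∞} (hM : M ≠ ∞) (h : ∫⁻ x, ‖u x‖ₑ ≤ M) (h' : ∫⁻ x, ‖u' x‖ₑ ≤ M) (n : ℕ) :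
    ∫⁻ x, ‖convPow u n x - convPow u' n x‖ₑ ≤
      ((n : ℝ≥0∞) + 1) * M ^ n * ∫⁻ x, ‖u x - u' x‖ₑ := by
  induction n with
  | zero => simp [convPow]
  | succ n ih =>
    have hfin : ∀ v : E d → ℂ, Measurable v → ∫⁻ x, ‖v x‖ₑ ≤ M →
        ∀ᵐ x, lconvPow (fun x => ‖v x‖ₑ) (n + 1) x < ∞ := fun v hv hvM =>
      ae_lt_top (measurable_lconvPow hv.enorm _) (by
        rw [lintegral_lconvPow hv.enorm]
        exact ENNReal.pow_ne_top (ne_top_of_le_ne_top hM hvM))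
    have hc := measurable_convPow hu n
    have hc' := measurable_convPow hu' n
    have hcM : ∫⁻ x, ‖convPow u n x‖ₑ ≤ M ^ (n + 1) :=
      calc _ ≤ ∫⁻ x, lconvPow (fun x => ‖u x‖ₑ) n x :=
            lintegral_mono fun x => enorm_convPow_le (fun _ => le_rfl) n x
        _ = (∫⁻ x, ‖u x‖ₑ) ^ (n + 1) := lintegral_lconvPow hu.enorm n
        _ ≤ _ := pow_le_pow_left' h _
    have hm1 := measurable_lconv (hu.sub hu').enorm hc.enorm
    simp only [Pi.sub_apply] at hm1
    calc _ ≤ ∫⁻ x, ((∫⁻ y, ‖u y - u' y‖ₑ * ‖convPow u n (x - y)‖ₑ) +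
          ∫⁻ y, ‖u' y‖ₑ * ‖convPow u n (x - y) - convPow u' n (x - y)‖ₑ) := by
          refine lintegral_mono_ae ?_
          filter_upwards [hfin u hu h, hfin u' hu' h'] with x hx hx'
          have i1 := integrable_conv hu hc (fun _ => le_rfl)
            (enorm_convPow_le (fun _ => le_rfl) n) hx.ne
          have i2 := integrable_conv hu' hc' (fun _ => le_rfl)
            (enorm_convPow_le (fun _ => le_rfl) n) hx'.ne
          simp only [convPow]
          rw [← integral_sub i1 i2, ← lintegral_add_left (by fun_prop)]
          refine (enorm_integral_le_lintegral_enorm _).trans (lintegral_mono fun y => ?_)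
          rw [← enorm_mul, ← enorm_mul]
          refine le_trans (le_of_eq ?_) (enorm_add_le _ _)
          congr 1; ring
      _ = (∫⁻ x, ‖u x - u' x‖ₑ) * (∫⁻ x, ‖convPow u n x‖ₑ) +
          (∫⁻ x, ‖u' x‖ₑ) * ∫⁻ x, ‖convPow u n x - convPow u' n x‖ₑ := by
          have e1 := lintegral_lconv (hu.sub hu').enorm hc.enorm
          have e2 := lintegral_lconv hu'.enorm (hc.sub hc').enorm
          simp only [Pi.sub_apply] at e1 e2
          rw [lintegral_add_left hm1, e1, e2]
      _ ≤ (∫⁻ x, ‖u x - u' x‖ₑ) * M ^ (n + 1) +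
          M * (((n : ℝ≥0∞) + 1) * M ^ n * ∫⁻ x, ‖u x - u' x‖ₑ) := by gcongr
      _ = _ := by push_cast; ring

/-- Each of the `j` factors of `u^{*j}` contributes one difference, so that the Lipschitz constant is
`∑ M^{j-1} / (j-1)!` over `j ≥ 2`, well below `f₂(M)`. -/
lemma lintegral_enorm_convExp_sub_le {u u' : E d → ℂ} (hu : Measurable u) (hu' : Measurable u')
    {M : ℝ≥0∞} (hM : M ≠ ∞) (h : ∫⁻ x, ‖u x‖ₑ ≤ M) (h' : ∫⁻ x, ‖u' x‖ₑ ≤ M) :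
    ∫⁻ x, ‖convExp u x - convExp u' x‖ₑ ≤ ef₂ M * ∫⁻ x, ‖u x - u' x‖ₑ := by
  have hm := fun n => measurable_convPow hu n
  have hm' := fun n => measurable_convPow hu' n
  have hsum : ∀ v : E d → ℂ, Measurable v → ∫⁻ x, ‖v x‖ₑ ≤ M →
      ∀ᵐ x, Summable fun n : ℕ => convPow v (n + 1) x / ((n + 2).factorial : ℂ) := by
    intro v hv hvM
    have : ∀ᵐ x, lconvExp (fun x => ‖v x‖ₑ) x < ∞ :=
      ae_lt_top (measurable_lconvExp hv.enorm) (ne_top_of_le_ne_top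
        (ENNReal.mul_ne_top (ef₂_ne_top (ne_top_of_le_ne_top hM hvM))
          (ne_top_of_le_ne_top hM hvM)) (lintegral_lconvExp_le hv.enorm))
    filter_upwards [this] with x hx
    exact summable_convExp (fun _ => le_rfl) hx.ne
  calc _ ≤ ∫⁻ x, ∑' n : ℕ, ‖convPow u (n + 1) x - convPow u' (n + 1) x‖ₑ /
        ((n + 2).factorial : ℝ≥0∞) := by
        refine lintegral_mono_ae ?_
        filter_upwards [hsum u hu h, hsum u' hu' h'] with x s1 s2
        unfold convExp
        rw [← s1.tsum_sub s2]
        refine enorm_tsum_le_tsum_enorm.trans (le_of_eq (tsum_congr fun n => ?_))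
        rw [← sub_div, enorm_div_factorial]
    _ = ∑' n : ℕ, (∫⁻ x, ‖convPow u (n + 1) x - convPow u' (n + 1) x‖ₑ) /
        ((n + 2).factorial : ℝ≥0∞) := by
        rw [lintegral_tsum fun n => by
          have := hm (n + 1); have := hm' (n + 1); fun_prop]
        refine tsum_congr fun n => ?_
        simp_rw [div_eq_mul_inv]
        have := hm (n + 1)
        have := hm' (n + 1)
        rw [lintegral_mul_const _ (by fun_prop)]
    _ ≤ _ := by
        rw [ef₂, ← ENNReal.tsum_mul_right]
        refine ENNReal.tsum_le_tsum fun n => ?_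
        have h2 : (n : ℝ≥0∞) + 1 + 1 = n + 2 := by rw [add_assoc]; norm_num
        have h1 := lintegral_enorm_convPow_sub_le hu hu' hM h h' (n + 1)
        push_cast at h1
        rw [h2] at h1
        calc _ ≤ _ := ENNReal.div_le_div_right h1 _
          _ ≤ (((n : ℝ≥0∞) + 2) ^ 4 * M ^ (n + 1) * ∫⁻ x, ‖u x - u' x‖ₑ) /
              ((n + 2).factorial : ℝ≥0∞) := by
              gcongr
              exact le_self_pow (le_add_left (by norm_num)) (by norm_num)
          _ = _ := by simp only [div_eq_mul_inv]; ring

/-! ### Hermitian symmetry -/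

/-- Hermitian symmetry `u(-ξ) = conj u(ξ)`, the Fourier-side expression of being real-valued. -/
def Hermitian (u : E d → ℂ) : Prop := ∀ x, u (-x) = conj (u x)

lemma Hermitian.convPow {u : E d → ℂ} (hu : Hermitian u) (n : ℕ) : Hermitian (convPow u n) := by
  induction n with
  | zero => exact hu
  | succ n ih =>
    intro x
    simp only [ExpPDE.convPow]
    rw [← integral_conj, ← integral_neg_eq_self]
    refine integral_congr_ae (ae_of_all _ fun y => ?_)
    simp only [map_mul]
    rw [hu y, ← ih (x - y)]
    congr 2; abel

lemma Hermitian.convExp {u : E d → ℂ} (hu : Hermitian u) : Hermitian (convExp u) := by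
  intro x
  simp only [ExpPDE.convExp]
  rw [Complex.conj_tsum]
  refine tsum_congr fun n => ?_
  rw [hu.convPow (n + 1) x]
  simp

/-! ### The Picard iteration on the Fourier side -/

/-- The multiplier `e^{-t|ξ|⁴}`. -/
def rheat (t : ℝ) (η : E d) : ℝ := Real.exp (-(t * freq η ^ 4))

lemma rheat_pos (t : ℝ) (η : E d) : 0 < rheat t η := Real.exp_pos _

@[fun_prop]
lemma Measurable.rheat {α : Type*} [MeasurableSpace α] {f : α → ℝ} {g : α → E d}
    (hf : Measurable f) (hg : Measurable g) : Measurable fun x => rheat (f x) (g x) := by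
  unfold ExpPDE.rheat
  have : Measurable fun x => freq (g x) := measurable_freq.comp hg
  fun_prop

lemma enorm_rheat (t : ℝ) (η : E d) : ‖((rheat t η : ℝ) : ℂ)‖ₑ = heat 1 t η := by
  rw [← ofReal_norm, Complex.norm_real, Real.norm_of_nonneg (rheat_pos t η).le, rheat, heat,
    one_mul]

lemma enorm_freq_sq (η : E d) : ‖((freq η ^ 2 : ℝ) : ℂ)‖ₑ = efreq η ^ 2 := by
  rw [← ofReal_norm, Complex.norm_real, Real.norm_of_nonneg (sq_nonneg _), efreq,
    ENNReal.ofReal_pow (freq_nonneg η)]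

/-- The Fourier transform of `-Δh` when `P` is that of `h`. -/
def lapl (P : E d → ℂ) (ζ : E d) : ℂ := ((freq ζ ^ 2 : ℝ) : ℂ) * P ζ

lemma enorm_lapl (P : E d → ℂ) (ζ : E d) : ‖lapl P ζ‖ₑ = efreq ζ ^ 2 * ‖P ζ‖ₑ := by
  rw [lapl, enorm_mul, enorm_freq_sq]

lemma measurable_lapl {P : E d → ℂ} (hP : Measurable P) : Measurable (lapl P) := by
  unfold lapl; fun_prop

/-- Duhamel's formula for `p_t = -|ξ|⁴ p - |ξ|² ∑_{j ≥ 2} u^{*j} / j!` with `u = |ξ|² p`, which is the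
equation `h_t = Δ e^{-Δh}` on the Fourier side. -/
def duhamel (p₀ : E d → ℂ) (P : ℝ → E d → ℂ) (t : ℝ) (η : E d) : ℂ :=
  (rheat t η : ℂ) * p₀ η -
    ((freq η ^ 2 : ℝ) : ℂ) * ∫ τ in Set.Ioc 0 t, (rheat (t - τ) η : ℂ) * convExp (lapl (P τ)) η

/-- The Picard iterates, started from zero. -/
def picard (p₀ : E d → ℂ) : ℕ → ℝ → E d → ℂ
  | 0 => fun _ _ => 0
  | n + 1 => duhamel p₀ (picard p₀ n)

/-- The limit of the Picard iterates, written as the sum of their increments. -/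
def fourierSol (p₀ : E d → ℂ) (t : ℝ) (η : E d) : ℂ :=
  ∑' n, (picard p₀ (n + 1) t η - picard p₀ n t η)

lemma measurable_lapl_param {P : ℝ → E d → ℂ} (hP : Measurable fun p : ℝ × E d => P p.1 p.2) :
    Measurable fun p : ℝ × E d => lapl (P p.1) p.2 := by
  unfold lapl; fun_prop

lemma measurable_convExp_lapl {P : ℝ → E d → ℂ}
    (hP : Measurable fun p : ℝ × E d => P p.1 p.2) :
    Measurable fun p : ℝ × E d => convExp (lapl (P p.1)) p.2 :=
  measurable_convExp_param (u := fun t => lapl (P t)) (measurable_lapl_param hP)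

lemma measurable_comp_swap {α : Type*} [MeasurableSpace α] {Q : ℝ → E d → α}
    (hQ : Measurable fun p : ℝ × E d => Q p.1 p.2) :
    Measurable fun q : (ℝ × E d) × ℝ => Q q.2 q.1.2 :=
  hQ.comp (by fun_prop : Measurable fun q : (ℝ × E d) × ℝ => (q.2, q.1.2))

lemma measurable_comp_left {α : Type*} [MeasurableSpace α] {Q : ℝ → E d → α}
    (hQ : Measurable fun p : ℝ × E d => Q p.1 p.2) (η : E d) : Measurable fun τ => Q τ η :=
  hQ.comp (measurable_prodMk_right (y := η))

lemma measurable_integral_Ioc {f : (ℝ × E d) × ℝ → ℂ} (hf : Measurable f) :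
    Measurable fun p : ℝ × E d => ∫ τ in Set.Ioc 0 p.1, f (p, τ) := by
  have e : ∀ p : ℝ × E d, ∫ τ in Set.Ioc 0 p.1, f (p, τ) =
      ∫ τ, {q : (ℝ × E d) × ℝ | 0 < q.2 ∧ q.2 ≤ q.1.1}.indicator f (p, τ) := fun p => by
    rw [← integral_indicator measurableSet_Ioc]
    refine integral_congr_ae (ae_of_all _ fun τ => ?_)
    simp [Set.indicator]
  simp_rw [e]
  exact (StronglyMeasurable.integral_prod_right' (Measurable.stronglyMeasurable
    (hf.indicator ((measurableSet_lt measurable_const measurable_snd).inter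
      (measurableSet_le measurable_snd (measurable_fst.comp measurable_fst)))))).measurable

lemma measurable_duhamel {p₀ : E d → ℂ} (hp₀ : Measurable p₀) {P : ℝ → E d → ℂ}
    (hP : Measurable fun p : ℝ × E d => P p.1 p.2) :
    Measurable fun p : ℝ × E d => duhamel p₀ P p.1 p.2 := by
  have hQ := measurable_comp_swap (Q := fun t => convExp (lapl (P t))) (measurable_convExp_lapl hP)
  have h : Measurable fun p : ℝ × E d => ∫ τ in Set.Ioc 0 p.1,
      ((rheat (p.1 - τ) p.2 : ℝ) : ℂ) * convExp (lapl (P τ)) p.2 :=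
    measurable_integral_Ioc (f := fun q => ((rheat (q.1.1 - q.2) q.1.2 : ℝ) : ℂ) *
      convExp (lapl (P q.2)) q.1.2) (Measurable.mul (by fun_prop) hQ)
  unfold duhamel
  exact (Measurable.mul (by fun_prop) (by fun_prop)).sub (Measurable.mul (by fun_prop) h)

lemma measurable_picard {p₀ : E d → ℂ} (hp₀ : Measurable p₀) (n : ℕ) :
    Measurable fun p : ℝ × E d => picard p₀ n p.1 p.2 := by
  induction n with
  | zero => exact measurable_const
  | succ n ih => exact measurable_duhamel hp₀ ih

lemma measurable_fourierSol {p₀ : E d → ℂ} (hp₀ : Measurable p₀) :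
    Measurable fun p : ℝ × E d => fourierSol p₀ p.1 p.2 :=
  Measurable.tsum fun n => (measurable_picard hp₀ (n + 1)).sub (measurable_picard hp₀ n)

lemma measurable_comp_right {α : Type*} [MeasurableSpace α] {Q : ℝ → E d → α}
    (hQ : Measurable fun p : ℝ × E d => Q p.1 p.2) (t : ℝ) : Measurable (Q t) :=
  hQ.comp (measurable_prodMk_left (x := t))

lemma measurable_fourierSol_apply {p₀ : E d → ℂ} (hp₀ : Measurable p₀) (t : ℝ) :
    Measurable (fourierSol p₀ t) :=
  measurable_comp_right (Q := fourierSol p₀) (measurable_fourierSol hp₀) t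

lemma integrable_duhamel {P : ℝ → E d → ℂ} (hP : Measurable fun p : ℝ × E d => P p.1 p.2)
    {V : ℝ → E d → ℝ≥0∞} (h : ∀ t η, ‖P t η‖ₑ ≤ V t η) {t : ℝ} {η : E d}
    (hfin : ∫⁻ τ in Set.Ioc 0 t, heat 1 (t - τ) η * forcing V τ η ≠ ∞) :
    IntegrableOn (fun τ => ((rheat (t - τ) η : ℝ) : ℂ) * convExp (lapl (P τ)) η)
      (Set.Ioc 0 t) := by
  have hQ := measurable_comp_left (Q := fun t => convExp (lapl (P t)))
    (measurable_convExp_lapl hP) η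
  refine ⟨(Measurable.mul (by fun_prop) hQ).aestronglyMeasurable, ?_⟩
  refine lt_of_le_of_lt (lintegral_mono fun τ => ?_) hfin.lt_top
  rw [enorm_mul, enorm_rheat]
  refine mul_le_mul' le_rfl (enorm_convExp_le (fun ζ => ?_) η)
  rw [enorm_lapl]
  exact mul_le_mul' le_rfl (h τ ζ)

/-- One step of the induction that compares the Picard iterates with those of the majorant. The
summand `V'` on the left makes the increments telescope. -/
lemma enorm_duhamel_sub_le (p₀ : E d → ℂ) {P P' : ℝ → E d → ℂ}
    (hP : Measurable fun p : ℝ × E d => P p.1 p.2) (hP' : Measurable fun p : ℝ × E d => P' p.1 p.2)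
    {V V' : ℝ → E d → ℝ≥0∞} (hV' : Measurable fun p : ℝ × E d => V' p.1 p.2)
    (h' : ∀ t η, ‖P' t η‖ₑ ≤ V' t η) (h : ∀ t η, ‖P t η - P' t η‖ₑ + V' t η ≤ V t η)
    (t : ℝ) (η : E d) :
    ‖duhamel p₀ P t η - duhamel p₀ P' t η‖ₑ + majStep 1 1 (fun η => ‖p₀ η‖ₑ) V' t η ≤
      majStep 1 1 (fun η => ‖p₀ η‖ₑ) V t η := by
  have hVV : ∀ t η, V' t η ≤ V t η := fun t η => le_add_self.trans (h t η)
  have hPV : ∀ t η, ‖P t η‖ₑ ≤ V t η := fun t η => by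
    calc ‖P t η‖ₑ = ‖(P t η - P' t η) + P' t η‖ₑ := by rw [sub_add_cancel]
      _ ≤ ‖P t η - P' t η‖ₑ + ‖P' t η‖ₑ := enorm_add_le _ _
      _ ≤ _ := (add_le_add_right (h' t η) _).trans (h t η)
  rcases eq_or_ne (freq η) 0 with h0 | h0
  · have e : duhamel p₀ P t η - duhamel p₀ P' t η = 0 := by simp [duhamel, h0]
    rw [e, enorm_zero, zero_add]
    exact majStep_mono hVV t η
  have he0 : efreq η ^ 2 ≠ 0 := by
    refine pow_ne_zero 2 ?_
    rw [efreq, ne_eq, ENNReal.ofReal_eq_zero, not_le]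
    exact lt_of_le_of_ne (freq_nonneg η) (Ne.symm h0)
  rcases eq_or_ne (∫⁻ τ in Set.Ioc 0 t, heat 1 (t - τ) η * forcing V τ η) ∞ with hx | hx
  · have : majStep 1 1 (fun η => ‖p₀ η‖ₑ) V t η = ∞ := by
      rw [majStep, hx, ENNReal.mul_top he0, add_top, one_mul]
    rw [this]; exact le_top
  have hFF : ∀ τ, forcing V' τ η ≤ forcing V τ η := fun τ =>
    lconvExp_mono (fun ζ => mul_le_mul' le_rfl (hVV τ ζ)) η
  have hx' : ∫⁻ τ in Set.Ioc 0 t, heat 1 (t - τ) η * forcing V' τ η ≠ ∞ :=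
    ne_top_of_le_ne_top hx (lintegral_mono fun τ => mul_le_mul' le_rfl (hFF τ))
  have i1 := integrable_duhamel hP hPV hx
  have i2 := integrable_duhamel hP' h' hx'
  have hF' : Measurable fun τ => forcing V' τ η :=
    (measurable_forcing hV').comp (measurable_prodMk_right (y := η))
  have e : duhamel p₀ P t η - duhamel p₀ P' t η = -(((freq η ^ 2 : ℝ) : ℂ) *
      ∫ τ in Set.Ioc 0 t, (((rheat (t - τ) η : ℝ) : ℂ) * convExp (lapl (P τ)) η -
        ((rheat (t - τ) η : ℝ) : ℂ) * convExp (lapl (P' τ)) η)) := by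
    rw [integral_sub i1 i2]; unfold duhamel; ring
  rw [e, enorm_neg, enorm_mul, enorm_freq_sq]
  have key : ‖∫ τ in Set.Ioc 0 t, (((rheat (t - τ) η : ℝ) : ℂ) * convExp (lapl (P τ)) η -
        ((rheat (t - τ) η : ℝ) : ℂ) * convExp (lapl (P' τ)) η)‖ₑ +
        ∫⁻ τ in Set.Ioc 0 t, heat 1 (t - τ) η * forcing V' τ η ≤
      ∫⁻ τ in Set.Ioc 0 t, heat 1 (t - τ) η * forcing V τ η := by
    refine (add_le_add_left (enorm_integral_le_lintegral_enorm _) _).trans ?_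
    rw [← lintegral_add_right _ (by fun_prop)]
    refine lintegral_mono fun τ => ?_
    have hPτ : Measurable fun ζ => P τ ζ := hP.comp measurable_prodMk_left
    have hPτ' : Measurable fun ζ => P' τ ζ := hP'.comp measurable_prodMk_left
    have hVτ' : Measurable fun ζ => V' τ ζ := hV'.comp measurable_prodMk_left
    rw [← mul_sub, enorm_mul, enorm_rheat, ← mul_add]
    refine mul_le_mul' le_rfl (enorm_convExp_sub_le (measurable_lapl hPτ) (measurable_lapl hPτ')
      (by fun_prop) (fun ζ => ?_) (fun ζ => ?_) η)
    · rw [enorm_lapl]; exact mul_le_mul' le_rfl (h' τ ζ)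
    · have : lapl (P τ) ζ - lapl (P' τ) ζ = ((freq ζ ^ 2 : ℝ) : ℂ) * (P τ ζ - P' τ ζ) := by
        unfold lapl; ring
      rw [this, enorm_mul, enorm_freq_sq, ← mul_add]
      exact mul_le_mul' le_rfl (h τ ζ)
  unfold majStep
  rw [one_mul, one_mul]
  calc _ = heat 1 t η * ‖p₀ η‖ₑ + efreq η ^ 2 *
      (‖∫ τ in Set.Ioc 0 t, (((rheat (t - τ) η : ℝ) : ℂ) * convExp (lapl (P τ)) η -
        ((rheat (t - τ) η : ℝ) : ℂ) * convExp (lapl (P' τ)) η)‖ₑ +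
        ∫⁻ τ in Set.Ioc 0 t, heat 1 (t - τ) η * forcing V' τ η) := by ring
    _ ≤ _ := add_le_add le_rfl (mul_le_mul' le_rfl key)

section Picard

variable {p₀ : E d → ℂ}

/-- The iterates of the majorant belonging to the datum `p₀`. -/
abbrev solIter (p₀ : E d → ℂ) (n : ℕ) (t : ℝ) (η : E d) : ℝ≥0∞ :=
  majIter 1 1 (fun η => ‖p₀ η‖ₑ) n t η

/-- The majorant of the solution with datum `p₀`. -/
abbrev solMaj (p₀ : E d → ℂ) (t : ℝ) (η : E d) : ℝ≥0∞ :=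
  majorant 1 1 (fun η => ‖p₀ η‖ₑ) t η

lemma enorm_picard_aux (hp₀ : Measurable p₀) (n : ℕ) :
    (∀ t η, ‖picard p₀ n t η‖ₑ ≤ solIter p₀ n t η) ∧
    ∀ t η, ‖picard p₀ (n + 1) t η - picard p₀ n t η‖ₑ + solIter p₀ n t η ≤
      solIter p₀ (n + 1) t η := by
  induction n with
  | zero =>
    refine ⟨fun t η => by simp [picard], fun t η => ?_⟩
    change ‖duhamel p₀ (fun _ _ => 0) t η - 0‖ₑ + 0 ≤
      majStep 1 1 (fun η => ‖p₀ η‖ₑ) (fun _ _ => 0) t η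
    rw [sub_zero, add_zero]
    have h0 : ∀ x : E d, convExp (lapl (fun _ => (0 : ℂ))) x = 0 := by
      have h1 : ∀ n (x : E d), convPow (lapl (fun _ : E d => (0 : ℂ))) n x = 0 := by
        intro n
        induction n with
        | zero => intro x; simp [convPow, lapl]
        | succ n ih => intro x; simp [convPow, ih]
      intro x; simp [convExp, h1]
    simp only [duhamel, h0, mul_zero, integral_zero, sub_zero]
    rw [enorm_mul, enorm_rheat, majStep, one_mul]
    exact le_self_add
  | succ n ih =>
    have h1 : ∀ t η, ‖picard p₀ (n + 1) t η‖ₑ ≤ solIter p₀ (n + 1) t η := fun t η => by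
      calc _ = ‖(picard p₀ (n + 1) t η - picard p₀ n t η) + picard p₀ n t η‖ₑ := by
            rw [sub_add_cancel]
        _ ≤ ‖picard p₀ (n + 1) t η - picard p₀ n t η‖ₑ + ‖picard p₀ n t η‖ₑ := enorm_add_le _ _
        _ ≤ _ := (add_le_add_right (ih.1 t η) _).trans (ih.2 t η)
    exact ⟨h1, enorm_duhamel_sub_le p₀ (measurable_picard hp₀ (n + 1)) (measurable_picard hp₀ n)
      (measurable_majIter hp₀.enorm n) ih.1 ih.2⟩

lemma enorm_picard_sub_le (hp₀ : Measurable p₀) {n m : ℕ} (hnm : n ≤ m) (t : ℝ) (η : E d) :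
    ‖picard p₀ m t η - picard p₀ n t η‖ₑ + solIter p₀ n t η ≤ solIter p₀ m t η := by
  induction m, hnm using Nat.le_induction with
  | base => simp
  | succ m _ ih =>
    calc _ = ‖(picard p₀ (m + 1) t η - picard p₀ m t η) +
          (picard p₀ m t η - picard p₀ n t η)‖ₑ + solIter p₀ n t η := by congr 2; ring
      _ ≤ (‖picard p₀ (m + 1) t η - picard p₀ m t η‖ₑ +
          ‖picard p₀ m t η - picard p₀ n t η‖ₑ) + solIter p₀ n t η :=
          add_le_add_left (enorm_add_le _ _) _
      _ ≤ ‖picard p₀ (m + 1) t η - picard p₀ m t η‖ₑ + solIter p₀ m t η := by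
          rw [add_assoc]; exact add_le_add_right ih _
      _ ≤ _ := (enorm_picard_aux hp₀ m).2 t η

lemma tendsto_picard (hp₀ : Measurable p₀) {t : ℝ} {η : E d} (hfin : solMaj p₀ t η ≠ ∞) :
    Tendsto (fun n => picard p₀ n t η) atTop (𝓝 (fourierSol p₀ t η)) := by
  have hpart : ∀ n, ∑ k ∈ Finset.range n, ‖picard p₀ (k + 1) t η - picard p₀ k t η‖ₑ ≤
      solIter p₀ n t η := by
    intro n
    induction n with
    | zero => simp
    | succ n ih =>
      rw [Finset.sum_range_succ, add_comm]
      exact (add_le_add_right ih _).trans ((enorm_picard_aux hp₀ n).2 t η)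
  have hs : Summable fun n => picard p₀ (n + 1) t η - picard p₀ n t η := by
    refine Summable.of_enorm (ne_top_of_le_ne_top hfin ?_)
    rw [ENNReal.tsum_eq_iSup_nat]
    exact iSup_mono hpart
  have := hs.hasSum.tendsto_sum_nat
  simp_rw [Finset.sum_range_sub (fun n => picard p₀ n t η)] at this
  have h0 : picard p₀ 0 t η = 0 := rfl
  simp only [h0, sub_zero] at this
  exact this

lemma enorm_fourierSol_sub_picard_le (hp₀ : Measurable p₀) (n : ℕ) (t : ℝ) (η : E d) :
    ‖fourierSol p₀ t η - picard p₀ n t η‖ₑ + solIter p₀ n t η ≤ solMaj p₀ t η := by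
  rcases eq_or_ne (solMaj p₀ t η) ∞ with h | h
  · rw [h]; exact le_top
  have hlim : Tendsto (fun m => ‖picard p₀ m t η - picard p₀ n t η‖ₑ + solIter p₀ n t η) atTop
      (𝓝 (‖fourierSol p₀ t η - picard p₀ n t η‖ₑ + solIter p₀ n t η)) :=
    (((tendsto_picard hp₀ h).sub_const _).enorm).add_const _
  refine le_of_tendsto hlim ?_
  filter_upwards [eventually_ge_atTop n] with m hm
  exact (enorm_picard_sub_le hp₀ hm t η).trans (le_iSup (fun m => solIter p₀ m t η) m)

lemma enorm_fourierSol_le (hp₀ : Measurable p₀) (t : ℝ) (η : E d) :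
    ‖fourierSol p₀ t η‖ₑ ≤ solMaj p₀ t η := by
  have h0 : picard p₀ 0 t η = 0 := rfl
  have h1 : solIter p₀ 0 t η = 0 := rfl
  simpa only [h0, h1, sub_zero, add_zero] using enorm_fourierSol_sub_picard_le hp₀ 0 t η

/-- The limit of the Picard iterates solves Duhamel's equation wherever the majorant is finite. -/
lemma duhamel_fourierSol (hp₀ : Measurable p₀) {t : ℝ} {η : E d} (hfin : solMaj p₀ t η ≠ ∞) :
    duhamel p₀ (fourierSol p₀) t η = fourierSol p₀ t η := by
  have h1 : ∀ n, ‖duhamel p₀ (fourierSol p₀) t η - picard p₀ (n + 1) t η‖ₑ +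
      solIter p₀ (n + 1) t η ≤ solMaj p₀ t η := by
    intro n
    have := enorm_duhamel_sub_le p₀ (measurable_fourierSol hp₀) (measurable_picard hp₀ n)
      (measurable_majIter hp₀.enorm n) (enorm_picard_aux hp₀ n).1
      (enorm_fourierSol_sub_picard_le hp₀ n) t η
    rw [majStep_majorant hp₀.enorm] at this
    exact this
  have hmaj : Tendsto (fun n => solIter p₀ (n + 1) t η) atTop (𝓝 (solMaj p₀ t η)) :=
    (tendsto_atTop_iSup (majIter_monotone t η)).comp (tendsto_add_atTop_nat 1)
  have h2 : Tendsto (fun n => ‖duhamel p₀ (fourierSol p₀) t η - picard p₀ (n + 1) t η‖ₑ) atTop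
      (𝓝 0) := by
    have hsub : Tendsto (fun n => solMaj p₀ t η - solIter p₀ (n + 1) t η) atTop (𝓝 0) := by
      have := ENNReal.Tendsto.sub (tendsto_const_nhds (x := solMaj p₀ t η)) hmaj (Or.inl hfin)
      simpa using this
    refine tendsto_of_tendsto_of_tendsto_of_le_of_le tendsto_const_nhds hsub
      (fun n => zero_le) fun n => ?_
    refine ENNReal.le_sub_of_add_le_right (ne_top_of_le_ne_top hfin ?_) (h1 n)
    exact le_add_self.trans (h1 n)
  have h3 : Tendsto (fun n => ‖duhamel p₀ (fourierSol p₀) t η - picard p₀ (n + 1) t η‖ₑ) atTop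
      (𝓝 ‖duhamel p₀ (fourierSol p₀) t η - fourierSol p₀ t η‖ₑ) :=
    (((tendsto_picard hp₀ hfin).comp (tendsto_add_atTop_nat 1)).const_sub _).enorm
  have := tendsto_nhds_unique h3 h2
  exact sub_eq_zero.1 (enorm_eq_zero.1 this)

lemma freq_neg (η : E d) : freq (-η) = freq η := by simp [freq]

lemma hermitian_lapl {P : E d → ℂ} (hP : Hermitian P) : Hermitian (lapl P) := fun x => by
  unfold lapl
  rw [freq_neg, hP x, map_mul, Complex.conj_ofReal]

lemma hermitian_picard (h : Hermitian p₀) (n : ℕ) (t : ℝ) : Hermitian (picard p₀ n t) := by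
  induction n generalizing t with
  | zero => intro x; simp [picard]
  | succ n ih =>
    intro x
    simp only [picard, duhamel]
    rw [freq_neg, map_sub, map_mul, map_mul, Complex.conj_ofReal, Complex.conj_ofReal, h x,
      ← integral_conj]
    have e : ∀ s, rheat s (-x) = rheat s x := fun s => by simp [rheat, freq_neg]
    simp only [e, map_mul, Complex.conj_ofReal]
    congr 2
    refine integral_congr_ae (ae_of_all _ fun τ => ?_)
    simp only
    rw [(hermitian_lapl (ih τ)).convExp x]

lemma hermitian_fourierSol (h : Hermitian p₀) (t : ℝ) : Hermitian (fourierSol p₀ t) := by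
  intro x
  unfold fourierSol
  rw [Complex.conj_tsum]
  refine tsum_congr fun n => ?_
  rw [hermitian_picard h (n + 1) t x, hermitian_picard h n t x, map_sub]

end Picard

/-! ### Growing weights -/

/-- A weight that is submultiplicative in frequency and whose growth in time is absorbed by the heat
kernel transforms the majorant into a majorant with slightly worse constants. -/
lemma weight_mul_majorant_le {ω : ℝ → E d → ℝ≥0∞} {κ : ℝ≥0∞} {lam : ℝ} {a b : E d → ℝ≥0∞}
    (hκ : κ ≠ ∞) (hsub : ∀ t x y, ω t x ≤ ω t y * ω t (x - y)) (hfin : ∀ t x, ω t x ≠ ∞)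
    (hheat : ∀ τ t, 0 ≤ τ → τ ≤ t → ∀ η,
      ω t η * heat 1 (t - τ) η ≤ κ * heat lam (t - τ) η * ω τ η)
    (h0 : ∀ η, ω 0 η * a η ≤ b η) {t : ℝ} (ht : 0 ≤ t) (η : E d) :
    ω t η * majorant 1 1 a t η ≤ majorant κ lam b t η := by
  have key : ∀ n, ∀ t, 0 ≤ t → ∀ η, ω t η * majIter 1 1 a n t η ≤ majIter κ lam b n t η := by
    intro n
    induction n with
    | zero => intro t _ η; simp [majIter]
    | succ n ih =>
      intro t ht η
      simp only [majIter]
      unfold majStep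
      have h1 : ω t η * (heat 1 t η * a η) ≤ κ * (heat lam t η * b η) := by
        have := hheat 0 t le_rfl ht η
        rw [sub_zero] at this
        calc _ = (ω t η * heat 1 t η) * a η := by ring
          _ ≤ (κ * heat lam t η * ω 0 η) * a η := by gcongr
          _ = κ * heat lam t η * (ω 0 η * a η) := by ring
          _ ≤ κ * heat lam t η * b η := by gcongr; exact h0 η
          _ = _ := by ring
      have h2 : ω t η * ∫⁻ τ in Set.Ioc 0 t, heat 1 (t - τ) η * forcing (majIter 1 1 a n) τ η ≤
          κ * ∫⁻ τ in Set.Ioc 0 t, heat lam (t - τ) η * forcing (majIter κ lam b n) τ η := by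
        rw [← lintegral_const_mul' _ _ (hfin t η)]
        calc _ ≤ ∫⁻ τ in Set.Ioc 0 t,
              κ * (heat lam (t - τ) η * forcing (majIter κ lam b n) τ η) := by
              refine setLIntegral_mono' measurableSet_Ioc fun τ hτ => ?_
              calc _ = (ω t η * heat 1 (t - τ) η) * forcing (majIter 1 1 a n) τ η := by ring
                _ ≤ (κ * heat lam (t - τ) η * ω τ η) * forcing (majIter 1 1 a n) τ η := by
                    exact mul_le_mul' (hheat τ t hτ.1.le hτ.2 η) le_rfl
                _ = κ * (heat lam (t - τ) η * (ω τ η * forcing (majIter 1 1 a n) τ η)) := by ring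
                _ ≤ _ := by
                    gcongr
                    refine mul_lconvExp_le (hsub τ) (hfin τ) (fun ζ => ?_) η
                    calc _ = efreq ζ ^ 2 * (ω τ ζ * majIter 1 1 a n τ ζ) := by ring
                      _ ≤ _ := mul_le_mul' le_rfl (ih τ hτ.1.le ζ)
          _ = _ := lintegral_const_mul' _ _ hκ
      calc _ = ω t η * (heat 1 t η * a η) + efreq η ^ 2 * (ω t η *
            ∫⁻ τ in Set.Ioc 0 t, heat 1 (t - τ) η * forcing (majIter 1 1 a n) τ η) := by ring
        _ ≤ κ * (heat lam t η * b η) + efreq η ^ 2 * (κ *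
            ∫⁻ τ in Set.Ioc 0 t, heat lam (t - τ) η * forcing (majIter κ lam b n) τ η) :=
            add_le_add h1 (mul_le_mul' le_rfl h2)
        _ = _ := by ring
  rw [majorant, ENNReal.mul_iSup]
  exact iSup_mono fun n => key n t ht η

/-- The weight `(1 + δ|ξ|)^m e^{ε t^{1/4} |ξ|}`. -/
def weight (δ m ε t : ℝ) (η : E d) : ℝ :=
  (1 + δ * freq η) ^ m * Real.exp (ε * t ^ (1 / 4 : ℝ) * freq η)

lemma weight_nonneg {δ : ℝ} (hδ : 0 ≤ δ) (m ε t : ℝ) (η : E d) : 0 ≤ weight δ m ε t η := by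
  have := freq_nonneg η
  unfold weight; positivity

/-- The heat kernel absorbs the growth of the radius of analyticity. -/
lemma rpow_quarter_sub_le {τ t x : ℝ} (hτ : 0 ≤ τ) (hτt : τ ≤ t) (hx : 0 ≤ x) :
    (t ^ (1 / 4 : ℝ) - τ ^ (1 / 4 : ℝ)) * x ≤ 1 + (t - τ) * x ^ 4 := by
  have h0 : 0 ≤ t - τ := sub_nonneg.2 hτt
  have h1 : t ^ (1 / 4 : ℝ) ≤ τ ^ (1 / 4 : ℝ) + (t - τ) ^ (1 / 4 : ℝ) := by
    have := Real.rpow_add_le_add_rpow hτ h0 (p := 1 / 4) (by norm_num) (by norm_num)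
    simpa using this
  set r := (t - τ) ^ (1 / 4 : ℝ) with hr
  have hr0 : 0 ≤ r := by positivity
  have hr4 : r ^ 4 = t - τ := by rw [hr, ← Real.rpow_natCast, ← Real.rpow_mul h0]; norm_num
  have h2 : r * x ≤ 1 + (r * x) ^ 4 := by
    have : 0 ≤ r * x := by positivity
    rcases le_total (r * x) 1 with h | h
    · have : 0 ≤ (r * x) ^ 4 := by positivity
      linarith
    · have := le_self_pow₀ h (n := 4) (by norm_num)
      linarith
  calc _ ≤ r * x := by gcongr; linarith
    _ ≤ _ := h2
    _ = _ := by rw [mul_pow, hr4]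

lemma ofReal_weight_mul_majorant_le {δ m ε : ℝ} (hδ : 0 ≤ δ) (hm : 0 ≤ m) (hε : 0 ≤ ε)
    (a : E d → ℝ≥0∞) {t : ℝ} (ht : 0 ≤ t) (η : E d) :
    ENNReal.ofReal (weight δ m ε t η) * majorant 1 1 a t η ≤
      majorant (ENNReal.ofReal (Real.exp ε)) (1 - ε)
        (fun η => ENNReal.ofReal ((1 + δ * freq η) ^ m) * a η) t η := by
  -- times are clamped at zero, since the weight is only controlled for `t ≥ 0`
  have key := weight_mul_majorant_le (ω := fun t η => ENNReal.ofReal (weight δ m ε (max t 0) η))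
    (κ := ENNReal.ofReal (Real.exp ε)) (lam := 1 - ε) (a := a)
    (b := fun η => ENNReal.ofReal ((1 + δ * freq η) ^ m) * a η)
    ENNReal.ofReal_ne_top (fun t x y => by
      rw [← ENNReal.ofReal_mul (weight_nonneg hδ _ _ _ _)]
      refine ENNReal.ofReal_le_ofReal ?_
      have hx := freq_nonneg x
      have hy := freq_nonneg y
      have hz := freq_nonneg (x - y)
      have hxy := freq_le_add x y
      set s := (max t 0) ^ (1 / 4 : ℝ) with hs
      have hs0 : 0 ≤ s := by positivity
      have e1 : (1 + δ * freq x) ^ m ≤ (1 + δ * freq y) ^ m * (1 + δ * freq (x - y)) ^ m := by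
        rw [← Real.mul_rpow (by positivity) (by positivity)]
        refine Real.rpow_le_rpow (by positivity) ?_ hm
        nlinarith [mul_nonneg (mul_nonneg hδ hy) (mul_nonneg hδ hz)]
      have e2 : Real.exp (ε * s * freq x) ≤
          Real.exp (ε * s * freq y) * Real.exp (ε * s * freq (x - y)) := by
        rw [← Real.exp_add, ← mul_add]
        gcongr
      calc weight δ m ε (max t 0) x ≤ ((1 + δ * freq y) ^ m * (1 + δ * freq (x - y)) ^ m) *
            (Real.exp (ε * s * freq y) * Real.exp (ε * s * freq (x - y))) := by
            unfold weight; gcongr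
        _ = _ := by unfold weight; ring)
    (fun t x => ENNReal.ofReal_ne_top)
    (fun τ t hτ hτt η => by
      have hη := freq_nonneg η
      have ht : 0 ≤ t := hτ.trans hτt
      simp only [max_eq_left ht, max_eq_left hτ]
      unfold heat
      rw [← ENNReal.ofReal_mul (weight_nonneg hδ _ _ _ _), ← ENNReal.ofReal_mul (Real.exp_nonneg _),
        ← ENNReal.ofReal_mul (by positivity)]
      refine ENNReal.ofReal_le_ofReal ?_
      have h1 := mul_le_mul_of_nonneg_left (rpow_quarter_sub_le hτ hτt hη) hε
      unfold weight
      calc _ = (1 + δ * freq η) ^ m * Real.exp (ε * t ^ (1 / 4 : ℝ) * freq η +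
            -(1 * (t - τ) * freq η ^ 4)) := by rw [Real.exp_add]; ring
        _ ≤ (1 + δ * freq η) ^ m * Real.exp (ε + -((1 - ε) * (t - τ) * freq η ^ 4) +
            ε * τ ^ (1 / 4 : ℝ) * freq η) := by
            refine mul_le_mul_of_nonneg_left (Real.exp_le_exp.2 ?_) (by positivity)
            linarith
        _ = _ := by rw [Real.exp_add, Real.exp_add]; ring)
    (fun η => by simp [weight]) ht η
  simpa [max_eq_left ht] using key

/-! ### Duhamel's formula and the integrated equation at a single frequency -/

lemma integral_Ioc_triangle {k : ℝ → ℝ → ℝ} (hk : Measurable fun p : ℝ × ℝ => k p.1 p.2)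
    {t : ℝ} (hk1 : ∀ τ r, 0 < r → r ≤ τ → τ ≤ t → |k τ r| ≤ 1) {G : ℝ → ℂ}
    (hG : IntegrableOn G (Set.Ioc 0 t)) :
    ∫ τ in Set.Ioc 0 t, ∫ r in Set.Ioc 0 τ, (k τ r : ℂ) * G r =
      ∫ r in Set.Ioc 0 t, ((∫ τ in r..t, k τ r : ℝ) : ℂ) * G r := by
  set A : Set (ℝ × ℝ) := {p | p.2 ≤ p.1} with hA
  have hAm : MeasurableSet A := measurableSet_le measurable_snd measurable_fst
  set μ : Measure ℝ := volume.restrict (Set.Ioc 0 t) with hμ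
  have hint : Integrable (A.indicator fun p : ℝ × ℝ => (k p.1 p.2 : ℂ) * G p.2) (μ.prod μ) := by
    have hG2 : Integrable (fun p : ℝ × ℝ => G p.2) (μ.prod μ) := hG.comp_snd μ
    refine hG2.mono ?_ ?_
    · refine AEStronglyMeasurable.indicator ?_ hAm
      exact (Complex.measurable_ofReal.comp hk).aestronglyMeasurable.mul hG2.aestronglyMeasurable
    · rw [hμ, Measure.prod_restrict, ae_restrict_iff' (measurableSet_Ioc.prod measurableSet_Ioc)]
      refine ae_of_all _ fun p hp => ?_
      by_cases hpA : p ∈ A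
      · rw [Set.indicator_of_mem hpA, norm_mul, Complex.norm_real, Real.norm_eq_abs]
        exact mul_le_of_le_one_left (norm_nonneg _) (hk1 _ _ hp.2.1 hpA hp.1.2)
      · rw [Set.indicator_of_notMem hpA, norm_zero]; exact norm_nonneg _
  have h1 : ∀ τ ∈ Set.Ioc 0 t, ∫ r in Set.Ioc 0 τ, (k τ r : ℂ) * G r =
      ∫ r, A.indicator (fun p : ℝ × ℝ => (k p.1 p.2 : ℂ) * G p.2) (τ, r) ∂μ := by
    intro τ hτ
    rw [hμ, ← integral_indicator measurableSet_Ioc, ← integral_indicator measurableSet_Ioc]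
    refine integral_congr_ae (ae_of_all _ fun r => ?_)
    simp only [Set.indicator, hA, Set.mem_Ioc, Set.mem_ofPred_eq]
    have := hτ.2
    clear_value μ A
    split_ifs <;> first | rfl | (exfalso; clear hk1; grind)
  have h2 : ∀ r ∈ Set.Ioc 0 t, ∫ τ, A.indicator (fun p : ℝ × ℝ => (k p.1 p.2 : ℂ) * G p.2) (τ, r) ∂μ
      = ((∫ τ in r..t, k τ r : ℝ) : ℂ) * G r := by
    intro r hr
    rw [intervalIntegral.integral_of_le hr.2, ← integral_complex_ofReal, ← integral_mul_const, hμ]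
    rw [← integral_Icc_eq_integral_Ioc (x := r), ← integral_indicator measurableSet_Ioc,
      ← integral_indicator measurableSet_Icc]
    refine integral_congr_ae (ae_of_all _ fun τ => ?_)
    have := hr.1
    simp only [Set.indicator, hA, Set.mem_Ioc, Set.mem_Icc, Set.mem_ofPred_eq]
    split_ifs <;> first | rfl | (exfalso; clear hk1 h1 hint hG; grind)
  rw [setIntegral_congr_fun measurableSet_Ioc h1, ← setIntegral_congr_fun measurableSet_Ioc h2]
  exact integral_integral_swap hint

lemma mul_integral_exp_neg (c : ℝ) (r t : ℝ) :
    c * ∫ τ in r..t, Real.exp (-((τ - r) * c)) = 1 - Real.exp (-((t - r) * c)) := by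
  have h : ∀ τ ∈ Set.uIcc r t, HasDerivAt (fun τ => -Real.exp (-((τ - r) * c)))
      (c * Real.exp (-((τ - r) * c))) τ := fun τ _ => by
    have h1 : HasDerivAt (fun τ : ℝ => -((τ - r) * c)) (-(1 * c)) τ :=
      (((hasDerivAt_id τ).sub_const r).mul_const c).neg
    exact h1.exp.neg.congr_deriv (by ring)
  rw [← intervalIntegral.integral_const_mul, intervalIntegral.integral_eq_sub_of_hasDerivAt h
    (Continuous.intervalIntegrable (by fun_prop) _ _)]
  simp only [sub_self, zero_mul, neg_zero, Real.exp_zero]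
  ring

lemma mul_integral_exp_neg' (c : ℝ) (r t : ℝ) :
    c * ∫ τ in r..t, Real.exp (-((t - τ) * c)) = 1 - Real.exp (-((t - r) * c)) := by
  have h : ∀ τ ∈ Set.uIcc r t, HasDerivAt (fun τ => Real.exp (-((t - τ) * c)))
      (c * Real.exp (-((t - τ) * c))) τ := fun τ _ => by
    have h1 : HasDerivAt (fun τ : ℝ => -((t - τ) * c)) (-(-1 * c)) τ :=
      (((hasDerivAt_id τ).const_sub t).mul_const c).neg
    exact h1.exp.congr_deriv (by ring)
  rw [← intervalIntegral.integral_const_mul, intervalIntegral.integral_eq_sub_of_hasDerivAt h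
    (Continuous.intervalIntegrable (by fun_prop) _ _)]
  simp

section Scalar

variable {c : ℝ} {q₀ b : ℂ} {G q : ℝ → ℂ} {T : ℝ}

lemma integrableOn_exp_mul (hc : 0 ≤ c) {t : ℝ} (hG : IntegrableOn G (Set.Ioc 0 t)) :
    IntegrableOn (fun τ => ((Real.exp (-((t - τ) * c)) : ℝ) : ℂ) * G τ) (Set.Ioc 0 t) := by
  refine Integrable.mono hG ((Measurable.aestronglyMeasurable (by fun_prop)).mul
    hG.aestronglyMeasurable) ?_
  rw [ae_restrict_iff' measurableSet_Ioc]
  refine ae_of_all _ fun τ hτ => ?_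
  rw [norm_mul, Complex.norm_real, Real.norm_of_nonneg (Real.exp_nonneg _)]
  refine mul_le_of_le_one_left (norm_nonneg _) (Real.exp_le_one_iff.2 ?_)
  have := mul_nonneg (sub_nonneg.2 hτ.2) hc
  linarith

lemma continuousOn_duhamel (hG : IntegrableOn G (Set.Ioc 0 T))
    (hq : ∀ t ∈ Set.Icc 0 T, q t = (Real.exp (-(t * c)) : ℂ) * q₀ -
      b * ∫ τ in Set.Ioc 0 t, ((Real.exp (-((t - τ) * c)) : ℝ) : ℂ) * G τ) :
    ContinuousOn q (Set.Icc 0 T) := by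
  have hG' : IntegrableOn (fun τ => ((Real.exp (τ * c) : ℝ) : ℂ) * G τ) (Set.Icc 0 T) := by
    rw [integrableOn_Icc_iff_integrableOn_Ioc]
    refine Integrable.mono (hG.const_mul ((Real.exp (T * |c|) : ℝ) : ℂ))
      ((Measurable.aestronglyMeasurable (by fun_prop)).mul hG.aestronglyMeasurable) ?_
    rw [ae_restrict_iff' measurableSet_Ioc]
    refine ae_of_all _ fun τ hτ => ?_
    rw [norm_mul, norm_mul, Complex.norm_real, Complex.norm_real,
      Real.norm_of_nonneg (Real.exp_nonneg _), Real.norm_of_nonneg (Real.exp_nonneg _)]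
    refine mul_le_mul_of_nonneg_right (Real.exp_le_exp.2 ?_) (norm_nonneg _)
    calc τ * c ≤ τ * |c| := mul_le_mul_of_nonneg_left (le_abs_self c) hτ.1.le
      _ ≤ T * |c| := mul_le_mul_of_nonneg_right hτ.2 (abs_nonneg c)
  have h1 := intervalIntegral.continuousOn_primitive hG'
  have h2 : ContinuousOn (fun t : ℝ => ((Real.exp (-(t * c)) : ℝ) : ℂ) * q₀ -
      b * (((Real.exp (-(t * c)) : ℝ) : ℂ) *
        ∫ τ in Set.Ioc 0 t, ((Real.exp (τ * c) : ℝ) : ℂ) * G τ)) (Set.Icc 0 T) :=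
    (ContinuousOn.mul (by fun_prop) continuousOn_const).sub
      (continuousOn_const.mul (ContinuousOn.mul (by fun_prop) h1))
  refine h2.congr fun t ht => ?_
  rw [hq t ht]
  simp only
  rw [← integral_const_mul ((Real.exp (-(t * c)) : ℝ) : ℂ)]
  congr 2
  refine integral_congr_ae (ae_of_all _ fun τ => ?_)
  simp only
  rw [← mul_assoc, ← Complex.ofReal_mul, ← Real.exp_add]
  congr 3; ring_nf

/-- Duhamel's formula implies the integrated equation `q' = -c q - b G`, also where `G` is merely
integrable. -/
lemma eq_sub_integral_of_duhamel (hc : 0 ≤ c) (hG : IntegrableOn G (Set.Ioc 0 T))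
    (hq : ∀ t ∈ Set.Icc 0 T, q t = (Real.exp (-(t * c)) : ℂ) * q₀ -
      b * ∫ τ in Set.Ioc 0 t, ((Real.exp (-((t - τ) * c)) : ℝ) : ℂ) * G τ)
    {t : ℝ} (ht : t ∈ Set.Icc 0 T) :
    q t = q₀ - ∫ τ in Set.Ioc 0 t, (c * q τ + b * G τ) := by
  have hGt : IntegrableOn G (Set.Ioc 0 t) := hG.mono_set (Set.Ioc_subset_Ioc_right ht.2)
  have hqi : IntegrableOn q (Set.Ioc 0 t) :=
    (((continuousOn_duhamel hG hq).mono (Set.Icc_subset_Icc_right ht.2)).integrableOn_Icc).mono_set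
      Set.Ioc_subset_Icc_self
  rw [integral_add (hqi.const_mul _) (hGt.const_mul _), integral_const_mul, integral_const_mul]
  have hmem : ∀ τ ∈ Set.Ioc 0 t, τ ∈ Set.Icc 0 T := fun τ hτ => ⟨hτ.1.le, hτ.2.trans ht.2⟩
  have htri := integral_Ioc_triangle (k := fun τ r => Real.exp (-((τ - r) * c))) (t := t)
    (by fun_prop) (fun τ r _ hr _ => by
      rw [abs_of_pos (Real.exp_pos _)]
      have := mul_nonneg (sub_nonneg.2 hr) hc
      exact Real.exp_le_one_iff.2 (by linarith)) hGt
  have e1 : ∫ τ in Set.Ioc 0 t, q τ = (∫ τ in Set.Ioc 0 t, ((Real.exp (-(τ * c)) : ℝ) : ℂ)) * q₀ -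
      b * ∫ τ in Set.Ioc 0 t, ∫ r in Set.Ioc 0 τ, ((Real.exp (-((τ - r) * c)) : ℝ) : ℂ) * G r := by
    have i1 : IntegrableOn (fun τ => ((Real.exp (-(τ * c)) : ℝ) : ℂ) * q₀) (Set.Ioc 0 t) :=
      (Continuous.integrableOn_Ioc (by fun_prop))
    have i2 : IntegrableOn (fun τ => b * ∫ r in Set.Ioc 0 τ,
        ((Real.exp (-((τ - r) * c)) : ℝ) : ℂ) * G r) (Set.Ioc 0 t) := by
      refine (i1.sub hqi).congr_fun (fun τ hτ => ?_) measurableSet_Ioc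
      simp only [Pi.sub_apply]
      rw [hq τ (hmem τ hτ)]; ring
    rw [setIntegral_congr_fun measurableSet_Ioc fun τ hτ => hq τ (hmem τ hτ), integral_sub i1 i2,
      integral_mul_const, integral_const_mul]
  have e2 : (c : ℂ) * ∫ τ in Set.Ioc 0 t, ((Real.exp (-(τ * c)) : ℝ) : ℂ) =
      ((1 - Real.exp (-(t * c)) : ℝ) : ℂ) := by
    have := mul_integral_exp_neg c 0 t
    simp only [sub_zero] at this
    rw [← this, intervalIntegral.integral_of_le ht.1, integral_complex_ofReal]
    push_cast; ring
  have e3 : (c : ℂ) * ∫ r in Set.Ioc 0 t, ((∫ τ in r..t, Real.exp (-((τ - r) * c)) : ℝ) : ℂ) * G r =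
      (∫ r in Set.Ioc 0 t, G r) -
        ∫ r in Set.Ioc 0 t, ((Real.exp (-((t - r) * c)) : ℝ) : ℂ) * G r := by
    rw [← integral_sub hGt (integrableOn_exp_mul hc hGt), ← integral_const_mul]
    refine integral_congr_ae (ae_of_all _ fun r => ?_)
    simp only
    rw [← mul_assoc, ← Complex.ofReal_mul, mul_integral_exp_neg]
    push_cast; ring
  rw [e1, htri, hq t ht]
  push_cast at e2 e3 ⊢
  linear_combination q₀ * e2 - b * e3

/-- The integrated equation `q' = -c q - b G` implies Duhamel's formula. -/
lemma duhamel_of_eq_sub_integral (hc : 0 ≤ c) {t : ℝ} (hG : IntegrableOn G (Set.Ioc 0 t))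
    (hqi : IntegrableOn q (Set.Ioc 0 t))
    (hq : ∀ τ ∈ Set.Icc 0 t, q τ = q₀ - ∫ r in Set.Ioc 0 τ, (c * q r + b * G r)) (ht : 0 ≤ t) :
    q t = (Real.exp (-(t * c)) : ℂ) * q₀ -
      b * ∫ τ in Set.Ioc 0 t, ((Real.exp (-((t - τ) * c)) : ℝ) : ℂ) * G τ := by
  set F : ℝ → ℂ := fun r => c * q r + b * G r with hF
  have hFi : IntegrableOn F (Set.Ioc 0 t) := (hqi.const_mul _).add (hG.const_mul _)
  have htri := integral_Ioc_triangle (k := fun τ r => Real.exp (-((t - τ) * c))) (t := t)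
    (by fun_prop) (fun τ r _ _ hr => by
      rw [abs_of_pos (Real.exp_pos _)]
      have := mul_nonneg (sub_nonneg.2 hr) hc
      exact Real.exp_le_one_iff.2 (by linarith)) hFi
  have i1 : IntegrableOn (fun τ => ((Real.exp (-((t - τ) * c)) : ℝ) : ℂ) * q₀) (Set.Ioc 0 t) :=
    (Continuous.integrableOn_Ioc (by fun_prop))
  have iq := integrableOn_exp_mul hc hqi
  have e1 : ∫ τ in Set.Ioc 0 t, ((Real.exp (-((t - τ) * c)) : ℝ) : ℂ) * q τ =
      (∫ τ in Set.Ioc 0 t, ((Real.exp (-((t - τ) * c)) : ℝ) : ℂ)) * q₀ -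
      ∫ τ in Set.Ioc 0 t, ∫ r in Set.Ioc 0 τ, ((Real.exp (-((t - τ) * c)) : ℝ) : ℂ) * F r := by
    have h : ∀ τ ∈ Set.Ioc 0 t, ((Real.exp (-((t - τ) * c)) : ℝ) : ℂ) * q τ =
        ((Real.exp (-((t - τ) * c)) : ℝ) : ℂ) * q₀ -
          ∫ r in Set.Ioc 0 τ, ((Real.exp (-((t - τ) * c)) : ℝ) : ℂ) * F r := fun τ hτ => by
      rw [integral_const_mul, hq τ ⟨hτ.1.le, hτ.2⟩]; ring
    have i2 : IntegrableOn (fun τ => ∫ r in Set.Ioc 0 τ,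
        ((Real.exp (-((t - τ) * c)) : ℝ) : ℂ) * F r) (Set.Ioc 0 t) := by
      refine (i1.sub iq).congr_fun (fun τ hτ => ?_) measurableSet_Ioc
      simp only [Pi.sub_apply]
      rw [h τ hτ]; ring
    rw [setIntegral_congr_fun measurableSet_Ioc h, integral_sub i1 i2, integral_mul_const]
  have e2 : (c : ℂ) * ∫ τ in Set.Ioc 0 t, ((Real.exp (-((t - τ) * c)) : ℝ) : ℂ) =
      ((1 - Real.exp (-(t * c)) : ℝ) : ℂ) := by
    have := mul_integral_exp_neg' c 0 t
    simp only [sub_zero] at this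
    rw [← this, intervalIntegral.integral_of_le ht, integral_complex_ofReal]
    push_cast; ring
  have iF := integrableOn_exp_mul hc hFi
  have e3 : (c : ℂ) * ∫ r in Set.Ioc 0 t, ((∫ τ in r..t, Real.exp (-((t - τ) * c)) : ℝ) : ℂ) * F r =
      (∫ r in Set.Ioc 0 t, F r) -
        ∫ r in Set.Ioc 0 t, ((Real.exp (-((t - r) * c)) : ℝ) : ℂ) * F r := by
    rw [← integral_sub hFi iF, ← integral_const_mul]
    refine integral_congr_ae (ae_of_all _ fun r => ?_)
    simp only
    rw [← mul_assoc, ← Complex.ofReal_mul, mul_integral_exp_neg']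
    push_cast; ring
  have e4 : ∫ r in Set.Ioc 0 t, ((Real.exp (-((t - r) * c)) : ℝ) : ℂ) * F r =
      c * (∫ r in Set.Ioc 0 t, ((Real.exp (-((t - r) * c)) : ℝ) : ℂ) * q r) +
      b * ∫ r in Set.Ioc 0 t, ((Real.exp (-((t - r) * c)) : ℝ) : ℂ) * G r := by
    rw [← integral_const_mul, ← integral_const_mul,
      ← integral_add (iq.const_mul _) ((integrableOn_exp_mul hc hG).const_mul _)]
    refine integral_congr_ae (ae_of_all _ fun r => ?_)
    simp only [hF]; ring
  have e5 := hq t ⟨ht, le_rfl⟩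
  rw [htri] at e1
  push_cast at e1 e2 e3 e4 e5 ⊢
  linear_combination e5 - c * e1 - q₀ * e2 + e3 - e4

end Scalar

/-! ### Regularity in time of the solution on the Fourier side -/

section Regularity

variable {p₀ : E d → ℂ} {Y σ : ℝ≥0∞}

/-- The dimension has to be positive: in dimension zero the only frequency is `0`. -/
lemma ae_efreq_ne_zero [NeZero d] : ∀ᵐ η : E d, efreq η ≠ 0 := by
  have : Nontrivial (E d) := by
    have : Nonempty (Fin d) := ⟨0⟩
    infer_instance
  filter_upwards [Measure.ae_ne (volume : Measure (E d)) (0 : E d)] with η h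
  simp only [efreq, ne_eq, ENNReal.ofReal_eq_zero, not_le, freq]
  have := norm_pos_iff.2 h
  positivity

lemma Subcritical.ae_majSup_ne_top [NeZero d] {κ : ℝ≥0∞} {lam : ℝ} {a : E d → ℝ≥0∞}
    (h : Subcritical κ lam a Y σ) : ∀ᵐ η, efreq η ≠ 0 ∧ majSup κ lam a η ≠ ∞ := by
  have hm : Measurable (majSup κ lam a) := measurable_majSup h.measurable
  have h1 : ∀ᵐ η, efreq η ^ 2 * majSup κ lam a η < ∞ :=
    ae_lt_top (by fun_prop) h.moment_majSup_lt_top.ne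
  filter_upwards [h1, ae_efreq_ne_zero] with η h1 hne
  refine ⟨hne, fun ht => ?_⟩
  rw [ht, ENNReal.mul_top (pow_ne_zero 2 hne)] at h1
  exact h1.ne rfl

variable (hp₀ : Measurable p₀)
include hp₀

/-- The nonlinear term of the solution is integrable in time wherever the uniform bound of the
majorant is finite. -/
lemma integrableOn_convExp_fourierSol {η : E d} (hne : efreq η ≠ 0)
    (hfin : majSup 1 1 (fun η => ‖p₀ η‖ₑ) η ≠ ∞) :
    IntegrableOn (fun τ => convExp (lapl (fourierSol p₀ τ)) η) (Set.Ioi 0) := by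
  refine ⟨(measurable_comp_left (Q := fun t => convExp (lapl (fourierSol p₀ t)))
    (measurable_convExp_lapl (measurable_fourierSol hp₀)) η).aestronglyMeasurable, ?_⟩
  have h1 : ∫⁻ τ in Set.Ioi 0, forcing (majorant 1 1 (fun η => ‖p₀ η‖ₑ)) τ η ≠ ∞ := by
    intro h
    apply hfin
    rw [majSup, h, ENNReal.mul_top (pow_ne_zero 2 hne), add_top, one_mul]
  refine lt_of_le_of_lt (lintegral_mono fun τ => ?_) h1.lt_top
  refine enorm_convExp_le (fun ζ => ?_) η
  rw [enorm_lapl]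
  exact mul_le_mul' le_rfl (enorm_fourierSol_le hp₀ τ ζ)

lemma fourierSol_eq_duhamel {η : E d} (hfin : majSup 1 1 (fun η => ‖p₀ η‖ₑ) η ≠ ∞) {t : ℝ}
    (ht : 0 ≤ t) :
    fourierSol p₀ t η = (Real.exp (-(t * freq η ^ 4)) : ℂ) * p₀ η - ((freq η ^ 2 : ℝ) : ℂ) *
      ∫ τ in Set.Ioc 0 t, ((Real.exp (-((t - τ) * freq η ^ 4)) : ℝ) : ℂ) *
        convExp (lapl (fourierSol p₀ τ)) η := by
  have h := duhamel_fourierSol hp₀ (t := t) (η := η)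
    (ne_top_of_le_ne_top hfin (majorant_le_majSup hp₀.enorm zero_le_one ht η))
  rw [← h]
  simp only [duhamel, rheat]

lemma continuousOn_fourierSol {η : E d} (hne : efreq η ≠ 0)
    (hfin : majSup 1 1 (fun η => ‖p₀ η‖ₑ) η ≠ ∞) :
    ContinuousOn (fun t => fourierSol p₀ t η) (Set.Ici 0) := by
  intro t ht
  have hI := (integrableOn_convExp_fourierSol hp₀ hne hfin).mono_set
    (show Set.Ioc (0 : ℝ) (t + 1) ⊆ Set.Ioi 0 from Set.Ioc_subset_Ioi_self)
  have h := continuousOn_duhamel (c := freq η ^ 4) (q := fun t => fourierSol p₀ t η) hI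
    (fun _ hτ => fourierSol_eq_duhamel hp₀ hfin hτ.1)
  refine (h t ⟨ht, by linarith⟩).mono_of_mem_nhdsWithin ?_
  rw [← Set.Ici_inter_Iic]
  exact inter_mem self_mem_nhdsWithin (mem_nhdsWithin_of_mem_nhds (Iic_mem_nhds (by linarith)))

/-- The equation on the Fourier side, integrated in time. -/
lemma fourierSol_eq_sub_integral {η : E d} (hne : efreq η ≠ 0)
    (hfin : majSup 1 1 (fun η => ‖p₀ η‖ₑ) η ≠ ∞) {t : ℝ} (ht : 0 ≤ t) :
    fourierSol p₀ t η = p₀ η - ∫ τ in Set.Ioc 0 t, (((freq η ^ 4 : ℝ) : ℂ) * fourierSol p₀ τ η +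
      ((freq η ^ 2 : ℝ) : ℂ) * convExp (lapl (fourierSol p₀ τ)) η) :=
  eq_sub_integral_of_duhamel (c := freq η ^ 4) (q := fun t => fourierSol p₀ t η)
    (pow_nonneg (freq_nonneg η) 4)
    ((integrableOn_convExp_fourierSol hp₀ hne hfin).mono_set Set.Ioc_subset_Ioi_self)
    (fun _ hτ => fourierSol_eq_duhamel hp₀ hfin hτ.1) ⟨ht, le_rfl⟩

lemma fourierSol_zero {η : E d} (hfin : majSup 1 1 (fun η => ‖p₀ η‖ₑ) η ≠ ∞) :
    fourierSol p₀ 0 η = p₀ η := by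
  rw [fourierSol_eq_duhamel hp₀ hfin le_rfl]; simp

lemma sq_enorm_fourierSol_le {t : ℝ} (ht : 0 ≤ t) (η : E d) :
    ‖fourierSol p₀ t η‖ₑ ^ 2 ≤ majSq 1 1 (fun η => ‖p₀ η‖ₑ) η := by
  refine le_trans (pow_le_pow_left₀ zero_le (enorm_fourierSol_le hp₀ t η) 2) ?_
  exact sq_majorant_le_majSq (a := fun η => ‖p₀ η‖ₑ) hp₀.enorm one_pos ht η

variable (hS : Subcritical 1 1 (fun η => ‖p₀ η‖ₑ) Y σ)
include hS

lemma memLp_fourierSol (h2 : ∫⁻ η, ‖p₀ η‖ₑ ^ 2 < ∞) {t : ℝ} (ht : 0 ≤ t) :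
    MemLp (fourierSol p₀ t) 2 := by
  have hm := measurable_fourierSol_apply hp₀ t
  have hb := hS.lintegral_majSq_lt_top ENNReal.one_ne_top h2
  have hle := sq_enorm_fourierSol_le hp₀ ht
  generalize majSq 1 1 (fun η => ‖p₀ η‖ₑ) = M at *
  generalize fourierSol p₀ t = P at *
  refine ⟨hm.aestronglyMeasurable, ?_⟩
  rw [eLpNorm_lt_top_iff_lintegral_rpow_enorm_lt_top (by norm_num) (by norm_num)]
  refine lt_of_le_of_lt (lintegral_mono fun η => ?_) hb
  simp only [ENNReal.toReal_ofNat, ENNReal.rpow_ofNat]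
  exact hle η

lemma tendsto_lintegral_sq_fourierSol [NeZero d] (h2 : ∫⁻ η, ‖p₀ η‖ₑ ^ 2 < ∞) {t₀ : ℝ}
    (ht₀ : 0 ≤ t₀) :
    Tendsto (fun t => ∫⁻ η, ‖fourierSol p₀ t η - fourierSol p₀ t₀ η‖ₑ ^ 2) (𝓝[Set.Ici 0] t₀)
      (𝓝 0) := by
  have hm := measurable_fourierSol_apply hp₀
  have key : ∀ t, 0 ≤ t → ∀ η, ‖fourierSol p₀ t η‖ₑ ^ 2 ≤ majSq 1 1 (fun η => ‖p₀ η‖ₑ) η :=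
    fun t ht η => sq_enorm_fourierSol_le hp₀ ht η
  rw [show (0 : ℝ≥0∞) = ∫⁻ _ : E d, 0 by simp]
  refine tendsto_lintegral_filter_of_dominated_convergence
    (fun η => 4 * majSq 1 1 (fun η => ‖p₀ η‖ₑ) η) ?_ ?_ ?_ ?_
  · exact Eventually.of_forall fun t => (((hm t).sub (hm t₀)).enorm).pow_const 2
  · filter_upwards [self_mem_nhdsWithin] with t ht
    refine ae_of_all _ fun η => ?_
    calc _ ≤ (‖fourierSol p₀ t η‖ₑ + ‖fourierSol p₀ t₀ η‖ₑ) ^ 2 := by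
          gcongr; exact enorm_sub_le
      _ ≤ 2 * ‖fourierSol p₀ t η‖ₑ ^ 2 + 2 * ‖fourierSol p₀ t₀ η‖ₑ ^ 2 := add_sq_le_two_mul _ _
      _ ≤ 2 * majSq 1 1 (fun η => ‖p₀ η‖ₑ) η + 2 * majSq 1 1 (fun η => ‖p₀ η‖ₑ) η :=
          add_le_add (mul_le_mul' le_rfl (key t ht η)) (mul_le_mul' le_rfl (key t₀ ht₀ η))
      _ = _ := by ring
  · rw [lintegral_const_mul' _ _ (by norm_num)]
    exact ENNReal.mul_ne_top (by norm_num) (hS.lintegral_majSq_lt_top ENNReal.one_ne_top h2).ne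
  · filter_upwards [hS.ae_majSup_ne_top] with η hη
    have h := (continuousOn_fourierSol hp₀ hη.1 hη.2) t₀ ht₀
    have h' : Tendsto (fun t => ‖fourierSol p₀ t η - fourierSol p₀ t₀ η‖ₑ ^ 2) (𝓝[Set.Ici 0] t₀)
        (𝓝 (‖fourierSol p₀ t₀ η - fourierSol p₀ t₀ η‖ₑ ^ 2)) :=
      ((ENNReal.continuous_pow 2).tendsto _).comp (h.tendsto.sub_const _).enorm
    simpa using h'

end Regularity

/-! ### Analyticity and decay -/

lemma ofReal_freq_pow (η : E d) (n : ℕ) : ENNReal.ofReal (freq η ^ n) = efreq η ^ n := by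
  rw [efreq, ENNReal.ofReal_pow (freq_nonneg η)]

lemma freq_sq_mul_one_add_rpow_le {s ρ : ℝ} (hρ : 0 ≤ ρ) :
    ρ ^ 2 * (1 + ρ) ^ max (s - 2) 0 ≤ 2 ^ max (s - 2) 0 * (ρ ^ 2 + ρ ^ s) := by
  set m := max (s - 2) 0 with hm
  have hm0 : 0 ≤ m := le_max_right _ _
  have hs0 : 0 ≤ ρ ^ s := Real.rpow_nonneg hρ s
  rcases le_total ρ 1 with h | h
  · have h1 : (1 + ρ) ^ m ≤ 2 ^ m := Real.rpow_le_rpow (by linarith) (by linarith) hm0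
    have h2 : (0 : ℝ) ≤ 2 ^ m := by positivity
    nlinarith [mul_le_mul_of_nonneg_left h1 (sq_nonneg ρ), mul_nonneg h2 hs0]
  · have h1 : (1 + ρ) ^ m ≤ 2 ^ m * ρ ^ m := by
      rw [← Real.mul_rpow (by norm_num) hρ]
      exact Real.rpow_le_rpow (by linarith) (by linarith) hm0
    have h2 : (0 : ℝ) ≤ 2 ^ m := by positivity
    have h3 : ρ ^ 2 * ρ ^ m ≤ ρ ^ 2 + ρ ^ s := by
      have hpos : 0 < ρ := by linarith
      rw [← Real.rpow_natCast, ← Real.rpow_add hpos]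
      rcases le_total (s - 2) 0 with h4 | h4
      · rw [hm, max_eq_right h4]
        simpa using hs0
      · rw [hm, max_eq_left h4]
        have : ((2 : ℕ) : ℝ) + (s - 2) = s := by push_cast; ring
        rw [this]
        have : (0:ℝ) ≤ ρ ^ ((2 : ℕ) : ℝ) := by positivity
        linarith
    calc _ ≤ ρ ^ 2 * (2 ^ m * ρ ^ m) := by gcongr
      _ = 2 ^ m * (ρ ^ 2 * ρ ^ m) := by ring
      _ ≤ _ := by gcongr

/-- Room in the smallness condition: it survives a slightly larger datum, a constant `e^ε` in front
of Duhamel's formula and a slightly slower heat kernel. -/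
lemma exists_room {y₀ : ℝ} (hf : f₂ y₀ < 1) :
    ∃ r : ℝ, 0 < r ∧ r < 1 ∧ Real.exp r * f₂ (Real.exp r * (y₀ + r)) < 1 - r := by
  have hc : Continuous fun r : ℝ => Real.exp r * f₂ (Real.exp r * (y₀ + r)) - (1 - r) := by
    have := continuous_f₂
    fun_prop
  have h0 : Real.exp 0 * f₂ (Real.exp 0 * (y₀ + 0)) - (1 - 0) < 0 := by simp; linarith
  have h1 : ∀ᶠ r in 𝓝 (0 : ℝ), Real.exp r * f₂ (Real.exp r * (y₀ + r)) - (1 - r) < 0 :=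
    hc.continuousAt.eventually_lt continuousAt_const h0
  have h2 : ∀ᶠ r in 𝓝[>] (0 : ℝ),
      Real.exp r * f₂ (Real.exp r * (y₀ + r)) - (1 - r) < 0 ∧ r < 1 :=
    nhdsWithin_le_nhds (h1.and (Iio_mem_nhds one_pos))
  obtain ⟨r, ⟨hr, hr1⟩, hr0⟩ := (h2.and self_mem_nhdsWithin).exists
  exact ⟨r, hr0, hr1, by linarith⟩

lemma subcritical_of_room {a : E d → ℝ≥0∞} (ha : Measurable a) {y₀ r : ℝ} (hy₀ : 0 ≤ y₀)
    (hr0 : 0 < r) (hr1 : r < 1) (hr : Real.exp r * f₂ (Real.exp r * (y₀ + r)) < 1 - r)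
    (h : ∫⁻ η, efreq η ^ 2 * a η ≤ ENNReal.ofReal (y₀ + r)) :
    Subcritical (ENNReal.ofReal (Real.exp r)) (1 - r) a
      (ENNReal.ofReal (Real.exp r * (y₀ + r)))
      (ENNReal.ofReal (1 - r - Real.exp r * f₂ (Real.exp r * (y₀ + r)))) where
  measurable := ha
  lam_pos := by linarith
  ne_top := ENNReal.ofReal_ne_top
  moment_le := by
    rw [ENNReal.ofReal_mul (Real.exp_nonneg r)]
    exact mul_le_mul' le_rfl h
  dissipation := by
    have h0 : 0 ≤ Real.exp r * (y₀ + r) := by positivity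
    rw [ef₂_ofReal h0, ← ENNReal.ofReal_mul (Real.exp_nonneg r), ← ENNReal.ofReal_add
      (by linarith) (mul_nonneg (Real.exp_nonneg r) (f₂_nonneg h0))]
    exact ENNReal.ofReal_le_ofReal (by linarith)
  sigma_ne_zero := by
    rw [ne_eq, ENNReal.ofReal_eq_zero, not_le]
    linarith

/-- A polynomial weight `(1 + δ|ξ|)^m` increases the second moment arbitrarily little. -/
lemma exists_weight_moment_le {a : E d → ℝ≥0∞} (ha : Measurable a) {s y₀ r : ℝ} (hy₀ : 0 ≤ y₀)
    (hr0 : 0 < r) (h : ∫⁻ η, efreq η ^ 2 * a η ≤ ENNReal.ofReal y₀)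
    (hs : ∫⁻ η, ENNReal.ofReal (freq η ^ s) * a η < ∞) :
    ∃ δ : ℝ, 0 < δ ∧ ∫⁻ η, efreq η ^ 2 *
      (ENNReal.ofReal ((1 + δ * freq η) ^ max (s - 2) 0) * a η) ≤ ENNReal.ofReal (y₀ + r) := by
  set m := max (s - 2) 0 with hm
  have hm0 : 0 ≤ m := le_max_right _ _
  have hlim : Tendsto (fun δ : ℝ => ∫⁻ η, efreq η ^ 2 *
      (ENNReal.ofReal ((1 + δ * freq η) ^ m) * a η)) (𝓝[>] 0)
      (𝓝 (∫⁻ η, efreq η ^ 2 * a η)) := by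
    have hfin : ∫⁻ η, (ENNReal.ofReal (2 ^ m) * (efreq η ^ 2 * a η +
        ENNReal.ofReal (freq η ^ s) * a η)) ≠ ∞ := by
      rw [lintegral_const_mul' _ _ ENNReal.ofReal_ne_top, lintegral_add_left (by fun_prop)]
      exact ENNReal.mul_ne_top ENNReal.ofReal_ne_top (ENNReal.add_ne_top.2
        ⟨ne_top_of_le_ne_top ENNReal.ofReal_ne_top h, hs.ne⟩)
    refine tendsto_lintegral_filter_of_dominated_convergence _ ?_ ?_ hfin ?_
    · exact Eventually.of_forall fun δ => by fun_prop
    · have : ∀ᶠ δ : ℝ in 𝓝[>] 0, δ < 1 := nhdsWithin_le_nhds (Iio_mem_nhds one_pos)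
      filter_upwards [self_mem_nhdsWithin, this] with δ hδ hδ1
      refine ae_of_all _ fun η => ?_
      have hδ0 : (0 : ℝ) < δ := hδ
      have hη := freq_nonneg η
      rw [← ofReal_freq_pow, ← mul_assoc, ← ENNReal.ofReal_mul (by positivity), ← add_mul,
        ← ENNReal.ofReal_add (by positivity) (by positivity), ← mul_assoc,
        ← ENNReal.ofReal_mul (by positivity)]
      refine mul_le_mul' (ENNReal.ofReal_le_ofReal ?_) le_rfl
      refine le_trans ?_ (freq_sq_mul_one_add_rpow_le hη)
      refine mul_le_mul_of_nonneg_left (Real.rpow_le_rpow (by positivity) ?_ hm0) (sq_nonneg _)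
      nlinarith
    · have ht : ∀ᵐ η, a η ≠ ∞ ∨ freq η = 0 := by
        have h1 : ∀ᵐ η, efreq η ^ 2 * a η < ∞ :=
          ae_lt_top (by fun_prop) (ne_top_of_le_ne_top ENNReal.ofReal_ne_top h)
        filter_upwards [h1] with η h1
        by_cases hz : freq η = 0
        · exact Or.inr hz
        · left; intro hta
          have : efreq η ^ 2 ≠ 0 := pow_ne_zero 2 (by
            rw [efreq, ne_eq, ENNReal.ofReal_eq_zero, not_le]
            exact lt_of_le_of_ne (freq_nonneg η) (Ne.symm hz))
          rw [hta, ENNReal.mul_top this] at h1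
          exact h1.ne rfl
      filter_upwards [ht] with η ht
      rcases ht with ht | ht
      · have h1 : Tendsto (fun δ : ℝ => (1 + δ * freq η) ^ m) (𝓝[>] 0)
            (𝓝 ((1 + 0 * freq η) ^ m)) := by
          refine Tendsto.mono_left ?_ nhdsWithin_le_nhds
          refine ContinuousAt.tendsto (f := fun δ : ℝ => (1 + δ * freq η) ^ m) ?_
          exact ContinuousAt.rpow_const (by fun_prop) (Or.inr hm0)
        have h2 := (ENNReal.tendsto_ofReal h1)
        have h3 := ENNReal.Tendsto.mul_const h2 (Or.inr ht)
        have h4 := ENNReal.Tendsto.const_mul (a := efreq η ^ 2) h3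
          (Or.inr (ENNReal.pow_ne_top (efreq_ne_top η)))
        simpa using h4
      · simp [efreq, ht]
  have hlt : ∫⁻ η, efreq η ^ 2 * a η < ENNReal.ofReal (y₀ + r) :=
    h.trans_lt ((ENNReal.ofReal_lt_ofReal_iff (by linarith)).2 (by linarith))
  obtain ⟨δ, hδ, hδ0⟩ := ((hlim.eventually_lt_const hlt).and self_mem_nhdsWithin).exists
  exact ⟨δ, hδ0, hδ.le⟩

section Bounds

variable {a : E d → ℝ≥0∞} {ε : ℝ} {Y σ : ℝ≥0∞}

lemma exp_mul_majorant_le_majorant (hε : 0 ≤ ε) {t : ℝ} (ht : 0 ≤ t) (η : E d) :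
    ENNReal.ofReal (Real.exp (ε * t ^ (1 / 4 : ℝ) * freq η)) * majorant 1 1 a t η ≤
      majorant (ENNReal.ofReal (Real.exp ε)) (1 - ε) a t η := by
  simpa [weight] using ofReal_weight_mul_majorant_le (δ := 0) (m := 0) le_rfl le_rfl hε a ht η

/-- A bound of the weighted majorant that is uniform in time. -/
lemma weighted_majorant_le {s δ : ℝ} (hs : 0 ≤ s) (hδ : 0 < δ) (hε : 0 ≤ ε) (hε1 : ε ≤ 1)
    (ha : Measurable a) {t : ℝ} (ht : 0 ≤ t) (η : E d) :
    ENNReal.ofReal (freq η ^ s * Real.exp (ε * t ^ (1 / 4 : ℝ) * freq η)) *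
        majorant 1 1 a t η ≤
      {η : E d | freq η < 1}.indicator (majSup (ENNReal.ofReal (Real.exp ε)) (1 - ε) a) η +
      ENNReal.ofReal (δ⁻¹ ^ max (s - 2) 0) * (efreq η ^ 2 *
        majSup (ENNReal.ofReal (Real.exp ε)) (1 - ε)
          (fun η => ENNReal.ofReal ((1 + δ * freq η) ^ max (s - 2) 0) * a η) η) := by
  set m := max (s - 2) 0 with hm
  have hm0 : 0 ≤ m := le_max_right _ _
  have hη := freq_nonneg η
  by_cases h1 : freq η < 1
  · refine le_trans ?_ le_self_add
    rw [Set.indicator_of_mem (by exact h1)]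
    refine le_trans ?_ ((exp_mul_majorant_le_majorant hε ht η).trans
      (majorant_le_majSup ha (by linarith) ht η))
    refine mul_le_mul' (ENNReal.ofReal_le_ofReal ?_) le_rfl
    exact mul_le_of_le_one_left (Real.exp_nonneg _) (Real.rpow_le_one hη h1.le hs)
  · refine le_trans ?_ le_add_self
    have h1' : 1 ≤ freq η := not_lt.1 h1
    have ham : Measurable fun η : E d => ENNReal.ofReal ((1 + δ * freq η) ^ m) * a η := by fun_prop
    have key := (ofReal_weight_mul_majorant_le hδ.le hm0 hε a ht η).trans
      (majorant_le_majSup ham (by linarith) ht η)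
    refine le_trans ?_ (mul_le_mul' le_rfl (mul_le_mul' le_rfl key))
    rw [← ofReal_freq_pow, ← mul_assoc, ← mul_assoc, ← ENNReal.ofReal_mul (by positivity),
      ← ENNReal.ofReal_mul (by positivity)]
    refine mul_le_mul' (ENNReal.ofReal_le_ofReal ?_) le_rfl
    have e1 : freq η ^ s ≤ freq η ^ 2 * freq η ^ m := by
      rw [← Real.rpow_natCast, ← Real.rpow_add (by linarith)]
      refine Real.rpow_le_rpow_of_exponent_le h1' ?_
      have := le_max_left (s - 2) 0
      push_cast; linarith
    have e2 : freq η ^ m ≤ δ⁻¹ ^ m * (1 + δ * freq η) ^ m := by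
      rw [← Real.mul_rpow (by positivity) (by positivity)]
      refine Real.rpow_le_rpow hη ?_ hm0
      rw [mul_add, inv_mul_cancel_left₀ hδ.ne']
      have : 0 < δ⁻¹ := by positivity
      linarith
    calc _ ≤ (freq η ^ 2 * (δ⁻¹ ^ m * (1 + δ * freq η) ^ m)) *
          Real.exp (ε * t ^ (1 / 4 : ℝ) * freq η) := by
          gcongr
          exact e1.trans (by gcongr)
      _ = _ := by unfold weight; ring

lemma lintegral_uniform_bound_lt_top {δ s : ℝ}
    (hlow : LowFrequency (majSup (ENNReal.ofReal (Real.exp ε)) (1 - ε) a))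
    (hS : Subcritical (ENNReal.ofReal (Real.exp ε)) (1 - ε)
      (fun η => ENNReal.ofReal ((1 + δ * freq η) ^ max (s - 2) 0) * a η) Y σ)
    (ha : Measurable a) :
    ∫⁻ η : E d, ({η : E d | freq η < 1}.indicator
        (majSup (ENNReal.ofReal (Real.exp ε)) (1 - ε) a) η +
      ENNReal.ofReal (δ⁻¹ ^ max (s - 2) 0) * (efreq η ^ 2 *
        majSup (ENNReal.ofReal (Real.exp ε)) (1 - ε)
          (fun η => ENNReal.ofReal ((1 + δ * freq η) ^ max (s - 2) 0) * a η) η)) < ∞ := by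
  have hfin := hS.moment_majSup_lt_top
  have hm : Measurable (majSup (ENNReal.ofReal (Real.exp ε)) (1 - ε) a) := measurable_majSup ha
  obtain ⟨K, hK, hlow⟩ := hlow
  have h1 := hlow 1 one_pos
  generalize majSup (ENNReal.ofReal (Real.exp ε)) (1 - ε) a = M at *
  generalize majSup (ENNReal.ofReal (Real.exp ε)) (1 - ε)
    (fun η => ENNReal.ofReal ((1 + δ * freq η) ^ max (s - 2) 0) * a η) = N at *
  rw [lintegral_add_left (hm.indicator (measurableSet_freq_lt 1)),
    lintegral_indicator (measurableSet_freq_lt 1), lintegral_const_mul' _ _ ENNReal.ofReal_ne_top]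
  refine ENNReal.add_lt_top.2 ⟨lt_of_le_of_lt h1 ?_, ENNReal.mul_lt_top ENNReal.ofReal_lt_top hfin⟩
  exact ENNReal.mul_lt_top hK.lt_top ENNReal.ofReal_lt_top

lemma rpow_le_mul_exp {s b x : ℝ} (hs : 0 ≤ s) (hb : 0 < b) (hx : 0 ≤ x) :
    x ^ s ≤ ((s + 1) / b) ^ s * Real.exp (b * x) := by
  have h1 : x ≤ (s + 1) / b * Real.exp (b * x / (s + 1)) := by
    have := Real.add_one_le_exp (b * x / (s + 1))
    calc x = (s + 1) / b * (b * x / (s + 1)) := by field_simp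
      _ ≤ _ := by gcongr; linarith
  calc x ^ s ≤ ((s + 1) / b * Real.exp (b * x / (s + 1))) ^ s := Real.rpow_le_rpow hx h1 hs
    _ = ((s + 1) / b) ^ s * Real.exp (b * x / (s + 1) * s) := by
        rw [Real.mul_rpow (by positivity) (Real.exp_nonneg _), ← Real.exp_mul]
    _ ≤ _ := by
        refine mul_le_mul_of_nonneg_left (Real.exp_le_exp.2 ?_) (by positivity)
        rw [div_mul_eq_mul_div, div_le_iff₀ (by positivity)]
        nlinarith [mul_nonneg hb.le hx]

/-- The pointwise splitting behind the decay of the weighted norm: frequencies below `t^{-1/4}` are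
counted by the low-frequency bound, the others by the decaying second moment. -/
lemma weighted_majorant_le_split {s : ℝ} (hs : 0 ≤ s) (hε : 0 < ε) (hε1 : ε ≤ 1)
    (ha : Measurable a) {t : ℝ} (ht : 0 < t) (η : E d) :
    ENNReal.ofReal (freq η ^ s * Real.exp (ε / 2 * t ^ (1 / 4 : ℝ) * freq η)) *
        majorant 1 1 a t η ≤
      ENNReal.ofReal (t ^ (-s / 4)) * {η : E d | freq η < t ^ (-1 / 4 : ℝ)}.indicator
        (majSup (ENNReal.ofReal (Real.exp ε)) (1 - ε) a) η +
      ENNReal.ofReal (((s + 1) / (ε / 2)) ^ s * t ^ ((2 - s) / 4)) * (efreq η ^ 2 *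
        majorant (ENNReal.ofReal (Real.exp ε)) (1 - ε) a t η) := by
  have hη := freq_nonneg η
  have hq : 0 < t ^ (1 / 4 : ℝ) := by positivity
  have key := exp_mul_majorant_le_majorant (a := a) hε.le ht.le η
  by_cases h1 : freq η < t ^ (-1 / 4 : ℝ)
  · refine le_trans ?_ le_self_add
    rw [Set.indicator_of_mem (by exact h1)]
    refine le_trans ?_ (mul_le_mul' le_rfl (key.trans (majorant_le_majSup ha (by linarith) ht.le η)))
    rw [← mul_assoc, ← ENNReal.ofReal_mul (by positivity)]
    refine mul_le_mul' (ENNReal.ofReal_le_ofReal ?_) le_rfl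
    have e1 : freq η ^ s ≤ t ^ (-s / 4) := by
      refine (Real.rpow_le_rpow hη h1.le hs).trans (le_of_eq ?_)
      rw [← Real.rpow_mul ht.le]; ring_nf
    gcongr
    linarith
  · refine le_trans ?_ le_add_self
    refine le_trans ?_ (mul_le_mul' le_rfl (mul_le_mul' le_rfl key))
    have h1' := not_lt.1 h1
    rw [← ofReal_freq_pow, ← mul_assoc, ← mul_assoc, ← ENNReal.ofReal_mul (by positivity),
      ← ENNReal.ofReal_mul (by positivity)]
    refine mul_le_mul' (ENNReal.ofReal_le_ofReal ?_) le_rfl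
    set x := t ^ (1 / 4 : ℝ) * freq η with hx
    have hx1 : 1 ≤ x := by
      calc (1 : ℝ) = t ^ (1 / 4 : ℝ) * t ^ (-1 / 4 : ℝ) := by
            rw [← Real.rpow_add ht]; norm_num
        _ ≤ _ := by rw [hx]; gcongr
    have hfx : freq η = t ^ (-1 / 4 : ℝ) * x := by
      rw [hx, ← mul_assoc, ← Real.rpow_add ht]; norm_num
    have e1 : freq η ^ s = t ^ (-s / 4) * x ^ s := by
      rw [hfx, Real.mul_rpow (by positivity) (by positivity), ← Real.rpow_mul ht.le]
      ring_nf
    have e2 : t ^ ((2 - s) / 4) * freq η ^ 2 = t ^ (-s / 4) * x ^ 2 := by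
      rw [hfx, mul_pow, ← Real.rpow_natCast (t ^ (-1 / 4 : ℝ)), ← Real.rpow_mul ht.le, ← mul_assoc,
        ← Real.rpow_add ht]
      push_cast; ring_nf
    have e3 := rpow_le_mul_exp hs (half_pos hε) (zero_le_one.trans hx1)
    have e4 : 1 ≤ x ^ 2 := one_le_pow₀ hx1
    have e5 : Real.exp (ε * t ^ (1 / 4 : ℝ) * freq η) =
        Real.exp (ε / 2 * x) * Real.exp (ε / 2 * x) := by
      rw [← Real.exp_add, hx]; ring_nf
    have e6 : Real.exp (ε / 2 * t ^ (1 / 4 : ℝ) * freq η) = Real.exp (ε / 2 * x) := by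
      rw [hx]; ring_nf
    rw [e1, e5, e6]
    calc t ^ (-s / 4) * x ^ s * Real.exp (ε / 2 * x)
        ≤ t ^ (-s / 4) * (((s + 1) / (ε / 2)) ^ s * Real.exp (ε / 2 * x)) *
          Real.exp (ε / 2 * x) * x ^ 2 := by
          have h0 : 0 ≤ t ^ (-s / 4) * (((s + 1) / (ε / 2)) ^ s * Real.exp (ε / 2 * x)) *
            Real.exp (ε / 2 * x) := by positivity
          refine le_trans ?_ (le_mul_of_one_le_right h0 e4)
          gcongr
      _ = ((s + 1) / (ε / 2)) ^ s * (t ^ ((2 - s) / 4) * freq η ^ 2) *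
          (Real.exp (ε / 2 * x) * Real.exp (ε / 2 * x)) := by rw [e2]; ring
      _ = _ := by ring

lemma weighted_decay {s : ℝ} (hs : 0 ≤ s) (hε : 0 < ε) (hε1 : ε ≤ 1)
    (hS : Subcritical (ENNReal.ofReal (Real.exp ε)) (1 - ε) a Y σ)
    (hlow : LowFrequency (majSup (ENNReal.ofReal (Real.exp ε)) (1 - ε) a)) :
    ∃ C : ℝ, 0 ≤ C ∧ ∀ t : ℝ, 0 < t →
      ∫⁻ η : E d, ENNReal.ofReal (freq η ^ s * Real.exp (ε / 2 * t ^ (1 / 4 : ℝ) * freq η)) *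
        majorant 1 1 a t η ≤ ENNReal.ofReal (C * t ^ (-(s + d) / 4)) := by
  have ha := hS.measurable
  obtain ⟨C, hC, hdec⟩ := hS.moment_decay hlow
  obtain ⟨K, hK, hlow⟩ := hlow
  have hm : Measurable (majSup (ENNReal.ofReal (Real.exp ε)) (1 - ε) a) := measurable_majSup ha
  have hM : ∀ t, Measurable (majorant (ENNReal.ofReal (Real.exp ε)) (1 - ε) a t) := fun t =>
    measurable_comp_right (Q := majorant (ENNReal.ofReal (Real.exp ε)) (1 - ε) a)
      (measurable_majorant ha) t
  have hsplit := fun t (ht : 0 < t) η => weighted_majorant_le_split hs hε hε1 ha ht η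
  generalize majSup (ENNReal.ofReal (Real.exp ε)) (1 - ε) a = M at *
  generalize majorant (ENNReal.ofReal (Real.exp ε)) (1 - ε) a = V at *
  set D := ((s + 1) / (ε / 2)) ^ s with hD
  have hD0 : 0 ≤ D := by positivity
  refine ⟨K.toReal + D * C, by positivity, fun t ht => ?_⟩
  refine (lintegral_mono (hsplit t ht)).trans ?_
  have hVt := hM t
  rw [lintegral_add_left (Measurable.const_mul (hm.indicator (measurableSet_freq_lt _)) _),
    lintegral_const_mul' _ _ ENNReal.ofReal_ne_top, lintegral_const_mul' _ _ ENNReal.ofReal_ne_top,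
    lintegral_indicator (measurableSet_freq_lt _)]
  have hR : 0 < t ^ (-1 / 4 : ℝ) := by positivity
  have h1 := hlow _ hR
  have h2 := hdec t ht
  have e1 : t ^ (-s / 4) * (t ^ (-1 / 4 : ℝ)) ^ d = t ^ (-(s + d) / 4) := by
    rw [← Real.rpow_natCast, ← Real.rpow_mul ht.le, ← Real.rpow_add ht]; ring_nf
  have e2 : t ^ ((2 - s) / 4) * t ^ (-((2 + (d : ℝ)) / 4)) = t ^ (-(s + d) / 4) := by
    rw [← Real.rpow_add ht]; ring_nf
  calc _ ≤ ENNReal.ofReal (t ^ (-s / 4)) * (K * ENNReal.ofReal ((t ^ (-1 / 4 : ℝ)) ^ d)) +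
        ENNReal.ofReal (D * t ^ ((2 - s) / 4)) *
          ENNReal.ofReal (C * t ^ (-((2 + (d : ℝ)) / 4))) :=
        add_le_add (mul_le_mul' le_rfl h1) (mul_le_mul' le_rfl h2)
    _ = ENNReal.ofReal ((K.toReal + D * C) * t ^ (-(s + d) / 4)) := by
        rw [← ENNReal.ofReal_toReal hK, ← ENNReal.ofReal_mul (by positivity),
          ← ENNReal.ofReal_mul (by positivity), ← ENNReal.ofReal_mul (by positivity),
          ← ENNReal.ofReal_add (by positivity) (by positivity)]
        congr 1
        rw [ENNReal.toReal_ofReal (by positivity)]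
        linear_combination K.toReal * e1 + D * C * e2

end Bounds

/-- The majorant of the solution carries the analytic weight of radius `ν t^{1/4}`, with an
integrable bound that is uniform in time and with the decay of the linear flow. -/
theorem exists_analytic_bound {a : E d → ℝ≥0∞} (ha : Measurable a) {s y₀ : ℝ} (hs0 : 0 ≤ s)
    (hy₀ : 0 ≤ y₀) (hf : f₂ y₀ < 1) (h : ∫⁻ η, efreq η ^ 2 * a η ≤ ENNReal.ofReal y₀)
    (hs : ∫⁻ η, ENNReal.ofReal (freq η ^ s) * a η < ∞) (ha2 : ∫⁻ η, a η ^ 2 < ∞)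
    (hlow : LowFrequency a) :
    ∃ ν : ℝ, 0 < ν ∧
      (∃ B : E d → ℝ≥0∞, ∫⁻ η, B η < ∞ ∧ ∀ t : ℝ, 0 ≤ t → ∀ η,
        ENNReal.ofReal (freq η ^ s * Real.exp (ν * t ^ (1 / 4 : ℝ) * freq η)) *
          majorant 1 1 a t η ≤ B η) ∧
      ∃ C : ℝ, 0 < C ∧ ∀ t : ℝ, 0 ≤ t →
        ∫⁻ η, ENNReal.ofReal (freq η ^ s * Real.exp (ν * t ^ (1 / 4 : ℝ) * freq η)) *
          majorant 1 1 a t η ≤ ENNReal.ofReal (C * (1 + t) ^ (-(s + d) / 4)) := by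
  obtain ⟨ε, hε0, hε1, hε⟩ := exists_room hf
  obtain ⟨δ, hδ, hδm⟩ := exists_weight_moment_le ha (s := s) hy₀ hε0 h hs
  have hS1 := subcritical_of_room ha hy₀ hε0 hε1 hε
    (h.trans (ENNReal.ofReal_le_ofReal (by linarith)))
  have hS2 := subcritical_of_room (a := fun η : E d =>
    ENNReal.ofReal ((1 + δ * freq η) ^ max (s - 2) 0) * a η) (by fun_prop) hy₀ hε0 hε1 hε hδm
  have hlowS := hS1.lowFrequency_majSup ENNReal.ofReal_ne_top ha2 hlow
  obtain ⟨C, hC, hdec⟩ := weighted_decay hs0 hε0 hε1.le hS1 hlowS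
  obtain ⟨B, hB, hle⟩ : ∃ B : E d → ℝ≥0∞, ∫⁻ η, B η < ∞ ∧ ∀ t : ℝ, 0 ≤ t → ∀ η,
      ENNReal.ofReal (freq η ^ s * Real.exp (ε * t ^ (1 / 4 : ℝ) * freq η)) *
        majorant 1 1 a t η ≤ B η :=
    ⟨_, lintegral_uniform_bound_lt_top hlowS hS2 ha, fun t ht η =>
      weighted_majorant_le hs0 hδ hε0.le hε1.le ha ht η⟩
  generalize majorant 1 1 a = V at *
  have hle' : ∀ t : ℝ, 0 ≤ t → ∀ η,
      ENNReal.ofReal (freq η ^ s * Real.exp (ε / 2 * t ^ (1 / 4 : ℝ) * freq η)) * V t η ≤ B η := by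
    intro t ht η
    have hη := freq_nonneg η
    refine le_trans (mul_le_mul' (ENNReal.ofReal_le_ofReal ?_) le_rfl) (hle t ht η)
    gcongr
    linarith
  -- half of the admissible radius: the other half absorbs `|ξ|^s` at high frequencies
  refine ⟨ε / 2, by positivity, ⟨B, hB, hle'⟩, ?_⟩
  set q : ℝ := (s + d) / 4 with hq
  have hq0 : 0 ≤ q := by positivity
  have hneg : -(s + d) / 4 = -q := by rw [hq]; ring
  rw [hneg] at hdec ⊢
  set b := (∫⁻ η, B η).toReal with hb
  refine ⟨(b + C) * 2 ^ q + 1, by positivity, fun t ht => ?_⟩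
  have h1t : (1 + t) ^ (-q) = ((1 + t) ^ q)⁻¹ := Real.rpow_neg (by linarith) q
  rcases le_total t 1 with h1 | h1
  · calc _ ≤ ∫⁻ η, B η := lintegral_mono (hle' t ht)
      _ = ENNReal.ofReal b := (ENNReal.ofReal_toReal hB.ne).symm
      _ ≤ _ := by
        refine ENNReal.ofReal_le_ofReal ?_
        have h2 : (1 + t) ^ q ≤ 2 ^ q := Real.rpow_le_rpow (by linarith) (by linarith) hq0
        have h3 : 0 < (1 + t) ^ q := Real.rpow_pos_of_pos (by linarith) q
        rw [h1t, ← div_eq_mul_inv, le_div_iff₀ h3]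
        have hb0 : 0 ≤ b := ENNReal.toReal_nonneg
        have h4 : (1 : ℝ) ≤ 2 ^ q := Real.one_le_rpow (by norm_num) hq0
        nlinarith [mul_le_mul_of_nonneg_left h2 hb0, mul_nonneg hC (zero_le_one.trans h4)]
  · refine (hdec t (by linarith)).trans (ENNReal.ofReal_le_ofReal ?_)
    have h2 : (1 + t) ^ q ≤ 2 ^ q * t ^ q := by
      rw [← Real.mul_rpow (by norm_num) ht]
      exact Real.rpow_le_rpow (by linarith) (by linarith) hq0
    have h3 : 0 < (1 + t) ^ q := Real.rpow_pos_of_pos (by linarith) q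
    have h4 : 0 < t ^ q := Real.rpow_pos_of_pos (by linarith) q
    rw [h1t, Real.rpow_neg ht, ← div_eq_mul_inv, ← div_eq_mul_inv, div_le_div_iff₀ h4 h3]
    have hb0 : 0 ≤ b := ENNReal.toReal_nonneg
    have h5 : (0 : ℝ) ≤ 2 ^ q := by positivity
    nlinarith [mul_le_mul_of_nonneg_left h2 hC, mul_nonneg (mul_nonneg hb0 h5) h4.le]

/-! ### Duality and the Fourier transform of products -/

/-- The `L²` Fourier transform of a real-valued function, in Mathlib's normalization. -/
def ft (f : L2 d) : E d → ℂ := (𝓕 (toComplex f) : Lp ℂ 2 (volume : Measure (E d)))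

lemma coeFn_toComplex (f : L2 d) : ∀ᵐ x, toComplex f x = (f x : ℂ) := by
  filter_upwards [Complex.ofRealCLM.coeFn_compLp f] with x hx
  exact hx

lemma integral_mul_eq_integral_fourier_mul (f : Lp ℂ 2 (volume : Measure (E d))) (φ : 𝓢(E d, ℂ)) :
    ∫ x, f x * φ x = ∫ η, (𝓕 f : Lp ℂ 2 (volume : Measure (E d))) η * (𝓕⁻ φ) η := by
  have h := DFunLike.congr_fun (Lp.fourier_toTemperedDistribution_eq f) (𝓕⁻ φ)
  rw [TemperedDistribution.fourier_apply, Lp.toTemperedDistribution_apply,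
    Lp.toTemperedDistribution_apply, FourierTransform.fourier_fourierInv_eq] at h
  simpa only [smul_eq_mul, mul_comm] using h

lemma integral_mul_eq_integral_ft_mul (f : L2 d) (φ : 𝓢(E d, ℂ)) :
    ∫ x, (f x : ℂ) * φ x = ∫ η, ft f η * (𝓕⁻ φ) η := by
  rw [ft, ← integral_mul_eq_integral_fourier_mul]
  refine integral_congr_ae ?_
  filter_upwards [coeFn_toComplex f] with x hx
  rw [hx]

lemma integral_fourierInv_mul_schwartz {u : E d → ℂ} (hu : Integrable u) (φ : 𝓢(E d, ℂ)) :
    ∫ x, 𝓕⁻ u x * φ x = ∫ η, u η * (𝓕⁻ φ) η := by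
  have h := VectorFourier.integral_fourierIntegral_smul_eq_flip (e := Real.fourierChar)
    (L := innerₗ (E d)) (μ := volume) (ν := volume) Real.continuous_fourierChar continuous_inner
    (hu.comp_neg) φ.integrable
  rw [Real.fourierInv_eq_fourier_comp_neg]
  calc _ = ∫ x, u (-x) * 𝓕 (φ : E d → ℂ) x := by simpa using! h
    _ = ∫ x, u x * 𝓕 (φ : E d → ℂ) (-x) := by
        rw [← integral_neg_eq_self]; simp
    _ = _ := by
        refine integral_congr_ae (ae_of_all _ fun x => ?_)
        simp only
        rw [← Real.fourierInv_eq_fourier_neg, SchwartzMap.fourierInv_coe]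

lemma fourier_laplacian (φ : 𝓢(E d, ℂ)) (η : E d) :
    (𝓕 (Δ φ) : 𝓢(E d, ℂ)) η = -((freq η ^ 2 : ℝ) : ℂ) * (𝓕 φ) η := by
  rw [SchwartzMap.laplacian_eq_fourierMultiplierCLM, SchwartzMap.fourierMultiplierCLM_apply,
    ← FourierTransform.fourierInv_smul, FourierTransform.fourier_fourierInv_eq]
  rw [smul_apply, SchwartzMap.smulLeftCLM_apply_apply (by fun_prop)]
  simp only [freq, Complex.real_smul]
  push_cast; ring

lemma fourierInv_laplacian (φ : 𝓢(E d, ℂ)) (η : E d) :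
    (𝓕⁻ (Δ φ) : 𝓢(E d, ℂ)) η = -((freq η ^ 2 : ℝ) : ℂ) * (𝓕⁻ φ) η := by
  have h : ∀ ψ : 𝓢(E d, ℂ), (𝓕⁻ ψ) η = (𝓕 ψ) (-η) := fun ψ => by
    rw [SchwartzMap.fourierInv_coe, SchwartzMap.fourier_coe, Real.fourierInv_eq_fourier_neg]
  rw [h, h, fourier_laplacian, freq_neg]

lemma integral_laplacian (φ : 𝓢(E d, ℂ)) : ∫ x, (Δ φ) x = 0 := by
  have h := fourier_laplacian φ 0
  rw [SchwartzMap.fourier_coe, Real.fourier_eq] at h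
  simpa [freq] using h

lemma ae_eq_of_forall_integral_mul_schwartz {f g : E d → ℂ} (hf : LocallyIntegrable f)
    (hg : LocallyIntegrable g) (h : ∀ φ : 𝓢(E d, ℂ), (∀ x, (φ x).im = 0) →
      ∫ x, f x * φ x = ∫ x, g x * φ x) :
    f =ᵐ[volume] g := by
  refine ae_eq_of_integral_contDiff_smul_eq hf hg fun ψ hψ hψc => ?_
  have h1 : HasCompactSupport (Complex.ofRealCLM ∘ ψ) := hψc.comp_left rfl
  have h2 : ContDiff ℝ (↑(⊤ : ℕ∞)) (Complex.ofRealCLM ∘ ψ) := by fun_prop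
  have := h (h1.toSchwartzMap h2) (fun x => by simp)
  simpa [mul_comm] using this

lemma star_fourier_of_real (φ : 𝓢(E d, ℂ)) (hφ : ∀ x, (φ x).im = 0) (η : E d) :
    conj ((𝓕 φ) η) = (𝓕 φ) (-η) := by
  rw [SchwartzMap.fourier_coe, Real.fourier_eq', Real.fourier_eq', ← integral_conj]
  refine integral_congr_ae (ae_of_all _ fun x => ?_)
  simp only [smul_eq_mul, map_mul, ← Complex.exp_conj, Complex.conj_ofReal, Complex.conj_I,
    inner_neg_right]
  rw [Complex.conj_eq_iff_im.2 (hφ x)]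
  congr 2
  push_cast; ring

lemma Lp.locallyIntegrable_two (f : Lp ℂ 2 (volume : Measure (E d))) : LocallyIntegrable f :=
  (Lp.memLp f).locallyIntegrable (by norm_num)

/-- The Fourier transform of the complex conjugate. -/
lemma fourier_star (f : Lp ℂ 2 (volume : Measure (E d))) :
    ∀ᵐ η, (𝓕 (star f) : Lp ℂ 2 (volume : Measure (E d))) η =
      conj ((𝓕 f : Lp ℂ 2 (volume : Measure (E d))) (-η)) := by
  set F := (𝓕 f : Lp ℂ 2 (volume : Measure (E d))) with hF
  have hq : Measure.QuasiMeasurePreserving (fun x : E d => -x) volume volume :=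
    (Measure.measurePreserving_neg volume).quasiMeasurePreserving
  have hL : MemLp (fun η => conj (F (-η))) 2 (volume : Measure (E d)) :=
    ((Lp.memLp F).comp_measurePreserving (Measure.measurePreserving_neg volume)).star
  refine ae_eq_of_forall_integral_mul_schwartz (Lp.locallyIntegrable_two _)
    (hL.locallyIntegrable (by norm_num)) fun φ hφ => ?_
  have h1 := integral_mul_eq_integral_fourier_mul (star f) (𝓕 φ)
  have h2 := integral_mul_eq_integral_fourier_mul f (𝓕⁻ φ)
  rw [FourierTransform.fourierInv_fourier_eq] at h1
  rw [← h1]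
  have hneg : ∀ (ψ : 𝓢(E d, ℂ)) (η : E d), (𝓕⁻ ψ) η = (𝓕 ψ) (-η) := fun ψ η => by
    rw [SchwartzMap.fourierInv_coe, SchwartzMap.fourier_coe, Real.fourierInv_eq_fourier_neg]
  have h3 : ∀ η, (𝓕⁻ (𝓕⁻ φ)) η = φ (-η) := fun η => by
    rw [hneg, FourierTransform.fourier_fourierInv_eq]
  have h4 : ∫ x, (star f : Lp ℂ 2 (volume : Measure (E d))) x * (𝓕 φ) x =
      conj (∫ x, f x * (𝓕⁻ φ) x) := by
    rw [← integral_conj]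
    refine integral_congr_ae ?_
    filter_upwards [Lp.coeFn_star f] with x hx
    rw [hx, map_mul, hneg, ← star_fourier_of_real φ hφ, Complex.conj_conj]
    rfl
  rw [h4, h2, ← integral_conj, ← integral_neg_eq_self]
  refine integral_congr_ae (ae_of_all _ fun η => ?_)
  simp only
  rw [h3, map_mul, neg_neg, Complex.conj_eq_iff_im.2 (hφ η)]

lemma Lp.fourierInv_fourier (f : Lp ℂ 2 (volume : Measure (E d))) :
    (𝓕⁻ (𝓕 f : Lp ℂ 2 (volume : Measure (E d))) : Lp ℂ 2 (volume : Measure (E d))) = f :=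
  FourierTransform.fourierInv_fourier_eq f

lemma star_toComplex (f : L2 d) : star (toComplex f) = toComplex f := by
  refine Lp.ext ?_
  filter_upwards [Lp.coeFn_star (toComplex f), coeFn_toComplex f] with x h1 h2
  rw [h1, Pi.star_apply, h2]
  exact Complex.conj_ofReal _

lemma ft_hermitian (f : L2 d) : ∀ᵐ η, ft f η = conj (ft f (-η)) := by
  have := fourier_star (toComplex f)
  rwa [star_toComplex] at this

/-- A Hermitian square integrable function is the Fourier transform of a real function. -/
lemma exists_ft_eq {P : E d → ℂ} (hP : MemLp P 2) (hH : Hermitian P) :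
    ∃ f : L2 d, ft f =ᵐ[volume] P := by
  set g : Lp ℂ 2 (volume : Measure (E d)) := 𝓕⁻ hP.toLp with hg
  have hFg : 𝓕 g = hP.toLp := FourierTransform.fourier_fourierInv_eq _
  have hstar : star g = g := by
    have h1 : 𝓕 (star g) = 𝓕 g := by
      refine Lp.ext ?_
      have hq : Measure.QuasiMeasurePreserving (fun x : E d => -x) volume volume :=
        (Measure.measurePreserving_neg volume).quasiMeasurePreserving
      filter_upwards [fourier_star g, hq.ae hP.coeFn_toLp, hP.coeFn_toLp] with η h1 h2 h3
      rw [h1, hFg, h2, h3, hH η, Complex.conj_conj]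
    rw [← Lp.fourierInv_fourier (star g), h1, Lp.fourierInv_fourier]
  refine ⟨Complex.reCLM.compLp g, ?_⟩
  have hc : toComplex (Complex.reCLM.compLp g) = g := by
    refine Lp.ext ?_
    have h0 := Lp.coeFn_star g
    rw [hstar] at h0
    filter_upwards [coeFn_toComplex (Complex.reCLM.compLp g), Complex.reCLM.coeFn_compLp g, h0]
      with x h1 h2 h3
    rw [h1, h2]
    rw [Pi.star_apply] at h3
    exact Complex.conj_eq_iff_re.1 h3.symm
  rw [ft, hc, hFg]
  exact hP.coeFn_toLp

lemma ft_injective {f g : L2 d} (h : ft f =ᵐ[volume] ft g) : f = g := by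
  have h1 : (𝓕 (toComplex f) : Lp ℂ 2 (volume : Measure (E d))) = 𝓕 (toComplex g) := Lp.ext h
  have h2 : toComplex f = toComplex g := by
    rw [← Lp.fourierInv_fourier (toComplex f), h1, Lp.fourierInv_fourier]
  refine Lp.ext ?_
  have h3 := coeFn_toComplex f
  rw [h2] at h3
  filter_upwards [h3, coeFn_toComplex g] with x h3 h4
  rw [h4] at h3
  exact_mod_cast h3.symm

/-- Plancherel's theorem. -/
lemma enorm_sub_eq_lintegral (f g : L2 d) :
    ‖f - g‖ₑ ^ 2 = ∫⁻ η, ‖ft f η - ft g η‖ₑ ^ 2 := by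
  have h1 : ‖f - g‖ₑ = ‖toComplex f - toComplex g‖ₑ := by
    rw [Lp.enorm_def, Lp.enorm_def]
    refine eLpNorm_congr_enorm_ae ?_
    filter_upwards [coeFn_toComplex f, coeFn_toComplex g, Lp.coeFn_sub f g,
      Lp.coeFn_sub (toComplex f) (toComplex g)] with x h1 h2 h3 h4
    rw [h3, h4, Pi.sub_apply, Pi.sub_apply, h1, h2, ← Complex.ofReal_sub, ← ofReal_norm,
      ← ofReal_norm, Complex.norm_real]
  have h2 : ‖toComplex f - toComplex g‖ₑ =
      ‖(𝓕 (toComplex f) - 𝓕 (toComplex g) : Lp ℂ 2 (volume : Measure (E d)))‖ₑ := by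
    have h3 : (𝓕 (toComplex f) - 𝓕 (toComplex g) : Lp ℂ 2 (volume : Measure (E d))) =
        𝓕 (toComplex f - toComplex g) :=
      ((Lp.fourierTransformₗᵢ (E d) ℂ).map_sub (toComplex f) (toComplex g)).symm
    rw [h3, ← ofReal_norm, ← ofReal_norm, Lp.norm_fourier_eq]
  rw [h1, h2, Lp.enorm_def, eLpNorm_eq_lintegral_rpow_enorm_toReal (by norm_num) (by norm_num)]
  simp only [ENNReal.toReal_ofNat, ENNReal.rpow_ofNat, one_div]
  rw [← ENNReal.rpow_natCast, ← ENNReal.rpow_mul]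
  norm_num
  refine lintegral_congr_ae ?_
  filter_upwards [AEEqFun.coeFn_sub
    (𝓕 (toComplex f) : Lp ℂ 2 (volume : Measure (E d))).1 (𝓕 (toComplex g)).1] with x hx
  rw [hx]; rfl

section Exponential

variable {u : E d → ℂ}

lemma integrable_convPow (hu : Measurable u) (hi : Integrable u) (n : ℕ) :
    Integrable (convPow u n) := by
  refine ⟨(measurable_convPow hu n).aestronglyMeasurable, ?_⟩
  refine lt_of_le_of_lt (lintegral_mono fun x => enorm_convPow_le (fun x => le_rfl) n x) ?_
  rw [lintegral_lconvPow hu.enorm]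
  exact ENNReal.pow_lt_top hi.2

lemma fourierInv_convPow (hu : Measurable u) (hi : Integrable u) (n : ℕ) (x : E d) :
    𝓕⁻ (convPow u n) x = (𝓕⁻ u x) ^ (n + 1) := by
  induction n with
  | zero => simp [convPow]
  | succ n ih =>
    rw [pow_succ', ← ih, Real.fourierInv_eq_fourier_neg, Real.fourierInv_eq_fourier_neg,
      Real.fourierInv_eq_fourier_neg,
      ← Real.fourier_mul_convolution_eq hi (integrable_convPow hu hi n)]
    rfl

lemma integrable_convExp (hu : Measurable u) (hi : Integrable u) : Integrable (convExp u) := by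
  refine ⟨(measurable_convExp hu).aestronglyMeasurable, ?_⟩
  refine lt_of_le_of_lt (lintegral_mono fun x => enorm_convExp_le (fun x => le_rfl) x) ?_
  refine (lintegral_lconvExp_le hu.enorm).trans_lt ?_
  exact ENNReal.mul_lt_top (ef₂_ne_top hi.2.ne).lt_top hi.2

lemma fourierInv_convExp (hu : Measurable u) (hi : Integrable u) (x : E d) :
    𝓕⁻ (convExp u) x = ∑' n : ℕ, (𝓕⁻ u x) ^ (n + 2) / ((n + 2).factorial : ℂ) := by
  have hnorm : ∀ (n : ℕ) (η : E d), ‖Real.fourierChar (inner ℝ η x) •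
      (convPow u (n + 1) η / ((n + 2).factorial : ℂ))‖ₑ ≤
      lconvPow (fun η => ‖u η‖ₑ) (n + 1) η / ((n + 2).factorial : ℝ≥0∞) := fun n η => by
    rw [← ofReal_norm, Circle.norm_smul, ofReal_norm, enorm_div_factorial]
    exact ENNReal.div_le_div_right (enorm_convPow_le (fun _ => le_rfl) (n + 1) η) _
  have hsum : ∑' n : ℕ, ∫⁻ η : E d, ‖Real.fourierChar (inner ℝ η x) •
      (convPow u (n + 1) η / ((n + 2).factorial : ℂ))‖ₑ ≠ ∞ := by
    refine ne_top_of_le_ne_top ?_ (ENNReal.tsum_le_tsum fun n => lintegral_mono (hnorm n))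
    rw [← lintegral_tsum fun n => ((measurable_lconvPow hu.enorm (n + 1)).div_const _).aemeasurable]
    exact ((lintegral_lconvExp_le hu.enorm).trans_lt
      (ENNReal.mul_lt_top (ef₂_ne_top hi.2.ne).lt_top hi.2)).ne
  have hmeas : ∀ n : ℕ, AEStronglyMeasurable (fun η : E d => Real.fourierChar (inner ℝ η x) •
      (convPow u (n + 1) η / ((n + 2).factorial : ℂ))) := fun n => by
    have hm := measurable_convPow hu (n + 1)
    refine AEStronglyMeasurable.smul ?_ (hm.div_const _).aestronglyMeasurable
    exact Continuous.aestronglyMeasurable (by fun_prop)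
  have := integral_tsum hmeas hsum
  rw [Real.fourierInv_eq]
  simp only [Circle.smul_def, smul_eq_mul, tsum_mul_left] at this ⊢
  refine this.trans (tsum_congr fun n => ?_)
  rw [← fourierInv_convPow hu hi (n + 1), Real.fourierInv_eq, ← integral_div]
  simp only [Circle.smul_def, smul_eq_mul, mul_div_assoc]

lemma fourierInv_add {v : E d → ℂ} (hi : Integrable u) (hv : Integrable v) (x : E d) :
    𝓕⁻ (fun η => u η + v η) x = 𝓕⁻ u x + 𝓕⁻ v x := by
  simp only [Real.fourierInv_eq]
  rw [← integral_add]
  · simp only [smul_add]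
  · exact (Real.fourierIntegral_convergent_iff (V := E d) (-x)).2 hi |>.congr
      (ae_of_all _ fun η => by simp)
  · exact (Real.fourierIntegral_convergent_iff (V := E d) (-x)).2 hv |>.congr
      (ae_of_all _ fun η => by simp)

/-- The convolution exponential is the Fourier counterpart of the exponential. -/
lemma exp_fourierInv (hu : Measurable u) (hi : Integrable u) (x : E d) :
    Complex.exp (𝓕⁻ u x) = 1 + 𝓕⁻ (fun η => u η + convExp u η) x := by
  rw [fourierInv_add hi (integrable_convExp hu hi), fourierInv_convExp hu hi]
  generalize 𝓕⁻ u x = z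
  have h3 : HasSum (fun n : ℕ => z ^ n / (n.factorial : ℂ)) (Complex.exp z) := by
    rw [Complex.exp_eq_exp_ℂ]
    exact NormedSpace.expSeries_div_hasSum_exp z
  rw [((hasSum_nat_add_iff' 2).2 h3).tsum_eq]
  simp [Finset.sum_range_succ]
  ring

end Exponential

/-! ### Change of normalization -/

lemma lintegral_comp_scale (G : E d → ℝ≥0∞) :
    ∫⁻ ξ : E d, G ((2 * Real.pi)⁻¹ • ξ) = ENNReal.ofReal ((2 * Real.pi) ^ d) * ∫⁻ η, G η := by
  have hpi : (0 : ℝ) < 2 * Real.pi := by positivity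
  have hne : (2 * Real.pi)⁻¹ ≠ 0 := (inv_pos.2 hpi).ne'
  have h := lintegral_map_equiv (μ := (volume : Measure (E d))) G
    (Homeomorph.smulOfNeZero (2 * Real.pi)⁻¹ hne).toMeasurableEquiv
  have h2 : Measure.map (Homeomorph.smulOfNeZero (2 * Real.pi)⁻¹ hne).toMeasurableEquiv
      (volume : Measure (E d)) = ENNReal.ofReal ((2 * Real.pi) ^ d) • volume := by
    have := Measure.map_addHaar_smul (volume : Measure (E d)) hne
    rw [finrank_euclideanSpace_fin, ← inv_pow, inv_inv, abs_of_pos (by positivity)] at this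
    exact this
  rw [h2, lintegral_smul_measure] at h
  exact h.symm

/-- The constant relating integrals of `hat` and of `ft`: the Jacobian `(2π)^d` of `ξ = 2πη` times the
factor `(2π)^{-d/2}` of `hat`. -/
def scaleConst (d : ℕ) : ℝ≥0∞ := ENNReal.ofReal ((2 * Real.pi) ^ ((d : ℝ) / 2))

lemma one_le_two_pi : 1 ≤ 2 * Real.pi := by linarith [Real.pi_gt_three]

lemma one_le_scaleConst : 1 ≤ scaleConst d := by
  rw [scaleConst, ENNReal.one_le_ofReal]
  exact Real.one_le_rpow one_le_two_pi (by positivity)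

lemma scaleConst_ne_top : scaleConst d ≠ ∞ := ENNReal.ofReal_ne_top

lemma freq_scale (ξ : E d) : freq ((2 * Real.pi)⁻¹ • ξ) = ‖ξ‖ := by
  have hpi : (0 : ℝ) < 2 * Real.pi := by positivity
  rw [freq, norm_smul, Real.norm_of_nonneg (inv_pos.2 hpi).le, mul_inv_cancel_left₀ hpi.ne']

lemma lintegral_scaled (G : E d → ℝ≥0∞) :
    ∫⁻ ξ : E d, ENNReal.ofReal ((2 * Real.pi) ^ (-(d : ℝ) / 2)) * G ((2 * Real.pi)⁻¹ • ξ) =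
      scaleConst d * ∫⁻ η, G η := by
  have hpi : (0 : ℝ) < 2 * Real.pi := by positivity
  rw [lintegral_const_mul' _ _ ENNReal.ofReal_ne_top, lintegral_comp_scale, ← mul_assoc,
    ← ENNReal.ofReal_mul (by positivity), scaleConst, ← Real.rpow_natCast, ← Real.rpow_add hpi]
  congr 3; ring

lemma enorm_hat (f : L2 d) (ξ : E d) : ‖hat f ξ‖ₑ =
    ENNReal.ofReal ((2 * Real.pi) ^ (-(d : ℝ) / 2)) * ‖ft f ((2 * Real.pi)⁻¹ • ξ)‖ₑ := by
  rw [hat, enorm_mul, ← ofReal_norm (((_ : ℝ) : ℂ)), Complex.norm_real, Real.norm_of_nonneg (by positivity)]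
  rfl

lemma lintegral_mul_hat (g : ℝ → ℝ≥0∞) (f : L2 d) :
    ∫⁻ ξ : E d, g ‖ξ‖ * ‖hat f ξ‖ₑ = scaleConst d * ∫⁻ η, g (freq η) * ‖ft f η‖ₑ := by
  rw [← lintegral_scaled]
  refine lintegral_congr fun ξ => ?_
  rw [enorm_hat, freq_scale]; ring

lemma sNorm_eq (s : ℝ) (f : L2 d) :
    sNorm s f = scaleConst d * ∫⁻ η, ENNReal.ofReal (freq η ^ s) * ‖ft f η‖ₑ :=
  lintegral_mul_hat (fun r => ENNReal.ofReal (r ^ s)) f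

lemma sNorm_natCast (n : ℕ) (f : L2 d) :
    sNorm n f = scaleConst d * ∫⁻ η, efreq η ^ n * ‖ft f η‖ₑ := by
  rw [sNorm_eq]
  simp only [Real.rpow_natCast, ofReal_freq_pow]

lemma analyticWeight_eq (s ν : ℝ) (f : L2 d) (ξ : E d) : analyticWeight s ν f ξ =
    (((2 * Real.pi) ^ (-(d : ℝ) / 2) : ℝ) : ℂ) *
      ((freq ((2 * Real.pi)⁻¹ • ξ) ^ s * Real.exp (ν * freq ((2 * Real.pi)⁻¹ • ξ)) : ℝ) *
        ft f ((2 * Real.pi)⁻¹ • ξ)) := by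
  rw [freq_scale, analyticWeight, hat, ft]
  ring

lemma analyticNorm_eq (s ν : ℝ) (f : L2 d) : analyticNorm s ν f =
    scaleConst d * ∫⁻ η, ENNReal.ofReal (freq η ^ s * Real.exp (ν * freq η)) * ‖ft f η‖ₑ := by
  rw [← lintegral_scaled, analyticNorm]
  refine lintegral_congr fun ξ => ?_
  have := freq_nonneg ((2 * Real.pi)⁻¹ • ξ)
  rw [analyticWeight_eq, enorm_mul, enorm_mul, ← ofReal_norm (((_ : ℝ) : ℂ)), Complex.norm_real,
    Real.norm_of_nonneg (by positivity), ← ofReal_norm (((_ : ℝ) : ℂ)), Complex.norm_real,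
    Real.norm_of_nonneg (by positivity)]

lemma lintegral_analyticWeight_sub (s ν ν' : ℝ) (f g : L2 d) :
    ∫⁻ ξ, ‖analyticWeight s ν f ξ - analyticWeight s ν' g ξ‖ₑ = scaleConst d * ∫⁻ η,
      ‖((freq η ^ s * Real.exp (ν * freq η) : ℝ) : ℂ) * ft f η -
        ((freq η ^ s * Real.exp (ν' * freq η) : ℝ) : ℂ) * ft g η‖ₑ := by
  rw [← lintegral_scaled]
  refine lintegral_congr fun ξ => ?_
  rw [analyticWeight_eq, analyticWeight_eq, ← mul_sub, enorm_mul, ← ofReal_norm (((_ : ℝ) : ℂ)),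
    Complex.norm_real, Real.norm_of_nonneg (by positivity)]

lemma lintegral_shell_le {a : E d → ℝ≥0∞} {B : ℝ≥0∞} (k : ℤ)
    (h : ∫⁻ ξ in shell d k, ENNReal.ofReal (‖ξ‖ ^ (-(d : ℝ))) * a ξ ≤ B) :
    ∫⁻ ξ in shell d k, a ξ ≤ ENNReal.ofReal (((2 : ℝ) ^ k) ^ d) * B := by
  have hm : MeasurableSet (shell d k) :=
    (measurableSet_le measurable_const measurable_norm).inter
      (measurableSet_lt measurable_norm measurable_const)
  refine le_trans ?_ (mul_le_mul' le_rfl h)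
  rw [← lintegral_const_mul' _ _ ENNReal.ofReal_ne_top]
  refine setLIntegral_mono' hm fun ξ hξ => ?_
  have hpos : 0 < ‖ξ‖ := lt_of_lt_of_le (by positivity) hξ.1
  rw [← mul_assoc, ← ENNReal.ofReal_mul (by positivity)]
  refine le_mul_of_one_le_left' ?_
  rw [ENNReal.one_le_ofReal, Real.rpow_neg hpos.le, Real.rpow_natCast, ← div_eq_mul_inv,
    one_le_div (by positivity)]
  exact pow_le_pow_left₀ hpos.le hξ.2.le d

/-- Summing over dyadic shells turns the Besov-type bound into a bound of the mass of balls. -/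
lemma lintegral_ball_le [NeZero d] {a : E d → ℝ≥0∞} {B : ℝ≥0∞}
    (h : ∀ k : ℤ, ∫⁻ ξ in shell d k, ENNReal.ofReal (‖ξ‖ ^ (-(d : ℝ))) * a ξ ≤ B) {R : ℝ}
    (hR : 0 < R) :
    ∫⁻ ξ in {ξ : E d | ‖ξ‖ < R}, a ξ ≤ 2 * ENNReal.ofReal (2 ^ d) * B * ENNReal.ofReal (R ^ d) := by
  obtain ⟨k, hk1, hk2⟩ := exists_mem_Ico_zpow hR (one_lt_two (α := ℝ))
  have hsub : {ξ : E d | ‖ξ‖ < R} ⊆ {0} ∪ ⋃ j : ℕ, shell d (k + 1 - j) := by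
    intro ξ hξ
    by_cases h0 : ξ = 0
    · exact Or.inl h0
    right
    obtain ⟨m, hm1, hm2⟩ := exists_mem_Ico_zpow (norm_pos_iff.2 h0) (one_lt_two (α := ℝ))
    have hlt : (2 : ℝ) ^ m < 2 ^ (k + 1) := hm1.trans_lt (hξ.trans hk2)
    have hmk : m < k + 1 := (zpow_lt_zpow_iff_right₀ one_lt_two).1 hlt
    refine Set.mem_iUnion.2 ⟨(k - m).toNat, ?_⟩
    have e : k + 1 - ((k - m).toNat : ℤ) = m + 1 := by omega
    rw [e]
    exact ⟨by simpa using hm1, hm2⟩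
  have : Nontrivial (E d) := by
    have : Nonempty (Fin d) := ⟨0⟩
    infer_instance
  calc _ ≤ ∫⁻ ξ in {0} ∪ ⋃ j : ℕ, shell d (k + 1 - j), a ξ := lintegral_mono_set hsub
    _ ≤ (∫⁻ ξ in {0}, a ξ) + ∫⁻ ξ in ⋃ j : ℕ, shell d (k + 1 - j), a ξ := lintegral_union_le _ _ _
    _ = ∫⁻ ξ in ⋃ j : ℕ, shell d (k + 1 - j), a ξ := by
        rw [setLIntegral_measure_zero _ _ (by simp), zero_add]
    _ ≤ ∑' j : ℕ, ∫⁻ ξ in shell d (k + 1 - j), a ξ := lintegral_iUnion_le _ _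
    _ ≤ ∑' j : ℕ, ENNReal.ofReal (((2 : ℝ) ^ (k + 1)) ^ d) * B * (2⁻¹) ^ j := by
        refine ENNReal.tsum_le_tsum fun j => (lintegral_shell_le _ (h _)).trans ?_
        rw [mul_right_comm]
        refine mul_le_mul' ?_ le_rfl
        rw [show ((2 : ℝ≥0∞)⁻¹) ^ j = ENNReal.ofReal ((2⁻¹) ^ j) by
          rw [ENNReal.ofReal_pow (by norm_num), ENNReal.ofReal_inv_of_pos (by norm_num)]; norm_num,
          ← ENNReal.ofReal_mul (by positivity)]
        refine ENNReal.ofReal_le_ofReal ?_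
        rw [zpow_sub₀ (by norm_num), zpow_natCast, div_pow, div_eq_mul_inv]
        refine mul_le_mul_of_nonneg_left ?_ (by positivity)
        rw [inv_pow]
        gcongr
        exact le_self_pow₀ (one_le_pow₀ one_le_two) (NeZero.ne d)
    _ = ENNReal.ofReal (((2 : ℝ) ^ (k + 1)) ^ d) * B * 2 := by
        rw [ENNReal.tsum_mul_left, ENNReal.tsum_geometric, ENNReal.one_sub_inv_two, inv_inv]
    _ ≤ ENNReal.ofReal (2 ^ d * R ^ d) * B * 2 := by
        gcongr
        rw [← mul_pow]
        refine pow_le_pow_left₀ (by positivity) ?_ d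
        rw [zpow_add₀ (by norm_num), zpow_one]
        linarith
    _ = _ := by rw [ENNReal.ofReal_mul (by positivity)]; ring

lemma lowFrequency_of_besovNorm [NeZero d] {f : L2 d} (h : besovNorm (-(d : ℝ)) f < ∞) :
    LowFrequency fun η => ‖ft f η‖ₑ := by
  refine ⟨2 * ENNReal.ofReal (2 ^ d) * besovNorm (-(d : ℝ)) f, by finiteness, fun R hR => ?_⟩
  have h1 := lintegral_ball_le (a := fun ξ => ‖hat f ξ‖ₑ) (B := besovNorm (-(d : ℝ)) f)
    (fun k => le_iSup (fun k : ℤ => ∫⁻ ξ in shell d k,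
      ENNReal.ofReal (‖ξ‖ ^ (-(d : ℝ))) * ‖hat f ξ‖ₑ) k) hR
  refine le_trans ?_ h1
  rw [← lintegral_indicator (measurableSet_freq_lt R),
    ← lintegral_indicator (measurableSet_lt measurable_norm measurable_const)]
  have h2 := lintegral_mul_hat (Set.indicator (Set.Iio R) 1) f
  have e1 : ∀ ξ : E d, {ξ : E d | ‖ξ‖ < R}.indicator (fun ξ => ‖hat f ξ‖ₑ) ξ =
      Set.indicator (Set.Iio R) 1 ‖ξ‖ * ‖hat f ξ‖ₑ := fun ξ => by
    by_cases h : ‖ξ‖ < R <;> simp [Set.indicator, h]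
  have e2 : ∀ η : E d, {η : E d | freq η < R}.indicator (fun η => ‖ft f η‖ₑ) η =
      Set.indicator (Set.Iio R) 1 (freq η) * ‖ft f η‖ₑ := fun ξ => by
    by_cases h : freq ξ < R <;> simp [Set.indicator, h]
  simp_rw [e1, e2, h2]
  exact le_mul_of_one_le_left' one_le_scaleConst

/-! ### The equation on the Fourier side -/

section Weak

variable {f : L2 d} {P : E d → ℂ}

lemma integrable_lapl (hP : Measurable P) (hfin : ∫⁻ η, efreq η ^ 2 * ‖P η‖ₑ < ∞) :
    Integrable (lapl P) := by
  refine ⟨(measurable_lapl hP).aestronglyMeasurable, ?_⟩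
  simpa only [HasFiniteIntegral, enorm_lapl] using hfin

lemma integral_mul_laplacian (hP : Measurable P) (hfP : ft f =ᵐ[volume] P)
    (hfin : ∫⁻ η, efreq η ^ 2 * ‖P η‖ₑ < ∞) (φ : 𝓢(E d, ℂ)) :
    ∫ x, (f x : ℂ) * (Δ φ) x = ∫ x, -𝓕⁻ (lapl P) x * φ x := by
  rw [integral_mul_eq_integral_ft_mul]
  simp only [neg_mul]
  rw [integral_neg, integral_fourierInv_mul_schwartz (integrable_lapl hP hfin), ← integral_neg]
  refine integral_congr_ae ?_
  filter_upwards [hfP] with η hη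
  rw [hη, fourierInv_laplacian, lapl]; ring

lemma continuous_fourierInv {u : E d → ℂ} (hu : Integrable u) : Continuous (𝓕⁻ u) := by
  have h := VectorFourier.fourierIntegral_continuous (L := innerₗ (E d)) (μ := volume)
    Real.continuous_fourierChar continuous_inner hu
  have : 𝓕⁻ u = fun x => 𝓕 u (-x) := funext fun x => Real.fourierInv_eq_fourier_neg u x
  rw [this]
  exact h.comp continuous_neg

/-- The weak Laplacian of a function is determined almost everywhere by its Fourier transform. -/
lemma IsWeakLaplacian.ae_eq {w : E d → ℝ} (h : IsWeakLaplacian f w) (hP : Measurable P)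
    (hfP : ft f =ᵐ[volume] P) (hfin : ∫⁻ η, efreq η ^ 2 * ‖P η‖ₑ < ∞) :
    ∀ᵐ x, (w x : ℂ) = -𝓕⁻ (lapl P) x := by
  refine ae_eq_of_forall_integral_mul_schwartz ?_
    (continuous_fourierInv (integrable_lapl hP hfin)).neg.locallyIntegrable fun φ _ => ?_
  · have : MemLp (fun x => (w x : ℂ)) ∞ (volume : Measure (E d)) := h.1.ofReal
    exact this.locallyIntegrable le_top
  · rw [h.2 φ, integral_mul_laplacian hP hfP hfin]

lemma fourierInv_conj_of_hermitian {u : E d → ℂ} (hu : Hermitian u) (x : E d) :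
    conj (𝓕⁻ u x) = 𝓕⁻ u x := by
  rw [Real.fourierInv_eq', ← integral_conj, ← integral_neg_eq_self]
  refine integral_congr_ae (ae_of_all _ fun y => ?_)
  simp only [smul_eq_mul, map_mul, ← Complex.exp_conj, Complex.conj_ofReal, Complex.conj_I,
    inner_neg_left, hu y, Complex.conj_conj]
  congr 2
  push_cast; ring

lemma isWeakLaplacian_fourierInv (hP : Measurable P) (hH : Hermitian P) (hfP : ft f =ᵐ[volume] P)
    (hfin : ∫⁻ η, efreq η ^ 2 * ‖P η‖ₑ < ∞) :
    IsWeakLaplacian f fun x => -(𝓕⁻ (lapl P) x).re := by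
  have hi := integrable_lapl hP hfin
  have hc := continuous_fourierInv hi
  refine ⟨memLp_top_of_bound (Continuous.aestronglyMeasurable (by fun_prop)) (∫ η, ‖lapl P η‖)
    (ae_of_all _ fun x => ?_), fun φ => ?_⟩
  · rw [norm_neg]
    refine (Complex.abs_re_le_norm _).trans ?_
    rw [Real.fourierInv_eq]
    refine (norm_integral_le_integral_norm _).trans (le_of_eq ?_)
    simp only [Circle.norm_smul]
  · rw [integral_mul_laplacian hP hfP hfin]
    refine integral_congr_ae (ae_of_all _ fun x => ?_)
    simp only
    have := Complex.conj_eq_iff_re.1 (fourierInv_conj_of_hermitian (hermitian_lapl hH) x)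
    rw [Complex.ofReal_neg, this]

/-- The nonlinearity of the equation, tested against `Δφ`, on the Fourier side. -/
lemma integral_exp_neg_mul_laplacian {w : E d → ℝ} {u : E d → ℂ} (hu : Measurable u)
    (hi : Integrable u) (hw : ∀ᵐ x, (w x : ℂ) = -𝓕⁻ u x) (φ : 𝓢(E d, ℂ)) :
    ∫ x, (Real.exp (-w x) : ℂ) * (Δ φ) x =
      -∫ η, ((freq η ^ 2 : ℝ) : ℂ) * (u η + convExp u η) * (𝓕⁻ φ) η := by
  have hi2 : Integrable fun η => u η + convExp u η := hi.add (integrable_convExp hu hi)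
  have e1 : ∫ x, (Real.exp (-w x) : ℂ) * (Δ φ) x =
      ∫ x, ((Δ φ) x + 𝓕⁻ (fun η => u η + convExp u η) x * (Δ φ) x) := by
    refine integral_congr_ae ?_
    filter_upwards [hw] with x hx
    rw [Complex.ofReal_exp, Complex.ofReal_neg, hx, neg_neg, exp_fourierInv hu hi]; ring
  have hb : Integrable fun x => 𝓕⁻ (fun η => u η + convExp u η) x * (Δ φ) x := by
    refine (Δ φ).integrable.bdd_mul (c := ∫ η, ‖u η + convExp u η‖)
      (continuous_fourierInv hi2).aestronglyMeasurable (ae_of_all _ fun x => ?_)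
    rw [Real.fourierInv_eq]
    refine (norm_integral_le_integral_norm _).trans (le_of_eq ?_)
    simp only [Circle.norm_smul]
  rw [e1, integral_add (Δ φ).integrable hb, integral_laplacian, zero_add,
    integral_fourierInv_mul_schwartz hi2, ← integral_neg]
  refine integral_congr_ae (ae_of_all _ fun η => ?_)
  simp only
  rw [fourierInv_laplacian]; ring

end Weak

/-! ### The weak formulation on the Fourier side -/

/-- The Fourier transform of `e^{-Δh} - 1` when `P` is that of `h`. -/
def nonlin (P : E d → ℂ) (η : E d) : ℂ := lapl P η + convExp (lapl P) η

section Fubini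

variable {P : ℝ → E d → ℂ} {Y : ℝ≥0∞} {t : ℝ}

lemma measurable_nonlin (hP : Measurable fun p : ℝ × E d => P p.1 p.2) :
    Measurable fun p : ℝ × E d => nonlin (P p.1) p.2 :=
  (measurable_lapl_param hP).add (measurable_convExp_lapl hP)

lemma lintegral_nonlin_le {Q : E d → ℂ} (hQ : Measurable Q)
    (hY : ∫⁻ η, efreq η ^ 2 * ‖Q η‖ₑ ≤ Y) : ∫⁻ η, ‖nonlin Q η‖ₑ ≤ Y + ef₂ Y * Y := by
  have hl : ∫⁻ η, ‖lapl Q η‖ₑ ≤ Y := by simpa only [enorm_lapl] using hY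
  calc _ ≤ ∫⁻ η, (‖lapl Q η‖ₑ + ‖convExp (lapl Q) η‖ₑ) := lintegral_mono fun η => enorm_add_le _ _
    _ = (∫⁻ η, ‖lapl Q η‖ₑ) + ∫⁻ η, ‖convExp (lapl Q) η‖ₑ :=
        lintegral_add_left (measurable_lapl hQ).enorm _
    _ ≤ Y + ef₂ Y * Y := by
        refine add_le_add hl ?_
        calc _ ≤ ∫⁻ η, lconvExp (fun η => ‖lapl Q η‖ₑ) η :=
              lintegral_mono fun η => enorm_convExp_le (fun _ => le_rfl) η
          _ ≤ _ := lintegral_lconvExp_le (measurable_lapl hQ).enorm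
          _ ≤ _ := mul_le_mul' (ef₂_mono hl) hl

lemma integrable_nonlin (hP : Measurable fun p : ℝ × E d => P p.1 p.2) (hYt : Y ≠ ∞)
    (hY : ∀ τ, 0 ≤ τ → ∫⁻ η, efreq η ^ 2 * ‖P τ η‖ₑ ≤ Y) :
    Integrable (fun p : ℝ × E d => nonlin (P p.1) p.2)
      ((volume.restrict (Set.Ioc 0 t)).prod volume) := by
  have hm := measurable_nonlin hP
  refine ⟨hm.aestronglyMeasurable, ?_⟩
  rw [HasFiniteIntegral, lintegral_prod _ hm.enorm.aemeasurable]
  calc _ ≤ ∫⁻ _ in Set.Ioc 0 t, (Y + ef₂ Y * Y) :=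
        setLIntegral_mono' measurableSet_Ioc fun τ hτ =>
          lintegral_nonlin_le (measurable_comp_right hP τ) (hY τ hτ.1.le)
    _ < ∞ := by
        rw [setLIntegral_const]
        have := ef₂_ne_top hYt
        exact ENNReal.mul_lt_top (by finiteness) (by simp)

lemma exists_freq_sq_mul_schwartz_le (φ : 𝓢(E d, ℂ)) :
    ∃ K : ℝ, ∀ η : E d, ‖((freq η ^ 2 : ℝ) : ℂ) * (𝓕⁻ φ) η‖ ≤ K := by
  obtain ⟨K, _, hK⟩ := (𝓕⁻ (Δ φ) : 𝓢(E d, ℂ)).decay 0 0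
  refine ⟨K, fun η => ?_⟩
  have := hK η
  rw [pow_zero, one_mul, norm_iteratedFDeriv_zero, fourierInv_laplacian, neg_mul, norm_neg] at this
  exact this

lemma integrable_nonlin_mul_schwartz (hP : Measurable fun p : ℝ × E d => P p.1 p.2) (hYt : Y ≠ ∞)
    (hY : ∀ τ, 0 ≤ τ → ∫⁻ η, efreq η ^ 2 * ‖P τ η‖ₑ ≤ Y) (φ : 𝓢(E d, ℂ)) :
    Integrable (fun p : ℝ × E d => ((freq p.2 ^ 2 : ℝ) : ℂ) * nonlin (P p.1) p.2 * (𝓕⁻ φ) p.2)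
      ((volume.restrict (Set.Ioc 0 t)).prod volume) := by
  obtain ⟨K, hK⟩ := exists_freq_sq_mul_schwartz_le φ
  have h := (integrable_nonlin (t := t) hP hYt hY).bdd_mul (c := K)
    (f := fun p : ℝ × E d => ((freq p.2 ^ 2 : ℝ) : ℂ) * (𝓕⁻ φ) p.2)
    (Measurable.aestronglyMeasurable (by
      have := (𝓕⁻ φ).continuous.measurable
      fun_prop)) (ae_of_all _ fun p => hK p.2)
  exact h.congr (ae_of_all _ fun p => by simp only; ring)

lemma integral_nonlin_swap (hP : Measurable fun p : ℝ × E d => P p.1 p.2) (hYt : Y ≠ ∞)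
    (hY : ∀ τ, 0 ≤ τ → ∫⁻ η, efreq η ^ 2 * ‖P τ η‖ₑ ≤ Y) (φ : 𝓢(E d, ℂ)) :
    ∫ τ in Set.Ioc 0 t, ∫ η, ((freq η ^ 2 : ℝ) : ℂ) * nonlin (P τ) η * (𝓕⁻ φ) η =
      ∫ η, (∫ τ in Set.Ioc 0 t, ((freq η ^ 2 : ℝ) : ℂ) * nonlin (P τ) η) * (𝓕⁻ φ) η := by
  rw [integral_integral_swap (integrable_nonlin_mul_schwartz hP hYt hY φ)]
  refine integral_congr_ae (ae_of_all _ fun η => ?_)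
  simp only
  rw [integral_mul_const]

end Fubini

/-- If every `w τ` is the Laplacian of the function with Fourier transform `P τ`, the weak equation
is the equation for `P`, tested against `𝓕⁻ φ`. -/
lemma integral_time_exp_laplacian {P : ℝ → E d → ℂ} {Y : ℝ≥0∞} {w : ℝ → E d → ℝ}
    (hP : Measurable fun p : ℝ × E d => P p.1 p.2) (hYt : Y ≠ ∞)
    (hY : ∀ τ, 0 ≤ τ → ∫⁻ η, efreq η ^ 2 * ‖P τ η‖ₑ ≤ Y)
    (hw : ∀ τ, 0 ≤ τ → ∀ᵐ x, (w τ x : ℂ) = -𝓕⁻ (lapl (P τ)) x) (φ : 𝓢(E d, ℂ)) {t : ℝ}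
    (ht : 0 ≤ t) :
    IntervalIntegrable (fun τ : ℝ => ∫ x, (Real.exp (-w τ x) : ℂ) * (Δ φ) x) volume 0 t ∧
      ∫ τ in (0 : ℝ)..t, ∫ x, (Real.exp (-w τ x) : ℂ) * (Δ φ) x =
        -∫ η, (∫ τ in Set.Ioc 0 t, ((freq η ^ 2 : ℝ) : ℂ) * nonlin (P τ) η) * (𝓕⁻ φ) η := by
  have e : ∀ τ ∈ Set.Ioc 0 t, ∫ x, (Real.exp (-w τ x) : ℂ) * (Δ φ) x =
      -∫ η, ((freq η ^ 2 : ℝ) : ℂ) * nonlin (P τ) η * (𝓕⁻ φ) η := fun τ hτ =>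
    integral_exp_neg_mul_laplacian (measurable_lapl (measurable_comp_right hP τ))
      (integrable_lapl (measurable_comp_right hP τ) ((hY τ hτ.1.le).trans_lt hYt.lt_top))
      (hw τ hτ.1.le) φ
  constructor
  · rw [intervalIntegrable_iff, Set.uIoc_of_le ht]
    have hI : IntegrableOn (fun τ => -∫ η, ((freq η ^ 2 : ℝ) : ℂ) * nonlin (P τ) η * (𝓕⁻ φ) η)
        (Set.Ioc 0 t) :=
      (integrable_nonlin_mul_schwartz hP hYt hY φ).integral_prod_left.neg
    exact hI.congr_fun (fun τ hτ => (e τ hτ).symm) measurableSet_Ioc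
  · rw [intervalIntegral.integral_of_le ht, setIntegral_congr_fun measurableSet_Ioc e, integral_neg,
      integral_nonlin_swap hP hYt hY]

/-! ### Existence -/

lemma measurable_ft (f : L2 d) : Measurable (ft f) :=
  (Lp.stronglyMeasurable (𝓕 (toComplex f) : Lp ℂ 2 (volume : Measure (E d)))).measurable

lemma lintegral_sq_ft_lt_top (f : L2 d) : ∫⁻ η, ‖ft f η‖ₑ ^ 2 < ∞ := by
  have := Lp.eLpNorm_lt_top (𝓕 (toComplex f) : Lp ℂ 2 (volume : Measure (E d)))
  rw [eLpNorm_lt_top_iff_lintegral_rpow_enorm_lt_top (by norm_num) (by norm_num)] at this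
  simp only [ENNReal.toReal_ofNat, ENNReal.rpow_ofNat] at this
  exact this

/-- The Fourier transform of a real function has a measurable representative that is Hermitian at
every point. -/
lemma exists_hermitian_rep (f : L2 d) :
    ∃ p : E d → ℂ, Measurable p ∧ Hermitian p ∧ ft f =ᵐ[volume] p := by
  refine ⟨fun η => (ft f η + conj (ft f (-η))) / 2, ?_, fun η => ?_, ?_⟩
  · have := measurable_ft f
    have h2 : Measurable fun η => conj (ft f (-η)) :=
      Complex.continuous_conj.measurable.comp (this.comp measurable_neg)
    fun_prop
  · simp only [neg_neg, map_div₀, map_add, Complex.conj_conj]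
    rw [add_comm, map_ofNat]
  · filter_upwards [ft_hermitian f] with η hη
    rw [← hη]; ring

section Existence

variable {h₀ : L2 d} {p₀ : E d → ℂ} {σ : ℝ≥0∞}

lemma lintegral_fourierSol_le (hp₀ : Measurable p₀)
    (hS : Subcritical 1 1 (fun η => ‖p₀ η‖ₑ) (∫⁻ η, efreq η ^ 2 * ‖p₀ η‖ₑ) σ) {t : ℝ}
    (ht : 0 ≤ t) :
    (∫⁻ η, efreq η ^ 2 * ‖fourierSol p₀ t η‖ₑ) +
      σ * (∫⁻ τ in Set.Ioc 0 t, ∫⁻ η, efreq η ^ 6 * ‖fourierSol p₀ τ η‖ₑ) ≤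
        ∫⁻ η, efreq η ^ 2 * ‖p₀ η‖ₑ := by
  refine le_trans (add_le_add ?_ (mul_le_mul' le_rfl ?_)) (hS.energy ht)
  · exact lintegral_mono fun η => mul_le_mul' le_rfl (enorm_fourierSol_le hp₀ t η)
  · exact lintegral_mono fun τ => lintegral_mono fun η =>
      mul_le_mul' le_rfl (enorm_fourierSol_le hp₀ τ η)

lemma continuousOn_of_ft_eq [NeZero d] (hp₀ : Measurable p₀)
    (hS : Subcritical 1 1 (fun η => ‖p₀ η‖ₑ) (∫⁻ η, efreq η ^ 2 * ‖p₀ η‖ₑ) σ)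
    (h2 : ∫⁻ η, ‖p₀ η‖ₑ ^ 2 < ∞) {h : ℝ → L2 d}
    (hh : ∀ t, 0 ≤ t → ft (h t) =ᵐ[volume] fourierSol p₀ t) : ContinuousOn h (Set.Ici 0) := by
  intro t₀ ht₀
  have h1 := tendsto_lintegral_sq_fourierSol hp₀ hS h2 ht₀
  have h3 : Tendsto (fun t => ‖h t - h t₀‖ₑ ^ 2) (𝓝[Set.Ici 0] t₀) (𝓝 0) := by
    refine h1.congr' ?_
    filter_upwards [self_mem_nhdsWithin] with t ht
    rw [enorm_sub_eq_lintegral]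
    refine lintegral_congr_ae ?_
    filter_upwards [hh t ht, hh t₀ ht₀] with η e1 e2
    rw [e1, e2]
  have h4 : Tendsto (fun t => (‖h t - h t₀‖ₑ ^ 2) ^ (1 / 2 : ℝ)) (𝓝[Set.Ici 0] t₀)
      (𝓝 (0 ^ (1 / 2 : ℝ))) := (ENNReal.continuous_rpow_const.tendsto _).comp h3
  rw [ENNReal.zero_rpow_of_pos (by norm_num)] at h4
  rw [ContinuousWithinAt, tendsto_iff_edist_tendsto_0]
  refine h4.congr fun t => ?_
  rw [edist_eq_enorm_sub, ← ENNReal.rpow_natCast, ← ENNReal.rpow_mul]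
  norm_num

lemma solvesPDE_of_ft_eq [NeZero d] (hp₀ : Measurable p₀) (hH : Hermitian p₀)
    (hft : ft h₀ =ᵐ[volume] p₀)
    (hS : Subcritical 1 1 (fun η => ‖p₀ η‖ₑ) (∫⁻ η, efreq η ^ 2 * ‖p₀ η‖ₑ) σ)
    {h : ℝ → L2 d} (hh : ∀ t, 0 ≤ t → ft (h t) =ᵐ[volume] fourierSol p₀ t) : SolvesPDE h₀ h := by
  have hm := measurable_fourierSol hp₀
  have hmt := measurable_fourierSol_apply hp₀
  have hY : ∀ τ, 0 ≤ τ → ∫⁻ η, efreq η ^ 2 * ‖fourierSol p₀ τ η‖ₑ ≤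
      ∫⁻ η, efreq η ^ 2 * ‖p₀ η‖ₑ := fun τ hτ =>
    le_self_add.trans (lintegral_fourierSol_le hp₀ hS hτ)
  have hfin : ∀ τ, 0 ≤ τ → ∫⁻ η, efreq η ^ 2 * ‖fourierSol p₀ τ η‖ₑ < ∞ := fun τ hτ =>
    (hY τ hτ).trans_lt hS.ne_top.lt_top
  have hHt := hermitian_fourierSol hH
  have hae := hS.ae_majSup_ne_top
  have hode := fun η (hη : efreq η ≠ 0 ∧ majSup 1 1 (fun η => ‖p₀ η‖ₑ) η ≠ ∞) t
    (ht : (0 : ℝ) ≤ t) => fourierSol_eq_sub_integral hp₀ hη.1 hη.2 ht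
  generalize fourierSol p₀ = P at *
  have hlapl : ∀ τ, 0 ≤ τ → IsWeakLaplacian (h τ) fun x => -(𝓕⁻ (lapl (P τ)) x).re :=
    fun τ hτ => isWeakLaplacian_fourierInv (hmt τ) (hHt τ) (hh τ hτ) (hfin τ hτ)
  refine ⟨fun τ x => -(𝓕⁻ (lapl (P τ)) x).re, hlapl, fun φ t ht => ?_⟩
  obtain ⟨h1, h2⟩ := integral_time_exp_laplacian hm hS.ne_top hY
    (fun τ hτ => (hlapl τ hτ).ae_eq (hmt τ) (hh τ hτ) (hfin τ hτ)) φ ht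
  refine ⟨h1, ?_⟩
  rw [h2, integral_mul_eq_integral_ft_mul, integral_mul_eq_integral_ft_mul, ← sub_eq_add_neg]
  have i1 : Integrable fun η => ft h₀ η * (𝓕⁻ φ) η := by
    exact (Lp.memLp (𝓕 (toComplex h₀) : Lp ℂ 2 (volume : Measure (E d)))).integrable_mul
      ((𝓕⁻ φ).memLp 2)
  have i2 : Integrable fun η =>
      (∫ τ in Set.Ioc 0 t, ((freq η ^ 2 : ℝ) : ℂ) * nonlin (P τ) η) * (𝓕⁻ φ) η := by
    refine (integrable_nonlin_mul_schwartz (t := t) hm hS.ne_top hY φ).integral_prod_right.congr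
      (ae_of_all _ fun η => ?_)
    simp only
    rw [integral_mul_const]
  rw [← integral_sub i1 i2]
  refine integral_congr_ae ?_
  filter_upwards [hh t ht, hft, hae] with η e1 e2 e3
  rw [e1, e2, hode η e3 t ht, ← sub_mul]
  congr 2
  refine integral_congr_ae (ae_of_all _ fun τ => ?_)
  simp only [nonlin, lapl]
  push_cast; ring

/-- The energy inequality, transferred to the norms of the problem. -/
lemma energy_of_ft_eq (hp₀ : Measurable p₀) (hft : ft h₀ =ᵐ[volume] p₀)
    (hS : Subcritical 1 1 (fun η => ‖p₀ η‖ₑ) (∫⁻ η, efreq η ^ 2 * ‖p₀ η‖ₑ) σ)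
    {h : ℝ → L2 d} (hh : ∀ t, 0 ≤ t → ft (h t) =ᵐ[volume] fourierSol p₀ t) {t : ℝ} (ht : 0 ≤ t) :
    sNorm 2 (h t) + σ * ∫⁻ τ in Set.Icc 0 t, sNorm 6 (h τ) ≤ sNorm 2 h₀ := by
  have e : ∀ (n : ℕ) τ, 0 ≤ τ → sNorm n (h τ) =
      scaleConst d * ∫⁻ η, efreq η ^ n * ‖fourierSol p₀ τ η‖ₑ := fun n τ hτ => by
    rw [sNorm_natCast]
    congr 1
    refine lintegral_congr_ae ?_
    filter_upwards [hh τ hτ] with η hη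
    rw [hη]
  have e0 : sNorm 2 h₀ = scaleConst d * ∫⁻ η, efreq η ^ 2 * ‖p₀ η‖ₑ := by
    rw [show (2 : ℝ) = ((2 : ℕ) : ℝ) by norm_num, sNorm_natCast]
    congr 1
    refine lintegral_congr_ae ?_
    filter_upwards [hft] with η hη
    rw [hη]
  have e2 := e 2 t ht
  have e6 : ∫⁻ τ in Set.Icc 0 t, sNorm 6 (h τ) =
      scaleConst d * ∫⁻ τ in Set.Ioc 0 t, ∫⁻ η, efreq η ^ 6 * ‖fourierSol p₀ τ η‖ₑ := by
    rw [setLIntegral_congr Ioc_ae_eq_Icc.symm, ← lintegral_const_mul' _ _ scaleConst_ne_top]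
    refine setLIntegral_congr_fun measurableSet_Ioc fun τ hτ => ?_
    have := e 6 τ hτ.1.le
    push_cast at this
    exact this
  push_cast at e2
  rw [e2, e6, e0]
  calc _ = scaleConst d * ((∫⁻ η, efreq η ^ 2 * ‖fourierSol p₀ t η‖ₑ) +
      σ * (∫⁻ τ in Set.Ioc 0 t, ∫⁻ η, efreq η ^ 6 * ‖fourierSol p₀ τ η‖ₑ)) := by ring
    _ ≤ _ := mul_le_mul' le_rfl (lintegral_fourierSol_le hp₀ hS ht)

/-- Continuity in time of the solution, with the analytic weight. -/
lemma continuousInAnalytic_of_ft_eq [NeZero d] (hp₀ : Measurable p₀)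
    (hS : Subcritical 1 1 (fun η => ‖p₀ η‖ₑ) (∫⁻ η, efreq η ^ 2 * ‖p₀ η‖ₑ) σ) {h : ℝ → L2 d}
    (hh : ∀ t, 0 ≤ t → ft (h t) =ᵐ[volume] fourierSol p₀ t) {s : ℝ} {ν : ℝ → ℝ}
    (hν : ContinuousOn ν (Set.Ici 0)) {B : E d → ℝ≥0∞} (hB : ∫⁻ η, B η < ∞)
    (hle : ∀ t : ℝ, 0 ≤ t → ∀ η, ENNReal.ofReal (freq η ^ s * Real.exp (ν t * freq η)) *
      solMaj p₀ t η ≤ B η) : ContinuousInAnalytic s ν h := by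
  have hle' : ∀ t : ℝ, 0 ≤ t → ∀ η, ENNReal.ofReal (freq η ^ s * Real.exp (ν t * freq η)) *
      ‖fourierSol p₀ t η‖ₑ ≤ B η := fun t ht η =>
    (mul_le_mul' le_rfl (enorm_fourierSol_le hp₀ t η)).trans (hle t ht η)
  have hmt := measurable_fourierSol_apply hp₀
  have hcont := fun η (hη : efreq η ≠ 0 ∧ majSup 1 1 (fun η => ‖p₀ η‖ₑ) η ≠ ∞) =>
    continuousOn_fourierSol hp₀ hη.1 hη.2
  have hae := hS.ae_majSup_ne_top
  generalize fourierSol p₀ = P at *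
  have hen : ∀ t η, ‖((freq η ^ s * Real.exp (ν t * freq η) : ℝ) : ℂ) * P t η‖ₑ =
      ENNReal.ofReal (freq η ^ s * Real.exp (ν t * freq η)) * ‖P t η‖ₑ := fun t η => by
    have := freq_nonneg η
    rw [enorm_mul, ← ofReal_norm (((_ : ℝ) : ℂ)), Complex.norm_real,
      Real.norm_of_nonneg (by positivity)]
  refine ⟨fun t ht => ?_, fun t₀ ht₀ => ?_⟩
  · rw [analyticNorm_eq]
    refine ENNReal.mul_lt_top scaleConst_ne_top.lt_top (lt_of_le_of_lt ?_ hB)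
    refine lintegral_mono_ae ?_
    filter_upwards [hh t ht] with η hη
    rw [hη]; exact hle' t ht η
  · have h1 : Tendsto (fun t => ∫⁻ η, ‖((freq η ^ s * Real.exp (ν t * freq η) : ℝ) : ℂ) * P t η -
        ((freq η ^ s * Real.exp (ν t₀ * freq η) : ℝ) : ℂ) * P t₀ η‖ₑ) (𝓝[Set.Ici 0] t₀) (𝓝 0) := by
      rw [show (0 : ℝ≥0∞) = ∫⁻ _ : E d, 0 by simp]
      refine tendsto_lintegral_filter_of_dominated_convergence (fun η => 2 * B η) ?_ ?_ ?_ ?_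
      · refine Eventually.of_forall fun t => ?_
        have h1 := hmt t
        have h2 := hmt t₀
        fun_prop
      · filter_upwards [self_mem_nhdsWithin] with t ht
        refine ae_of_all _ fun η => ?_
        refine enorm_sub_le.trans ?_
        rw [hen, hen, two_mul]
        exact add_le_add (hle' t ht η) (hle' t₀ ht₀ η)
      · rw [lintegral_const_mul' _ _ (by norm_num)]
        exact ENNReal.mul_ne_top (by norm_num) hB.ne
      · filter_upwards [hae] with η hη
        have hc : Tendsto (fun t => ((freq η ^ s * Real.exp (ν t * freq η) : ℝ) : ℂ) * P t η)
            (𝓝[Set.Ici 0] t₀)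
            (𝓝 (((freq η ^ s * Real.exp (ν t₀ * freq η) : ℝ) : ℂ) * P t₀ η)) := by
          have h2 : ContinuousOn (fun t =>
              ((freq η ^ s * Real.exp (ν t * freq η) : ℝ) : ℂ) * P t η) (Set.Ici 0) := by
            have := hcont η hη
            fun_prop
          exact h2 t₀ ht₀
        have := (hc.sub_const (((freq η ^ s * Real.exp (ν t₀ * freq η) : ℝ) : ℂ) * P t₀ η)).enorm
        simpa using this
    have h2 := ENNReal.Tendsto.const_mul (a := scaleConst d) h1 (Or.inr scaleConst_ne_top)
    rw [mul_zero] at h2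
    refine h2.congr' ?_
    filter_upwards [self_mem_nhdsWithin] with t ht
    rw [lintegral_analyticWeight_sub]
    congr 1
    refine lintegral_congr_ae ?_
    filter_upwards [hh t ht, hh t₀ ht₀] with η e1 e2
    rw [e1, e2]

end Existence

/-! ### Uniqueness -/

/-- A continuous curve in `L²` has a representative that is jointly measurable, namely the limit of
its averages over small balls. -/
lemma exists_measurable_rep {F : ℝ → Lp ℂ 2 (volume : Measure (E d))} (hF : Continuous F) :
    ∃ P : ℝ → E d → ℂ, (Measurable fun p : ℝ × E d => P p.1 p.2) ∧ ∀ t, F t =ᵐ[volume] P t := by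
  -- `A n` is continuous in time for fixed `η` and measurable in `η` for fixed time
  let A : ℕ → ℝ → E d → ℂ := fun n t η => ⨍ y in Metric.closedBall η (1 / ((n : ℝ) + 1)), F t y
  have hA : ∀ n, Measurable fun p : ℝ × E d => A n p.1 p.2 := fun n => by
    refine measurable_uncurry_of_continuous_of_measurable (u := A n) (fun η => ?_) fun t => ?_
    · simp only [A, setAverage_eq]
      refine Continuous.const_smul ?_ _
      simp_rw [← L2.inner_indicatorConstLp_one (𝕜 := ℂ)
        (Metric.isClosed_closedBall (x := η) (ε := 1 / ((n : ℝ) + 1))).measurableSet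
        measure_closedBall_lt_top.ne]
      fun_prop
    · simp only [A, setAverage_eq, measureReal_def, Measure.addHaar_closedBall_center]
      refine Measurable.const_smul ?_ _
      have e : ∀ η : E d, ∫ y in Metric.closedBall η (1 / ((n : ℝ) + 1)), F t y =
          ∫ y, {q : E d × E d | dist q.2 q.1 ≤ 1 / ((n : ℝ) + 1)}.indicator (fun q => F t q.2)
            (η, y) := fun η => by
        rw [← integral_indicator Metric.isClosed_closedBall.measurableSet]
        refine integral_congr_ae (ae_of_all _ fun τ => ?_)
        simp [Set.indicator]
      simp_rw [e]
      refine (StronglyMeasurable.integral_prod_right' (Measurable.stronglyMeasurable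
        (Measurable.indicator ((Lp.stronglyMeasurable (F t)).measurable.comp measurable_snd)
          ?_))).measurable
      exact measurableSet_le (by fun_prop) measurable_const
  refine ⟨fun t η => limUnder atTop fun n => A n t η,
    (StronglyMeasurable.limUnder fun n => (hA n).stronglyMeasurable).measurable, fun t => ?_⟩
  filter_upwards [IsUnifLocDoublingMeasure.ae_tendsto_average volume
    (Lp.locallyIntegrable_two (F t)) 1] with η hη
  refine (Tendsto.limUnder_eq (hη (fun _ => η) (fun n : ℕ => 1 / ((n : ℝ) + 1)) ?_ ?_)).symm
  · exact tendsto_nhdsWithin_iff.2 ⟨tendsto_one_div_add_atTop_nhds_zero_nat,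
      Eventually.of_forall fun n => by simp only [Set.mem_Ioi]; positivity⟩
  · exact Eventually.of_forall fun n => Metric.mem_closedBall_self (by positivity)

lemma locallyIntegrable_integral_nonlin {P : ℝ → E d → ℂ} {Y : ℝ≥0∞} {t : ℝ}
    (hP : Measurable fun p : ℝ × E d => P p.1 p.2) (hYt : Y ≠ ∞)
    (hY : ∀ τ, 0 ≤ τ → ∫⁻ η, efreq η ^ 2 * ‖P τ η‖ₑ ≤ Y) :
    LocallyIntegrable fun η : E d =>
      ∫ τ in Set.Ioc 0 t, ((freq η ^ 2 : ℝ) : ℂ) * nonlin (P τ) η := by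
  have h := (integrable_nonlin (t := t) hP hYt hY).integral_prod_right.locallyIntegrable
  have h2 : Continuous fun η : E d => ((freq η ^ 2 : ℝ) : ℂ) := by
    have := continuous_freq (d := d)
    fun_prop
  refine (h.locallyIntegrableOn Set.univ |>.continuousOn_smul isClosed_univ.isLocallyClosed
    h2.continuousOn |> locallyIntegrableOn_univ.1).congr (ae_of_all _ fun η => ?_)
  simp only [smul_eq_mul]
  rw [integral_const_mul]

/-- Every solution has a jointly measurable Fourier transform that satisfies the integrated
equation at each time and almost every frequency. -/
lemma IsGlobalSolution.exists_fourier {h₀ : L2 d} {g : ℝ → L2 d} (hg : IsGlobalSolution h₀ g)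
    (hfin : sNorm 2 h₀ ≠ ∞) :
    ∃ P : ℝ → E d → ℂ, (Measurable fun p : ℝ × E d => P p.1 p.2) ∧
      (∀ t, 0 ≤ t → ft (g t) =ᵐ[volume] P t) ∧
      (∀ t, 0 ≤ t → ∫⁻ η, efreq η ^ 2 * ‖P t η‖ₑ ≤ sNorm 2 h₀) ∧
      ∀ t, 0 ≤ t → ∀ᵐ η, P t η = ft h₀ η -
        ∫ τ in Set.Ioc 0 t, ((freq η ^ 2 : ℝ) : ℂ) * nonlin (P τ) η := by
  -- nothing is known about `g` at negative times, so times are clamped at zero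
  let F : ℝ → Lp ℂ 2 (volume : Measure (E d)) := fun t => 𝓕 (toComplex (g (max t 0)))
  have hF : Continuous F := by
    have h1 : Continuous fun t => g (max t 0) :=
      hg.continuousOn.comp_continuous (by fun_prop) fun t => Set.mem_Ici.2 (le_max_right _ _)
    have h2 : Continuous (toComplex (d := d)) :=
      (Complex.ofRealCLM.compLpL 2 (volume : Measure (E d))).continuous
    have h3 : Continuous fun f : Lp ℂ 2 (volume : Measure (E d)) => (𝓕 f : Lp ℂ 2 _) :=
      (Lp.fourierTransformₗᵢ (E d) ℂ).continuous
    exact h3.comp (h2.comp h1)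
  obtain ⟨P, hP, hFP⟩ := exists_measurable_rep hF
  have hgP : ∀ t, 0 ≤ t → ft (g t) =ᵐ[volume] P t := fun t ht => by
    have := hFP t
    simp only [F, max_eq_left ht] at this
    exact this
  have hY : ∀ t, 0 ≤ t → ∫⁻ η, efreq η ^ 2 * ‖P t η‖ₑ ≤ sNorm 2 h₀ := fun t ht => by
    have h1 := le_self_add.trans (hg.energy t ht)
    rw [show (2 : ℝ) = ((2 : ℕ) : ℝ) by norm_num, sNorm_natCast] at h1
    refine le_trans ?_ (le_trans (le_mul_of_one_le_left zero_le one_le_scaleConst) h1)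
    refine lintegral_mono_ae ?_
    filter_upwards [hgP t ht] with η hη
    rw [hη]
  refine ⟨P, hP, hgP, hY, fun t ht => ?_⟩
  obtain ⟨w, hw, hweak⟩ := hg.equation
  have hloc := locallyIntegrable_integral_nonlin (t := t) hP hfin hY
  have key : ft (g t) =ᵐ[volume] fun η => ft h₀ η -
        ∫ τ in Set.Ioc 0 t, ((freq η ^ 2 : ℝ) : ℂ) * nonlin (P τ) η := by
    refine ae_eq_of_forall_integral_mul_schwartz (Lp.locallyIntegrable_two _)
      ((Lp.locallyIntegrable_two _).sub hloc) fun ψ _ => ?_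
    have h1 := (hweak (𝓕 ψ) t ht).2
    rw [(integral_time_exp_laplacian hP hfin hY (fun τ hτ => (hw τ hτ).ae_eq
      (measurable_comp_right hP τ) (hgP τ hτ) ((hY τ hτ).trans_lt hfin.lt_top)) (𝓕 ψ) ht).2,
      integral_mul_eq_integral_ft_mul, integral_mul_eq_integral_ft_mul,
      FourierTransform.fourierInv_fourier_eq, ← sub_eq_add_neg] at h1
    rw [h1]
    have i1 : Integrable fun η => ft h₀ η * ψ η :=
      (Lp.memLp (𝓕 (toComplex h₀) : Lp ℂ 2 (volume : Measure (E d)))).integrable_mul (ψ.memLp 2)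
    have i2 : Integrable fun η =>
        (∫ τ in Set.Ioc 0 t, ((freq η ^ 2 : ℝ) : ℂ) * nonlin (P τ) η) * ψ η := by
      have := (integrable_nonlin_mul_schwartz (t := t) hP hfin hY (𝓕 ψ)).integral_prod_right
      rw [FourierTransform.fourierInv_fourier_eq] at this
      refine this.congr (ae_of_all _ fun η => ?_)
      simp only
      rw [integral_mul_const]
    rw [← integral_sub i1 i2]
    simp only [sub_mul]
  filter_upwards [key, hgP t ht] with η h1 h2
  rw [← h2, h1]

lemma ae_integrableOn_convExp_lapl {P : ℝ → E d → ℂ} {Y : ℝ≥0∞}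
    (hP : Measurable fun p : ℝ × E d => P p.1 p.2) (hYt : Y ≠ ∞)
    (hY : ∀ τ, 0 ≤ τ → ∫⁻ η, efreq η ^ 2 * ‖P τ η‖ₑ ≤ Y) (T : ℝ) :
    ∀ᵐ η, IntegrableOn (fun τ => lapl (P τ) η) (Set.Ioc 0 T) ∧
      IntegrableOn (fun τ => convExp (lapl (P τ)) η) (Set.Ioc 0 T) := by
  have hni := (integrable_nonlin (t := T) hP hYt hY).prod_left_ae
  have hli : Integrable (fun p : ℝ × E d => lapl (P p.1) p.2)
      ((volume.restrict (Set.Ioc 0 T)).prod volume) := by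
    refine ⟨(measurable_lapl_param hP).aestronglyMeasurable, ?_⟩
    rw [HasFiniteIntegral, lintegral_prod _ (measurable_lapl_param hP).enorm.aemeasurable]
    calc _ ≤ ∫⁻ _ in Set.Ioc 0 T, Y := by
          refine setLIntegral_mono' measurableSet_Ioc fun τ hτ => ?_
          simpa only [enorm_lapl] using hY τ hτ.1.le
      _ < ∞ := by
          rw [setLIntegral_const]
          exact ENNReal.mul_lt_top hYt.lt_top (by simp)
  filter_upwards [hni, hli.prod_left_ae] with η e1 e2
  exact ⟨e2, (e1.sub e2).congr (ae_of_all _ fun τ => by simp [nonlin])⟩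

/-- A solution of the integrated equation solves Duhamel's formula almost everywhere in space and
time. -/
lemma ae_eq_duhamel {p₀ : E d → ℂ} {P : ℝ → E d → ℂ} {Y : ℝ≥0∞} [NeZero d] (hp₀ : Measurable p₀)
    (hP : Measurable fun p : ℝ × E d => P p.1 p.2) (hYt : Y ≠ ∞)
    (hY : ∀ τ, 0 ≤ τ → ∫⁻ η, efreq η ^ 2 * ‖P τ η‖ₑ ≤ Y)
    (h : ∀ t, 0 ≤ t → ∀ᵐ η, P t η = p₀ η -
        ∫ τ in Set.Ioc 0 t, ((freq η ^ 2 : ℝ) : ℂ) * nonlin (P τ) η) (T : ℝ) :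
    ∀ᵐ t ∂(volume.restrict (Set.Ioc 0 T)), ∀ᵐ η, P t η = duhamel p₀ P t η := by
  -- the right-hand side `R` is a representative of `P` for which the equation holds at every time
  set R : ℝ → E d → ℂ := fun t η => p₀ η -
        ∫ τ in Set.Ioc 0 t, ((freq η ^ 2 : ℝ) : ℂ) * nonlin (P τ) η with hR
  have hRm : Measurable fun p : ℝ × E d => R p.1 p.2 := by
    refine (hp₀.comp measurable_snd).sub (measurable_integral_Ioc (f := fun q =>
      ((freq q.1.2 ^ 2 : ℝ) : ℂ) * nonlin (P q.2) q.1.2) (Measurable.mul ?_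
        (measurable_comp_swap (Q := fun t => nonlin (P t)) (measurable_nonlin hP))))
    have := (continuous_freq (d := d)).measurable
    fun_prop
  have h1 : ∀ᵐ t ∂(volume.restrict (Set.Ioc 0 T)), ∀ᵐ η, P t η = R t η :=
    (ae_restrict_iff' measurableSet_Ioc).2 (ae_of_all _ fun t ht => h t ht.1.le)
  have h2 := (Measure.ae_ae_comm (p := fun t η => P t η = R t η)
    (measurableSet_eq_fun hP hRm)).1 h1
  refine (Measure.ae_ae_comm (p := fun t η => P t η = duhamel p₀ P t η)
    (measurableSet_eq_fun hP (measurable_duhamel hp₀ hP))).2 ?_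
  filter_upwards [h2, ae_integrableOn_convExp_lapl hP hYt hY T, ae_efreq_ne_zero] with η e1 ⟨e3, hG⟩ e4
  have hf4 : ((freq η ^ 2 : ℝ) : ℂ) ≠ 0 := by
    have : freq η ≠ 0 := fun h0 => e4 (by rw [efreq, h0, ENNReal.ofReal_zero])
    exact_mod_cast pow_ne_zero 2 this
  have hqi : IntegrableOn (fun τ => R τ η) (Set.Ioc 0 T) := by
    refine (e3.const_mul (((freq η ^ 2 : ℝ) : ℂ)⁻¹)).congr ?_
    filter_upwards [e1] with τ hτ
    rw [← hτ, lapl, inv_mul_cancel_left₀ hf4]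
  filter_upwards [e1, ae_restrict_mem measurableSet_Ioc] with t ht htT
  have hsub : Set.Ioc 0 t ⊆ Set.Ioc 0 T := Set.Ioc_subset_Ioc_right htT.2
  have := duhamel_of_eq_sub_integral (c := freq η ^ 4) (b := ((freq η ^ 2 : ℝ) : ℂ))
    (q := fun τ => R τ η) (q₀ := p₀ η)
    (pow_nonneg (freq_nonneg η) 4) (hG.mono_set hsub) (hqi.mono_set hsub)
    (fun τ hτ => by
      simp only [hR]
      congr 1
      refine integral_congr_ae ?_
      filter_upwards [ae_restrict_of_ae_restrict_of_subset
        (Set.Ioc_subset_Ioc_right (hτ.2.trans htT.2)) e1] with r hr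
      simp only [hR] at hr
      rw [← hr, nonlin, lapl]
      push_cast; ring) htT.1.le
  rw [ht, this, duhamel]
  simp only [rheat]

lemma enorm_duhamel_sub_duhamel_le {p₀ : E d → ℂ} {P P' : ℝ → E d → ℂ} {t : ℝ} {η : E d}
    (hG : IntegrableOn (fun τ => convExp (lapl (P τ)) η) (Set.Ioc 0 t))
    (hG' : IntegrableOn (fun τ => convExp (lapl (P' τ)) η) (Set.Ioc 0 t)) :
    ‖duhamel p₀ P t η - duhamel p₀ P' t η‖ₑ ≤ efreq η ^ 2 * ∫⁻ τ in Set.Ioc 0 t,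
      heat 1 (t - τ) η * ‖convExp (lapl (P τ)) η - convExp (lapl (P' τ)) η‖ₑ := by
  have e : duhamel p₀ P t η - duhamel p₀ P' t η = -(((freq η ^ 2 : ℝ) : ℂ) *
      ∫ τ in Set.Ioc 0 t, ((rheat (t - τ) η : ℝ) : ℂ) *
        (convExp (lapl (P τ)) η - convExp (lapl (P' τ)) η)) := by
    have h4 : 0 ≤ freq η ^ 4 := pow_nonneg (freq_nonneg η) 4
    have h := integral_sub (integrableOn_exp_mul h4 hG) (integrableOn_exp_mul h4 hG')
    simp only [mul_sub]
    unfold duhamel rheat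
    rw [h]; ring
  rw [e, enorm_neg, enorm_mul, enorm_freq_sq]
  refine mul_le_mul' le_rfl ((enorm_integral_le_lintegral_enorm _).trans_eq ?_)
  simp only [enorm_mul, enorm_rheat]

/-- The Duhamel map contracts the norm `∫_0^T ∫ |ξ|² |p|` with factor `f₂(Y)`: the factor `|ξ|⁴` in
front of the nonlinearity is absorbed by the time integral of the heat kernel. -/
lemma lintegral_sub_le_of_ae_eq_duhamel {p₀ : E d → ℂ} {P P' : ℝ → E d → ℂ} {Y : ℝ≥0∞}
    (hP : Measurable fun p : ℝ × E d => P p.1 p.2) (hP' : Measurable fun p : ℝ × E d => P' p.1 p.2)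
    (hYt : Y ≠ ∞) (hY : ∀ τ, 0 ≤ τ → ∫⁻ η, efreq η ^ 2 * ‖P τ η‖ₑ ≤ Y)
    (hY' : ∀ τ, 0 ≤ τ → ∫⁻ η, efreq η ^ 2 * ‖P' τ η‖ₑ ≤ Y) {T : ℝ}
    (h : ∀ᵐ t ∂(volume.restrict (Set.Ioc 0 T)), ∀ᵐ η, P t η = duhamel p₀ P t η)
    (h' : ∀ᵐ t ∂(volume.restrict (Set.Ioc 0 T)), ∀ᵐ η, P' t η = duhamel p₀ P' t η) :
    ∫⁻ t in Set.Ioc 0 T, ∫⁻ η, efreq η ^ 2 * ‖P t η - P' t η‖ₑ ≤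
      ef₂ Y * ∫⁻ t in Set.Ioc 0 T, ∫⁻ η, efreq η ^ 2 * ‖P t η - P' t η‖ₑ := by
  set D : ℝ → E d → ℝ≥0∞ := fun τ η => ‖convExp (lapl (P τ)) η - convExp (lapl (P' τ)) η‖ₑ with hD
  have hDm : Measurable fun p : ℝ × E d => D p.1 p.2 :=
    ((measurable_convExp_lapl hP).sub (measurable_convExp_lapl hP')).enorm
  have hker : ∀ η, Measurable fun p : ℝ × ℝ => heat 1 (p.1 - p.2) η * D p.2 η := fun η =>
    (by fun_prop : Measurable fun p : ℝ × ℝ => heat 1 (p.1 - p.2) η).mul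
      ((measurable_comp_left hDm η).comp measurable_snd)
  have hkm : Measurable fun p : ℝ × E d => ∫⁻ τ in Set.Ioc 0 p.1,
      heat 1 (p.1 - τ) p.2 * D τ p.2 := by
    have e : ∀ p : ℝ × E d, ∫⁻ τ in Set.Ioc 0 p.1, heat 1 (p.1 - τ) p.2 * D τ p.2 =
        ∫⁻ τ, {q : (ℝ × E d) × ℝ | 0 < q.2 ∧ q.2 ≤ q.1.1}.indicator
          (fun q => heat 1 (q.1.1 - q.2) q.1.2 * D q.2 q.1.2) (p, τ) := fun p => by
      rw [← lintegral_indicator measurableSet_Ioc]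
      refine lintegral_congr fun τ => ?_
      simp [Set.indicator]
    simp_rw [e]
    refine Measurable.lintegral_prod_right' (Measurable.indicator
      (Measurable.mul (by fun_prop) (measurable_comp_swap hDm))
      ((measurableSet_lt measurable_const measurable_snd).inter
        (measurableSet_le measurable_snd (measurable_fst.comp measurable_fst))))
  have hint := ae_integrableOn_convExp_lapl hP hYt hY T
  have hint' := ae_integrableOn_convExp_lapl hP' hYt hY' T
  calc ∫⁻ t in Set.Ioc 0 T, ∫⁻ η, efreq η ^ 2 * ‖P t η - P' t η‖ₑ
      ≤ ∫⁻ t in Set.Ioc 0 T, ∫⁻ η, efreq η ^ 4 *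
          ∫⁻ τ in Set.Ioc 0 t, heat 1 (t - τ) η * D τ η := by
        refine lintegral_mono_ae ?_
        filter_upwards [h, h', ae_restrict_mem measurableSet_Ioc] with t e e' ht
        refine lintegral_mono_ae ?_
        filter_upwards [e, e', hint, hint'] with η e1 e2 e3 e4
        have hsub : Set.Ioc 0 t ⊆ Set.Ioc 0 T := Set.Ioc_subset_Ioc_right ht.2
        have := enorm_duhamel_sub_duhamel_le (p₀ := p₀) (e3.2.mono_set hsub) (e4.2.mono_set hsub)
        rw [← e1, ← e2] at this
        refine (mul_le_mul' le_rfl this).trans_eq ?_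
        rw [← mul_assoc, ← pow_add]
    _ = ∫⁻ η, ∫⁻ t in Set.Ioc 0 T, efreq η ^ 4 *
          ∫⁻ τ in Set.Ioc 0 t, heat 1 (t - τ) η * D τ η :=
        lintegral_lintegral_swap (Measurable.aemeasurable (by fun_prop))
    _ ≤ ∫⁻ η, ∫⁻ τ in Set.Ioc 0 T, D τ η := by
        refine lintegral_mono fun η => ?_
        rw [lintegral_const_mul _ (measurable_comp_left
          (Q := fun t η => ∫⁻ τ in Set.Ioc 0 t, heat 1 (t - τ) η * D τ η) hkm η),
          setLIntegral_triangle (f := fun t τ => heat 1 (t - τ) η * D τ η) (hker η),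
          ← lintegral_const_mul' (efreq η ^ 4) _ (ENNReal.pow_ne_top ENNReal.ofReal_ne_top)]
        refine lintegral_mono fun τ => ?_
        have hb := setLIntegral_heat_le_one (lam := 1) zero_le_one τ T η
        rw [ENNReal.ofReal_one, one_mul] at hb
        rw [lintegral_mul_const _ (by fun_prop), ← mul_assoc]
        exact mul_le_of_le_one_left zero_le hb
    _ = ∫⁻ τ in Set.Ioc 0 T, ∫⁻ η, D τ η :=
        lintegral_lintegral_swap (hDm.comp measurable_swap).aemeasurable
    _ ≤ ∫⁻ τ in Set.Ioc 0 T, ef₂ Y * ∫⁻ η, efreq η ^ 2 * ‖P τ η - P' τ η‖ₑ := by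
        refine setLIntegral_mono' measurableSet_Ioc fun τ hτ => ?_
        refine (lintegral_enorm_convExp_sub_le (measurable_lapl (measurable_comp_right hP τ))
          (measurable_lapl (measurable_comp_right hP' τ)) hYt
          (by simpa only [enorm_lapl] using hY τ hτ.1.le)
          (by simpa only [enorm_lapl] using hY' τ hτ.1.le)).trans_eq ?_
        congr 1
        refine lintegral_congr fun η => ?_
        rw [lapl, lapl, ← mul_sub, enorm_mul, enorm_freq_sq]
    _ = _ := lintegral_const_mul' _ _ (ef₂_ne_top hYt)

/-- Solutions with small initial datum are unique. -/
theorem IsGlobalSolution.eq [NeZero d] {h₀ : L2 d} {g g' : ℝ → L2 d} (hg : IsGlobalSolution h₀ g)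
    (hg' : IsGlobalSolution h₀ g') (hfin : sNorm 2 h₀ ≠ ∞) (hsmall : ef₂ (sNorm 2 h₀) < 1) {t : ℝ}
    (ht : 0 ≤ t) : g t = g' t := by
  obtain ⟨P, hP, hgP, hY, hode⟩ := hg.exists_fourier hfin
  obtain ⟨P', hP', hgP', hY', hode'⟩ := hg'.exists_fourier hfin
  generalize sNorm 2 h₀ = Y at *
  rcases ht.eq_or_lt with rfl | ht0
  · rw [hg.initial, hg'.initial]
  have hX := lintegral_sub_le_of_ae_eq_duhamel hP hP' hfin hY hY'
    (ae_eq_duhamel (measurable_ft h₀) hP hfin hY hode t)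
    (ae_eq_duhamel (measurable_ft h₀) hP' hfin hY' hode' t)
  have hm : Measurable fun p : ℝ × E d => efreq p.2 ^ 2 * ‖P p.1 p.2 - P' p.1 p.2‖ₑ := by
    have := hP.sub hP'
    fun_prop
  have hXt : ∫⁻ τ in Set.Ioc 0 t, ∫⁻ η, efreq η ^ 2 * ‖P τ η - P' τ η‖ₑ ≠ ∞ := by
    refine ne_top_of_le_ne_top (b := ∫⁻ _ in Set.Ioc 0 t, (Y + Y)) ?_
      (setLIntegral_mono' measurableSet_Ioc fun τ hτ => ?_)
    · rw [setLIntegral_const]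
      exact ENNReal.mul_ne_top (by finiteness) (by simp)
    · have h1 := measurable_comp_right hP τ
      calc _ ≤ ∫⁻ η, (efreq η ^ 2 * ‖P τ η‖ₑ + efreq η ^ 2 * ‖P' τ η‖ₑ) :=
            lintegral_mono fun η => by
              rw [← mul_add]; exact mul_le_mul' le_rfl enorm_sub_le
        _ = (∫⁻ η, efreq η ^ 2 * ‖P τ η‖ₑ) + ∫⁻ η, efreq η ^ 2 * ‖P' τ η‖ₑ :=
            lintegral_add_left (by fun_prop) _
        _ ≤ _ := add_le_add (hY τ hτ.1.le) (hY' τ hτ.1.le)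
  have hX0 : ∫⁻ τ in Set.Ioc 0 t, ∫⁻ η, efreq η ^ 2 * ‖P τ η - P' τ η‖ₑ = 0 := by
    by_contra h0
    have := ENNReal.mul_lt_mul_left h0 hXt hsmall
    rw [one_mul] at this
    exact absurd hX (not_le.2 this)
  rw [lintegral_eq_zero_iff hm.lintegral_prod_right'] at hX0
  have hae : g =ᵐ[volume.restrict (Set.Ioc 0 t)] g' := by
    filter_upwards [hX0, ae_restrict_mem measurableSet_Ioc] with τ e hτ
    have hz := (lintegral_eq_zero_iff (measurable_comp_right
      (Q := fun τ η => efreq η ^ 2 * ‖P τ η - P' τ η‖ₑ) hm τ)).1 e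
    refine ft_injective ?_
    filter_upwards [hgP τ hτ.1.le, hgP' τ hτ.1.le, hz, ae_efreq_ne_zero] with η e1 e2 e3 e4
    rw [e1, e2]
    simpa [e4, sub_eq_zero] using e3
  have hsub : Set.Ioc 0 t ⊆ Set.Ici 0 := fun τ hτ => hτ.1.le
  exact Measure.eqOn_Ioc_of_ae_eq volume hae (hg.continuousOn.mono hsub) (hg'.continuousOn.mono hsub)
    ⟨ht0, le_rfl⟩

end ExpPDE

end

theorem theorem1p3 (d : ℕ) (hd : 1 ≤ d)
    (y : ℝ) (hy : 0 < y) (hfy : ExpPDE.f₂ y ≤ 1)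
    (s : ℝ) (hs : 0 ≤ s)
    (h₀ : ExpPDE.L2 d)
    (hsmall : ExpPDE.sNorm 2 h₀ < ENNReal.ofReal y)
    (hbesov : ExpPDE.besovNorm (-(d : ℝ)) h₀ < ∞)
    (hs1 : ExpPDE.sNorm s h₀ < ∞)
    (h22 : ExpPDE.FNorm 2 2 h₀ < ∞) :
    ∃ h : ℝ → ExpPDE.L2 d,
      ExpPDE.IsGlobalSolution h₀ h ∧
      (∀ g : ℝ → ExpPDE.L2 d, ExpPDE.IsGlobalSolution h₀ g → ∀ t : ℝ, 0 ≤ t → g t = h t) ∧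
      ∃ ν : ℝ → ℝ,
        ContinuousOn ν (Set.Ici 0) ∧ StrictMonoOn ν (Set.Ici 0) ∧
        ν 0 = 0 ∧ (∀ t : ℝ, 0 < t → 0 < ν t) ∧
        (∃ c C : ℝ, 0 < c ∧ 0 < C ∧ ∀ t : ℝ, 1 ≤ t →
          c * t ^ (1 / 4 : ℝ) ≤ ν t ∧ ν t ≤ C * t ^ (1 / 4 : ℝ)) ∧
        ExpPDE.ContinuousInAnalytic s ν h ∧
        ∃ C : ℝ, 0 < C ∧ ∀ t : ℝ, 0 ≤ t →
          ExpPDE.analyticNorm s (ν t) (h t) ≤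
            ENNReal.ofReal (C * (1 + t) ^ (-(s + (d : ℝ)) / 4)) := by
  open ExpPDE in
  have : NeZero d := ⟨by lia⟩
  obtain ⟨p₀, hp₀, hH, hft⟩ := exists_hermitian_rep h₀
  have hfin : sNorm 2 h₀ ≠ ∞ := hsmall.ne_top
  set M : ℝ := (sNorm 2 h₀).toReal with hM
  have hM0 : 0 ≤ M := ENNReal.toReal_nonneg
  have hMy : M < y := (ENNReal.lt_ofReal_iff_toReal_lt hfin).1 hsmall
  have hfM : f₂ M < 1 := (f₂_strictMonoOn hM0 hy.le hMy).trans_le hfy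
  have hMe : ENNReal.ofReal M = sNorm 2 h₀ := ENNReal.ofReal_toReal hfin
  have hef : ef₂ (sNorm 2 h₀) = ENNReal.ofReal (f₂ M) := by rw [← hMe, ef₂_ofReal hM0]
  have htr : ∀ w : E d → ℝ≥0∞, ∫⁻ η, w η * ‖p₀ η‖ₑ = ∫⁻ η, w η * ‖ft h₀ η‖ₑ := fun w => by
    refine lintegral_congr_ae ?_
    filter_upwards [hft] with η hη
    rw [hη]
  have hmom : ∫⁻ η, efreq η ^ 2 * ‖p₀ η‖ₑ ≤ sNorm 2 h₀ := by
    rw [htr, show (2 : ℝ) = ((2 : ℕ) : ℝ) by norm_num, sNorm_natCast]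
    exact le_mul_of_one_le_left zero_le one_le_scaleConst
  have hS : Subcritical 1 1 (fun η => ‖p₀ η‖ₑ) (∫⁻ η, efreq η ^ 2 * ‖p₀ η‖ₑ)
      (ENNReal.ofReal (1 - f₂ M)) :=
    { measurable := hp₀.enorm
      lam_pos := one_pos
      ne_top := ne_top_of_le_ne_top hfin hmom
      moment_le := by rw [one_mul]
      dissipation := by
        rw [one_mul]
        refine (add_le_add le_rfl ((ef₂_mono hmom).trans_eq hef)).trans_eq ?_
        rw [← ENNReal.ofReal_add (by linarith) (f₂_nonneg hM0), sub_add_cancel]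
      sigma_ne_zero := by
        rw [ne_eq, ENNReal.ofReal_eq_zero, not_le]
        linarith }
  have h2 : ∫⁻ η, ‖p₀ η‖ₑ ^ 2 < ∞ := by
    refine lt_of_le_of_lt (lintegral_mono_ae ?_) (lintegral_sq_ft_lt_top h₀)
    filter_upwards [hft] with η hη
    rw [hη]
  -- only times `t ≥ 0` matter; at negative times the solution is set to zero
  have hex : ∀ t : ℝ, ∃ f : L2 d, 0 ≤ t → ft f =ᵐ[volume] fourierSol p₀ t := fun t => by
    by_cases ht : 0 ≤ t
    · obtain ⟨f, hf⟩ := exists_ft_eq (memLp_fourierSol hp₀ hS h2 ht) (hermitian_fourierSol hH t)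
      exact ⟨f, fun _ => hf⟩
    · exact ⟨0, fun h => absurd h ht⟩
  choose h hh using hex
  have hsol : IsGlobalSolution h₀ h :=
    { initial := by
        refine ft_injective ?_
        filter_upwards [hh 0 le_rfl, hft, hS.ae_majSup_ne_top] with η e1 e2 e3
        rw [e1, e2, fourierSol_zero hp₀ e3.2]
      continuousOn := continuousOn_of_ft_eq hp₀ hS h2 hh
      equation := solvesPDE_of_ft_eq hp₀ hH hft hS hh
      energy := fun t ht => energy_of_ft_eq hp₀ hft hS hh ht }
  have hlow : LowFrequency fun η => ‖p₀ η‖ₑ := by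
    obtain ⟨K, hK, hle⟩ := lowFrequency_of_besovNorm hbesov
    refine ⟨K, hK, fun R hR => le_of_eq_of_le (lintegral_congr_ae ?_) (hle R hR)⟩
    filter_upwards [ae_restrict_of_ae hft] with η hη
    rw [hη]
  have hsfin : ∫⁻ η, ENNReal.ofReal (freq η ^ s) * ‖p₀ η‖ₑ < ∞ := by
    rw [htr fun η => ENNReal.ofReal (freq η ^ s)]
    rw [sNorm_eq] at hs1
    refine lt_of_le_of_lt (le_mul_of_one_le_left zero_le one_le_scaleConst) hs1
  obtain ⟨ν, hν, ⟨B, hB, hle⟩, C, hC, hdec⟩ := exists_analytic_bound (a := fun η => ‖p₀ η‖ₑ)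
    hp₀.enorm hs hM0 hfM (hmom.trans_eq hMe.symm) hsfin h2 hlow
  have hνc : Continuous fun t : ℝ => ν * t ^ (1 / 4 : ℝ) :=
    continuous_const.mul (Real.continuous_rpow_const (by norm_num))
  refine ⟨h, hsol, fun g hg t ht => hg.eq hsol hfin ?_ ht, fun t => ν * t ^ (1 / 4 : ℝ),
    hνc.continuousOn, ?_, ?_, fun t ht => by positivity, ⟨ν, ν, hν, hν, fun t _ => ⟨le_rfl, le_rfl⟩⟩,
    continuousInAnalytic_of_ft_eq hp₀ hS hh hνc.continuousOn hB hle,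
    (scaleConst d).toReal * C, ?_, fun t ht => ?_⟩
  · rw [hef]
    exact ENNReal.ofReal_lt_one.2 hfM
  · intro a ha b _ hab
    exact mul_lt_mul_of_pos_left (Real.rpow_lt_rpow ha hab (by norm_num)) hν
  · simp
  · exact mul_pos (ENNReal.toReal_pos (one_pos.trans_le one_le_scaleConst).ne' scaleConst_ne_top) hC
  · rw [analyticNorm_eq, mul_assoc, ENNReal.ofReal_mul ENNReal.toReal_nonneg,
      ENNReal.ofReal_toReal scaleConst_ne_top]
    refine mul_le_mul' le_rfl (le_trans (lintegral_mono_ae ?_) (hdec t ht))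
    filter_upwards [hh t ht] with η hη
    rw [hη]
    exact mul_le_mul' le_rfl (enorm_fourierSol_le hp₀ t η)
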